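/- Let $n\ge 0$, $k,\ell\ge 0$, $p\ge 1$ be integers with $k\le \ell+p-1$. **Notation.** For a real vector space $V$ let $\mathrm{Alt}^{k,\ell}(V)=\mathrm{Alt}^k(V)\otimes \mathrm{Alt}^\ell(V)$ be the space of alternating $k$-forms on $V$ with values in the alternating $\ell$-forms on $V$, and let $$\mathcal S_\dagger^{k,\ell}:\mathrm{Alt}^{k,\ell}\to \mathrm{Alt}^{k-1,\ell+1},\qquad \mathcal S_\dagger\omega(v_1,\dots,v_{k-1})(u_1,\dots,u_{\ell+1})=\sum_{j=1}^{\ell+1}(-1)^{j+1}\omega(u_j,v_1,\dots,v_{k-1})(u_1,\dots,\widehat{u_j},\dots,u_{\ell+1}),$$ with $\mathrm{Alt}^{k,\ell}=0$ if $k<0$, and $\mathcal S_{\dagger,[p]}=\mathcal S_\dagger\circ\cdots\circ\mathcal S_\dagger$ ($p$ factors) $:\mathrm{Alt}^{k,\ell}\to\mathrm{Alt}^{k-p,\ell+p}$. For a simplex $\sigma\subset\mathbb R^n$ with tangent space $T_\sigma$, a $(k,\ell)$-form on $\sigma$ is a function $\sigma\to \mathrm{Alt}^{k,\ell}(T_\sigma)$;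 $\mathcal P^-\mathrm{Alt}^{k,\ell}(\sigma)$ is the space of the $(k,\ell)$-forms $x\mapsto a+b(x-o,\cdot)$ with constant $a\in \mathrm{Alt}^{k,\ell}(T_\sigma)$, $b\in \mathrm{Alt}^{k+1,\ell}(T_\sigma)$ (this does not depend on the origin $o$ in the affine hull of $\sigma$). For a face $\tau$ of $\sigma$ (of any dimension, $\tau = \sigma$ allowed) the double trace $\iota_\tau^*\iota_\tau^*\omega$ is the restriction of $\omega$ to the points of $\tau$ and to arguments in $T_\tau$. Put $$\mathcal B^-\mathrm{Alt}^{k,\ell}(\sigma)=\{\omega\in\mathcal P^-\mathrm{Alt}^{k,\ell}(\sigma):\iota_\tau^*\iota_\tau^*\omega=0\ \text{for every proper face }\tau\text{ of }\sigma\},$$ $$\mathcal P^-\mathbb W^{k,\ell}_{[p]}(\sigma)=\ker \mathcal S_{\dagger,[p]}\big|_{\mathcal P^-\mathrm{Alt}^{k,\ell}(\sigma)},\qquad \mathcal B^-\mathbb W^{k,\ell}_{[p]}(\sigma)=\ker \mathcal S_{\dagger,[p]}\big|_{\mathcal B^-\mathrm{Alt}^{k,\ell}(\sigma)},$$ and let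 $\langle\cdot,\cdot\rangle_\sigma$ be the $L^2$ inner product on $\sigma$ (surface measure, Frobenius inner product on $\mathrm{Alt}^{k,\ell}(T_\sigma)$). **(1) Unisolvency.** For every simplex $K$ in $\mathbb R^n$ the degrees of freedom $\omega\mapsto\langle\iota_\sigma^*\iota_\sigma^*\omega,b\rangle_\sigma$, $b\in\mathcal B^-\mathbb W^{k,\ell}_{[p]}(\sigma)$, for all faces $\sigma$ of $K$ (including $K$), are unisolvent for the shape function space $\mathcal P^-\mathbb W^{k,\ell}_{[p]}(K)$: for any linear functionals $L_\sigma$ on $\mathcal B^-\mathbb W^{k,\ell}_{[p]}(\sigma)$ there is exactly one $\omega\in\mathcal P^-\mathbb W^{k,\ell}_{[p]}(K)$ with $\langle\iota_\sigma^*\iota_\sigma^*\omega,b\rangle_\sigma=L_\sigma(b)$ for all $\sigma$ and $b$. **(2) Conformity.** Let $\mathcal T$ be a geometric simplicial complex in $\mathbb R^n$. The finite element space, consisting of the families $(\omega_K)$, $\omega_K\in \mathcal P^-\mathbb W^{k,\ell}_{[p]}(K)$, $K$ ranging over the $n$-simplices of $\mathcal T$, whose degrees of freedom on common faces agree, is exactly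 the space of those families for which $\iota_\sigma^*\iota_\sigma^*\omega_K=\iota_\sigma^*\iota_\sigma^*\omega_{K'}$ for all $n$-simplices $K,K'$ and all common faces $\sigma$ of any dimension. **(3) Special cases.** * *Regge* ($k=\ell=p=1$, any $n$): on an $n$-simplex $K$, $\mathcal P^-\mathbb W^{1,1}(K)$ is the space of constant symmetric matrices $A$ via $\omega(v)(u)=v^{\mathsf T}Au$. There is one degree of freedom per edge, which vanishes iff $t^{\mathsf T}At=0$ for the edge tangent $t$, and none on other faces. The space in (2) consists of the piecewise constant symmetric matrix fields for which $t^{\mathsf T}At$ is single-valued on every edge. * *Hellan–Herrmann–Johnson* ($k=\ell=2$, $p=1$, $n=3$): on a tetrahedron $K$, $\mathcal P^-\mathbb W^{2,2}(K)$ is the space of constant symmetric matrices via $\omega(v_1,v_2)(u_1,u_2)=(v_1\times v_2)^{\mathsf T}A(u_1\times u_2)$. There is one degree of freedom per triangular face, which vanishes iff $\nu^{\mathsf T}A\nu=0$ for the face normal $\nu$; there are two interior ones, namely the moments against the constant symmetric matrices with vanishing normal-normal component on all faces; and there are none on edges and vertices. The space in (2) consists of the piecewise constant symmetric matrix fields for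 which $\nu^{\mathsf T}A\nu$ is single-valued on every triangular face. * *MCS* ($k=2$, $\ell=1$, $p=2$, $n=3$): on a tetrahedron $K$, $\mathcal P^-\mathbb W^{2,1}_{[2]}(K)$ is the space of constant trace-free matrices via $\omega(v_1,v_2)(u)=(v_1\times v_2)^{\mathsf T}Au$. There are two degrees of freedom per triangular face, which vanish iff $\nu^{\mathsf T}At=0$ for all tangent vectors $t$ of the face, and none elsewhere. The space in (2) consists of the piecewise constant trace-free matrix fields whose normal-tangential components $\nu^{\mathsf T}At$ are single-valued on every triangular face. -/

import Mathlib

open MeasureTheory Module Matrix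

noncomputable section

/-! ## Form-valued forms on a vector space -/

namespace FormValued

/-- `Alt^{k,ℓ}(V)`: alternating `k`-forms on `V` with values in the alternating `ℓ`-forms on `V`.
This is `Alt^k(V) ⊗ Alt^ℓ(V)`; one writes `ω (v₁, …, v_k) (u₁, …, u_ℓ)`. -/
abbrev AltForm (k ℓ : ℕ) (V : Type*) [AddCommGroup V] [Module ℝ V] : Type _ :=
  V [⋀^Fin k]→ₗ[ℝ] (V [⋀^Fin ℓ]→ₗ[ℝ] ℝ)

section Algebra

variable {V W : Type*} [AddCommGroup V] [Module ℝ V] [AddCommGroup W] [Module ℝ W] {k ℓ : ℕ}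

/-- The slot `u ↦ ω(u, v₁, …, v_k)` as an alternating function of `v₁, …, v_k`. -/
def firstSlot (ω : AltForm (k + 1) ℓ V) :
    V [⋀^Fin k]→ₗ[ℝ] (V →ₗ[ℝ] (V [⋀^Fin ℓ]→ₗ[ℝ] ℝ)) where
  toFun v :=
    { toFun := fun u => ω.curryLeft u v
      map_add' := fun u u' => by simp only [map_add, AlternatingMap.add_apply]
      map_smul' := fun c u => by simp only [map_smul, AlternatingMap.smul_apply, RingHom.id_apply] }
  map_update_add' v i x y := by
    ext u : 1
    exact (ω.curryLeft u).map_update_add v i x y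
  map_update_smul' v i c x := by
    ext u : 1
    exact (ω.curryLeft u).map_update_smul v i c x
  map_eq_zero_of_eq' v i j h hij := by
    ext u : 1
    exact (ω.curryLeft u).map_eq_zero_of_eq v h hij

/-- `𝒮_† : Alt^{k+1,ℓ} → Alt^{k,ℓ+1}`; see `SdagSucc_apply` for the explicit formula. -/
def SdagSucc (k ℓ : ℕ) (V : Type*) [AddCommGroup V] [Module ℝ V] :
    AltForm (k + 1) ℓ V →ₗ[ℝ] AltForm k (ℓ + 1) V where
  toFun ω := (AlternatingMap.alternatizeUncurryFinLM).compAlternatingMap (firstSlot ω)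
  map_add' ω η := by
    ext v u
    simp [firstSlot, AlternatingMap.alternatizeUncurryFin_apply, Finset.sum_add_distrib]
  map_smul' c ω := by
    ext v u
    simp only [LinearMap.compAlternatingMap_apply, RingHom.id_apply, AlternatingMap.smul_apply,
      AlternatingMap.alternatizeUncurryFinLM_apply, AlternatingMap.alternatizeUncurryFin_apply,
      Finset.smul_sum]
    refine Finset.sum_congr rfl fun i _ => ?_
    rw [smul_comm]
    rfl

/-- `(𝒮_† ω)(v₁,…,v_k)(u₀,…,u_ℓ) = ∑_j (-1)^j ω(u_j, v₁,…,v_k)(u₀,…,û_j,…,u_ℓ)`. -/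
theorem SdagSucc_apply (ω : AltForm (k + 1) ℓ V) (v : Fin k → V) (u : Fin (ℓ + 1) → V) :
    SdagSucc k ℓ V ω v u =
      ∑ j : Fin (ℓ + 1), (-1 : ℝ) ^ (j : ℕ) * ω (Matrix.vecCons (u j) v) (j.removeNth u) := by
  simp only [SdagSucc, firstSlot, LinearMap.coe_mk, AddHom.coe_mk,
    LinearMap.compAlternatingMap_apply, AlternatingMap.alternatizeUncurryFinLM_apply,
    AlternatingMap.alternatizeUncurryFin_apply]
  refine Finset.sum_congr rfl fun j _ => ?_
  rcases Nat.even_or_odd (j : ℕ) with h | h <;> simp [h.neg_one_pow]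

/-- `𝒮_†^{k,ℓ} : Alt^{k,ℓ} → Alt^{k-1,ℓ+1}`.  As `Alt^{-1,ℓ+1} = 0`, it is the zero map for `k = 0`
(the truncated index `0 - 1 = 0` in the codomain only ever receives this zero map). -/
def Sdag (V : Type*) [AddCommGroup V] [Module ℝ V] :
    (k ℓ : ℕ) → AltForm k ℓ V →ₗ[ℝ] AltForm (k - 1) (ℓ + 1) V
  | 0, _ => 0
  | k + 1, ℓ => SdagSucc k ℓ V

/-- The iterated operator
`𝒮_{†,[p]}^{k,ℓ} = 𝒮_†^{k-p+1,ℓ+p-1} ∘ ⋯ ∘ 𝒮_†^{k-1,ℓ+1} ∘ 𝒮_†^{k,ℓ} : Alt^{k,ℓ} → Alt^{k-p,ℓ+p}`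
(zero when `k < p`). -/
def SdagIter (V : Type*) [AddCommGroup V] [Module ℝ V] (k ℓ : ℕ) :
    (p : ℕ) → AltForm k ℓ V →ₗ[ℝ] AltForm (k - p) (ℓ + p) V
  | 0 => LinearMap.id
  | p + 1 => Sdag V (k - p) (ℓ + p) ∘ₗ SdagIter V k ℓ p

/-- Pullback of an `ℓ`-form along a linear map, as a linear map. -/
def pullAlt (ℓ : ℕ) (f : V →ₗ[ℝ] W) : (W [⋀^Fin ℓ]→ₗ[ℝ] ℝ) →ₗ[ℝ] (V [⋀^Fin ℓ]→ₗ[ℝ] ℝ) where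
  toFun η := η.compLinearMap f
  map_add' _ _ := rfl
  map_smul' _ _ := rfl

/-- Pullback in both indices: `(f^* f^* ω)(v₁,…)(u₁,…) = ω(f v₁,…)(f u₁,…)`. -/
def pullback (k ℓ : ℕ) (f : V →ₗ[ℝ] W) : AltForm k ℓ W →ₗ[ℝ] AltForm k ℓ V where
  toFun ω := (pullAlt ℓ f).compAlternatingMap (ω.compLinearMap f)
  map_add' _ _ := rfl
  map_smul' _ _ := rfl

theorem pullback_apply (f : V →ₗ[ℝ] W) (ω : AltForm k ℓ W) (v : Fin k → V) (u : Fin ℓ → V) :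
    pullback k ℓ f ω v u = ω (fun i => f (v i)) (fun j => f (u j)) := rfl

end Algebra

/-- The Frobenius inner product of `Alt^{k,ℓ}(V)`, for which the monomials `dx^I ⊗ dx^J` of an
orthonormal basis are orthonormal (each pair of increasing multi-indices is counted `k! ℓ!` times
in the sum over all tuples). -/
def frobInner {V : Type*} [NormedAddCommGroup V] [InnerProductSpace ℝ V] [FiniteDimensional ℝ V]
    {k ℓ : ℕ} (ω η : AltForm k ℓ V) : ℝ :=
  ((k.factorial : ℝ) * (ℓ.factorial : ℝ))⁻¹ *
    ∑ I : Fin k → Fin (finrank ℝ V), ∑ J : Fin ℓ → Fin (finrank ℝ V),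
      ω (fun i => stdOrthonormalBasis ℝ V (I i)) (fun j => stdOrthonormalBasis ℝ V (J j)) *
        η (fun i => stdOrthonormalBasis ℝ V (I i)) (fun j => stdOrthonormalBasis ℝ V (J j))

/-! ## Form-valued forms on a simplex -/

/-- `ℝⁿ`. -/
abbrev E (n : ℕ) : Type := EuclideanSpace ℝ (Fin n)

variable {n : ℕ}

/-- A finite set of points of `ℝⁿ` that is the vertex set of a simplex (of dimension `card - 1`).
The faces of the simplex are the nonempty subsets of the vertex set. -/
def IsSimplex (s : Finset (E n)) : Prop :=
  s.Nonempty ∧ AffineIndependent ℝ ((↑) : s → E n)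

/-- The closed simplex with vertex set `s`. -/
abbrev Cell (s : Finset (E n)) : Type := convexHull ℝ (s : Set (E n))

/-- The tangent space of the simplex with vertex set `s`. -/
abbrev Tan (s : Finset (E n)) : Submodule ℝ (E n) := vectorSpan ℝ (s : Set (E n))

/-- All `(k,ℓ)`-forms (functions with values in `Alt^{k,ℓ}` of the tangent space) on a simplex. -/
abbrev Field (k ℓ : ℕ) (s : Finset (E n)) : Type := Cell s → AltForm k ℓ (Tan s)

/-- The Euler vector field `x ↦ x - o` of the simplex with respect to an origin `o` in its
affine hull. -/
def euler (s : Finset (E n)) (o : affineSpan ℝ (s : Set (E n))) (x : Cell s) : Tan s :=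
  ⟨(x : E n) - (o : E n), by
    have hx : (x : E n) ∈ affineSpan ℝ (s : Set (E n)) := convexHull_subset_affineSpan _ x.2
    have h := AffineSubspace.vsub_mem_direction hx o.2
    rwa [direction_affineSpan] at h⟩

/-- `𝒫⁻Alt^{k,ℓ}(s) = Alt^{k,ℓ} + κ Alt^{k+1,ℓ}`, the forms `x ↦ a + b(x - o, ·)` with constant
`a`, `b`.  The space is the same for every origin `o`. -/
def PmAlt (k ℓ : ℕ) (s : Finset (E n)) : Submodule ℝ (Field k ℓ s) where
  carrier := {ω | ∀ o : affineSpan ℝ (s : Set (E n)),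
    ∃ (a : AltForm k ℓ (Tan s)) (b : AltForm (k + 1) ℓ (Tan s)),
      ∀ x : Cell s, ω x = a + b.curryLeft (euler s o x)}
  zero_mem' o := ⟨0, 0, fun x => by simp⟩
  add_mem' {ω η} hω hη o := by
    obtain ⟨a, b, h⟩ := hω o
    obtain ⟨a', b', h'⟩ := hη o
    exact ⟨a + a', b + b', fun x => by
      rw [Pi.add_apply, h, h', AlternatingMap.curryLeft_add, LinearMap.add_apply]; abel⟩
  smul_mem' c ω hω o := by
    obtain ⟨a, b, h⟩ := hω o
    exact ⟨c • a, c • b, fun x => by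
      rw [Pi.smul_apply, h, AlternatingMap.curryLeft_smul, LinearMap.smul_apply, smul_add]⟩

/-- The double trace `ι_t^* ι_t^*` from a simplex `s` to a face `t`: restriction of the base point
to `t` and of all arguments to tangent vectors of `t`. -/
def trace (k ℓ : ℕ) {s t : Finset (E n)} (h : t ⊆ s) : Field k ℓ s →ₗ[ℝ] Field k ℓ t where
  toFun ω x := pullback k ℓ
    (Submodule.inclusion (vectorSpan_mono ℝ (Finset.coe_subset.2 h) : Tan t ≤ Tan s))
    (ω ⟨x, convexHull_mono (Finset.coe_subset.2 h) x.2⟩)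
  map_add' _ _ := by ext1 x; simp only [Pi.add_apply, map_add]
  map_smul' _ _ := by ext1 x; simp only [Pi.smul_apply, map_smul, RingHom.id_apply]

/-- The bubble space `ℬ⁻Alt^{k,ℓ}(s)`: forms in `𝒫⁻Alt^{k,ℓ}(s)` whose double trace vanishes on
every proper face of `s`. -/
def BmAlt (k ℓ : ℕ) (s : Finset (E n)) : Submodule ℝ (Field k ℓ s) :=
  PmAlt k ℓ s ⊓ ⨅ t : {t : Finset (E n) // t.Nonempty ∧ t ⊂ s},
    LinearMap.ker (trace k ℓ t.2.2.subset)

/-- The `(k,ℓ)`-forms on `s` annihilated (pointwise) by `𝒮_{†,[p]}`. -/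
def kerS (p k ℓ : ℕ) (s : Finset (E n)) : Submodule ℝ (Field k ℓ s) :=
  LinearMap.ker ((SdagIter (Tan s) k ℓ p).compLeft (Cell s))

/-- `𝒫⁻𝕎^{k,ℓ}_{[p]}(s) = ker (𝒮_{†,[p]} : 𝒫⁻Alt^{k,ℓ}(s) → 𝒫⁻Alt^{k-p,ℓ+p}(s))`. -/
def PmW (p k ℓ : ℕ) (s : Finset (E n)) : Submodule ℝ (Field k ℓ s) :=
  PmAlt k ℓ s ⊓ kerS p k ℓ s

/-- `ℬ⁻𝕎^{k,ℓ}_{[p]}(s) = ker (𝒮_{†,[p]} : ℬ⁻Alt^{k,ℓ}(s) → ℬ⁻Alt^{k-p,ℓ+p}(s))`. -/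
def BmW (p k ℓ : ℕ) (s : Finset (E n)) : Submodule ℝ (Field k ℓ s) :=
  BmAlt k ℓ s ⊓ kerS p k ℓ s

/-- `⟨ω, b⟩_s`: the `L²` inner product of two `(k,ℓ)`-forms on a simplex `s`, with respect to the
`dim s`-dimensional Euclidean surface measure and the Frobenius inner product.  For a vertex it is
the product of the values at the vertex. -/
def l2Inner {k ℓ : ℕ} {s : Finset (E n)} (ω b : Field k ℓ s) : ℝ :=
  ∫ x : Cell s, frobInner (ω x) (b x)
    ∂((Measure.euclideanHausdorffMeasure (s.card - 1) : Measure (E n)).comap Subtype.val)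

/-- The degree of freedom `⟨ι_σ^* ι_σ^* ω, b⟩_σ` of a form `ω` on the simplex `s` given by a
form `b` on the face `σ`. -/
def dof {k ℓ : ℕ} {s σ : Finset (E n)} (h : σ ⊆ s) (ω : Field k ℓ s) (b : Field k ℓ σ) : ℝ :=
  l2Inner (trace k ℓ h ω) b

/-- The faces (subsimplices) of a simplex `s`, including `s` itself. -/
abbrev Face (s : Finset (E n)) : Type := {σ : Finset (E n) // σ.Nonempty ∧ σ ⊆ s}

/-! ## Finite element spaces on a triangulation -/

/-- The `n`-simplices of a triangulation in `ℝⁿ`. -/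
abbrev TopCell (T : Geometry.SimplicialComplex ℝ (E n)) : Type :=
  {K : Finset (E n) // K ∈ T.faces ∧ K.card = n + 1}

/-- Piecewise `(k,ℓ)`-forms: one form on each `n`-simplex, with no relation between them. -/
abbrev PiecewiseField (k ℓ : ℕ) (T : Geometry.SimplicialComplex ℝ (E n)) : Type :=
  (K : TopCell T) → Field k ℓ K.1

/-- The finite element space assembled from the shape functions `𝒫⁻𝕎^{k,ℓ}_{[p]}(K)` and the
degrees of freedom `⟨ι_σ^* ι_σ^* ω, b⟩_σ`, `b ∈ ℬ⁻𝕎^{k,ℓ}_{[p]}(σ)`: the piecewise shape functions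
whose degrees of freedom on each common face of two cells agree. -/
def feSpace (p k ℓ : ℕ) (T : Geometry.SimplicialComplex ℝ (E n)) :
    Set (PiecewiseField k ℓ T) :=
  {ω | (∀ K, ω K ∈ PmW p k ℓ K.1) ∧
    ∀ (K K' : TopCell T) (σ : Finset (E n)) (h : σ ⊆ K.1) (h' : σ ⊆ K'.1), σ.Nonempty →
      ∀ b ∈ BmW p k ℓ σ, dof h (ω K) b = dof h' (ω K') b}

/-- The piecewise forms that are `ι^*ι^*`-conforming: the double trace is single-valued on every
common face (of any dimension) of two cells. -/
def IICconforming (k ℓ : ℕ) (T : Geometry.SimplicialComplex ℝ (E n)) :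
    Submodule ℝ (PiecewiseField k ℓ T) where
  carrier := {ω | ∀ (K K' : TopCell T) (σ : Finset (E n)) (h : σ ⊆ K.1) (h' : σ ⊆ K'.1),
    σ.Nonempty → trace k ℓ h (ω K) = trace k ℓ h' (ω K')}
  zero_mem' K K' σ h h' _ := by simp only [Pi.zero_apply, map_zero]
  add_mem' {ω η} hω hη K K' σ h h' hσ := by
    simp only [Pi.add_apply, map_add, hω K K' σ h h' hσ, hη K K' σ h h' hσ]
  smul_mem' c ω hω K K' σ h h' hσ := by
    simp only [Pi.smul_apply, map_smul, hω K K' σ h h' hσ]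

/-! ## Matrix proxies -/

/-- Symmetric `m × m` matrices. -/
def symMat (m : ℕ) : Submodule ℝ (Matrix (Fin m) (Fin m) ℝ) where
  carrier := {A | A.IsSymm}
  zero_mem' := Matrix.isSymm_zero
  add_mem' hA hB := hA.add hB
  smul_mem' c _ hA := hA.smul c

/-- Trace-free `m × m` matrices. -/
def traceFreeMat (m : ℕ) : Submodule ℝ (Matrix (Fin m) (Fin m) ℝ) :=
  LinearMap.ker (Matrix.traceLinearMap (Fin m) ℝ ℝ)

/-- The `(1,1)`-form `ω` is the constant form with matrix `A`: `ω(v)(u) = vᵀ A u`. -/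
def HasProxy11 {s : Finset (E n)} (ω : Field 1 1 s) (A : Matrix (Fin n) (Fin n) ℝ) : Prop :=
  ∀ (x : Cell s) (v u : Fin 1 → Tan s),
    ω x v u = (v 0 : E n).ofLp ⬝ᵥ A *ᵥ (u 0 : E n).ofLp

/-- In `ℝ³`, the `(2,2)`-form `ω` is the constant form with matrix `A`:
`ω(v₁,v₂)(u₁,u₂) = (v₁ × v₂)ᵀ A (u₁ × u₂)`. -/
def HasProxy22 {s : Finset (E 3)} (ω : Field 2 2 s) (A : Matrix (Fin 3) (Fin 3) ℝ) : Prop :=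
  ∀ (x : Cell s) (v u : Fin 2 → Tan s),
    ω x v u = crossProduct (v 0 : E 3).ofLp (v 1 : E 3).ofLp ⬝ᵥ
      A *ᵥ crossProduct (u 0 : E 3).ofLp (u 1 : E 3).ofLp

/-- In `ℝ³`, the `(2,1)`-form `ω` is the constant form with matrix `A`:
`ω(v₁,v₂)(u) = (v₁ × v₂)ᵀ A u`. -/
def HasProxy21 {s : Finset (E 3)} (ω : Field 2 1 s) (A : Matrix (Fin 3) (Fin 3) ℝ) : Prop :=
  ∀ (x : Cell s) (v : Fin 2 → Tan s) (u : Fin 1 → Tan s),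
    ω x v u = crossProduct (v 0 : E 3).ofLp (v 1 : E 3).ofLp ⬝ᵥ A *ᵥ (u 0 : E 3).ofLp

/-- The (non-normalized) tangent vector of the edge from `a` to `b`. -/
def edgeTangent (a b : E n) : Fin n → ℝ := (b - a).ofLp

/-- The (non-normalized) normal vector of the triangle `a`, `b`, `c` in `ℝ³`. -/
def faceNormal (a b c : E 3) : Fin 3 → ℝ := crossProduct (b - a).ofLp (c - a).ofLp

end FormValued

end

noncomputable section
namespace FormValued

/-! ### The `sl₂`-action on form-valued forms. -/

section Sl2

/-! Algebra. On the forms of all bidegrees, `𝒮_†` (`totalDown`) lowers `k - ℓ` by 2 and its mirror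
image (`totalUp`) raises it by 2. Both composites subtract the same exchange sum from a multiple of
the form, so their commutator is multiplication by `k - ℓ`: this is an `sl₂`-action, and pullbacks
commute with it. Hard Lefschetz (`hardLefschetz`) then says that `𝒮_{†,[p]}` is injective on weights
at least `p` and reaches every form of weight at most `-p`, with a preimage inside any prescribed
invariant subspace, such as the common kernel of a family of pullbacks.

Geometry. A form in `𝒫⁻Alt^{k,ℓ}(s)` is a constant form `ζ` in `Alt^{k+1,ℓ}(ℝ^s)` whose first
argument is the vector of barycentric coordinates of the point (`whitney`). Contraction anticommutes
with `𝒮_†`, so `𝒮_{†,[p]}` acts on `ζ` up to sign; the trace on a face is the pullback by extension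
of weights by zero; bubbles come from those `ζ` that vanish when any one coordinate is set to zero.
The target `ζ` has bidegree `(k-p+1, ℓ+p)`, of weight at most `-p` exactly when `k + 1 ≤ ℓ + p`.
Hence, for `p ≤ k`, `𝒮_{†,[p]}` maps bubbles onto bubbles on every simplex
(`exists_bubble_fieldS_eq`).

Unisolvency. A bubble on a face extends to `K` by restricting weights to the vertices of the face,
with zero trace on all faces not containing it. If the bubble lies in the kernel of `𝒮_{†,[p]}`, the
image of its extension vanishes on all faces of no larger dimension, and the surjectivity on bubbles
corrects it face by face (`exists_fieldS_eq`, `exists_extension_PmW`). The degrees of freedom are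
thus triangular in the dimension of the faces: if those on lower faces vanish, the trace is a bubble
and is tested against itself; conversely, prescribed values are matched by extending Riesz
representatives. Conformity follows from the injectivity half on the common face, applied to the
difference of two traces.

Special cases. All have `ℓ + p = k + 1`, where the injectivity half of Lefschetz kills the linear
part, so shape functions are constant matrices. Forms with fewer than `k + 1` vertices below them
vanish, and on `k`-simplices every constant form is a bubble. The remaining bubbles are found by
polarization (Regge) or by the dimension counts `6 = 4·1 + 2` and `8 = 4·2 + 0`. -/

theorem removeNth_zero_vecCons {m : ℕ} {V : Type*} (a : V) (u : Fin m → V) :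
    (0 : Fin (m + 1)).removeNth (Matrix.vecCons a u) = u := by
  ext i; simp [Fin.removeNth]

theorem removeNth_succ_vecCons {V : Type*} {m : ℕ} (a : V) (u : Fin (m + 1) → V) (j : Fin (m + 1)) :
    (j.succ).removeNth (Matrix.vecCons a u) = Matrix.vecCons a (j.removeNth u) := by
  ext i
  refine Fin.cases ?_ (fun i => ?_) i
  · simp [Fin.removeNth]
  · simp [Fin.removeNth]

theorem comp_removeNth' {m : ℕ} {V W : Type*} (f : V → W) (i : Fin (m + 1)) (v : Fin (m + 1) → V) :
    (fun j => f (i.removeNth v j)) = i.removeNth fun j => f (v j) := rfl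

theorem comp_vecCons' {m : ℕ} {V W : Type*} (f : V → W) (a : V) (v : Fin m → V) :
    (fun j => f (Matrix.vecCons a v j)) = Matrix.vecCons (f a) fun j => f (v j) := by
  ext j
  refine Fin.cases rfl (fun i => rfl) j

variable {V W : Type*} [AddCommGroup V] [Module ℝ V] [AddCommGroup W] [Module ℝ W] {k ℓ : ℕ}

theorem alternatingMap_sum_apply {ι N : Type*} [AddCommGroup N] [Module ℝ N] (s : Finset ι)
    (f : ι → V [⋀^Fin k]→ₗ[ℝ] N) (v : Fin k → V) : (∑ i ∈ s, f i) v = ∑ i ∈ s, f i v := by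
  classical
  induction s using Finset.induction_on with
  | empty => simp
  | insert a s ha ih => simp [Finset.sum_insert ha, ih]

/-- Contraction of an `(ℓ + 1)`-form with a vector. -/
def contractForm (v : V) : (V [⋀^Fin (ℓ + 1)]→ₗ[ℝ] ℝ) →ₗ[ℝ] (V [⋀^Fin ℓ]→ₗ[ℝ] ℝ) where
  toFun η := η.curryLeft v
  map_add' _ _ := rfl
  map_smul' _ _ := rfl

/-- Contraction of the second slot of a form-valued form. -/
def contractSecond (ω : AltForm k (ℓ + 1) V) : V →ₗ[ℝ] AltForm k ℓ V where
  toFun v := (contractForm v).compAlternatingMap ω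
  map_add' v v' := by
    ext w u
    exact DFunLike.congr_fun ((ω w).curryLeft.map_add v v') u
  map_smul' c v := by
    ext w u
    exact DFunLike.congr_fun ((ω w).curryLeft.map_smul c v) u

theorem contractSecond_apply (ω : AltForm k (ℓ + 1) V) (a : V) (v : Fin k → V) (u : Fin ℓ → V) :
    contractSecond ω a v u = ω v (Matrix.vecCons a u) := rfl

/-- The mirror image of `SdagSucc`, moving an argument from the second slot to the first. -/
def SsymSucc (k ℓ : ℕ) (V : Type*) [AddCommGroup V] [Module ℝ V] :
    AltForm k (ℓ + 1) V →ₗ[ℝ] AltForm (k + 1) ℓ V where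
  toFun ω := AlternatingMap.alternatizeUncurryFin (contractSecond ω)
  map_add' ω η := by
    rw [← AlternatingMap.alternatizeUncurryFin_add]
    rfl
  map_smul' c ω := by
    rw [RingHom.id_apply, ← AlternatingMap.alternatizeUncurryFin_smul]
    rfl

theorem alternatizeUncurryFin_apply_real {N : Type*} [AddCommGroup N] [Module ℝ N]
    (f : V →ₗ[ℝ] V [⋀^Fin k]→ₗ[ℝ] N) (v : Fin (k + 1) → V) :
    AlternatingMap.alternatizeUncurryFin f v =
      ∑ i : Fin (k + 1), (-1 : ℝ) ^ (i : ℕ) • f (v i) (i.removeNth v) := by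
  rw [AlternatingMap.alternatizeUncurryFin_apply]
  refine Finset.sum_congr rfl fun i _ => ?_
  rcases Nat.even_or_odd (i : ℕ) with h | h <;> simp [h.neg_one_pow]

theorem SsymSucc_apply (ω : AltForm k (ℓ + 1) V) (v : Fin (k + 1) → V) (u : Fin ℓ → V) :
    SsymSucc k ℓ V ω v u =
      ∑ i : Fin (k + 1), (-1 : ℝ) ^ (i : ℕ) * ω (i.removeNth v) (Matrix.vecCons (v i) u) := by
  simp [SsymSucc, alternatizeUncurryFin_apply_real, alternatingMap_sum_apply, contractSecond_apply]

/-- Exchanging one argument of the first slot with one of the second slot, summed over all pairs. -/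
def exchangeSum (ω : AltForm k ℓ V) (v : Fin k → V) (u : Fin ℓ → V) : ℝ :=
  ∑ i, ∑ j, ω (Function.update v i (u j)) (Function.update u j (v i))

theorem alternating_cons_removeNth {N : Type*} [AddCommGroup N] [Module ℝ N]
    (f : V [⋀^Fin (k + 1)]→ₗ[ℝ] N) (i : Fin (k + 1)) (a : V) (v : Fin (k + 1) → V) :
    f (Matrix.vecCons a (i.removeNth v)) = (-1 : ℝ) ^ (i : ℕ) • f (Function.update v i a) := by
  rw [← AlternatingMap.neg_one_pow_smul_map_insertNth f i a, Fin.insertNth_removeNth]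
  rcases Nat.even_or_odd (i : ℕ) with h | h <;> simp [h.neg_one_pow]

theorem neg_one_pow_mul_self_mul (i : ℕ) (x : ℝ) : (-1 : ℝ) ^ i * ((-1 : ℝ) ^ i * x) = x := by
  rw [← mul_assoc, ← pow_add, Even.neg_one_pow ⟨i, rfl⟩, one_mul]

/-- An argument `v i` is moved to the second slot, then some argument is moved back. If it is `v i`
itself, the form is recovered, once for each `i`; otherwise `v i` has been exchanged with some `u
j`, with sign `-1`. -/
theorem SsymSucc_SdagSucc (ω : AltForm (k + 1) ℓ V) (v : Fin (k + 1) → V) (u : Fin ℓ → V) :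
    SsymSucc k ℓ V (SdagSucc k ℓ V ω) v u = ((k + 1 : ℕ) : ℝ) * ω v u - exchangeSum ω v u := by
  rw [SsymSucc_apply, exchangeSum]
  have h : ∀ i : Fin (k + 1), (-1 : ℝ) ^ (i : ℕ) *
      SdagSucc k ℓ V ω (i.removeNth v) (Matrix.vecCons (v i) u) =
        ω v u - ∑ j, ω (Function.update v i (u j)) (Function.update u j (v i)) := by
    intro i
    rw [SdagSucc_apply, Fin.sum_univ_succ, mul_add, sub_eq_add_neg]
    congr 1
    · simp [alternating_cons_removeNth, neg_one_pow_mul_self_mul]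
    · cases ℓ with
      | zero => simp
      | succ m =>
        rw [Finset.mul_sum, ← Finset.sum_neg_distrib]
        refine Finset.sum_congr rfl fun j _ => ?_
        rw [removeNth_succ_vecCons, Matrix.cons_val_succ, alternating_cons_removeNth,
          alternating_cons_removeNth]
        simp only [AlternatingMap.smul_apply, smul_eq_mul, Fin.val_succ, pow_succ]
        nth_rw 2 [← neg_one_pow_mul_self_mul i (ω _ _), ← neg_one_pow_mul_self_mul j (ω _ _)]
        ring
  rw [Finset.sum_congr rfl fun i _ => h i]
  simp

theorem SdagSucc_SsymSucc (ω : AltForm k (ℓ + 1) V) (v : Fin k → V) (u : Fin (ℓ + 1) → V) :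
    SdagSucc k ℓ V (SsymSucc k ℓ V ω) v u = ((ℓ + 1 : ℕ) : ℝ) * ω v u - exchangeSum ω v u := by
  rw [SdagSucc_apply, exchangeSum, Finset.sum_comm]
  have h : ∀ j : Fin (ℓ + 1), (-1 : ℝ) ^ (j : ℕ) *
      SsymSucc k ℓ V ω (Matrix.vecCons (u j) v) (j.removeNth u) =
        ω v u - ∑ i, ω (Function.update v i (u j)) (Function.update u j (v i)) := by
    intro j
    rw [SsymSucc_apply, Fin.sum_univ_succ, mul_add, sub_eq_add_neg]
    congr 1
    · simp [alternating_cons_removeNth, neg_one_pow_mul_self_mul]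
    · cases k with
      | zero => simp
      | succ m =>
        rw [Finset.mul_sum, ← Finset.sum_neg_distrib]
        refine Finset.sum_congr rfl fun i _ => ?_
        rw [removeNth_succ_vecCons, Matrix.cons_val_succ, alternating_cons_removeNth,
          alternating_cons_removeNth]
        simp only [AlternatingMap.smul_apply, smul_eq_mul, Fin.val_succ, pow_succ]
        nth_rw 2 [← neg_one_pow_mul_self_mul i (ω _ _), ← neg_one_pow_mul_self_mul j (ω _ _)]
        ring
  rw [Finset.sum_congr rfl fun i _ => h i]
  simp

/-- All form-valued forms, of all bidegrees. -/
abbrev Total (V : Type*) [AddCommGroup V] [Module ℝ V] : Type _ := ∀ k ℓ : ℕ, AltForm k ℓ V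

/-- `SdagSucc` on all bidegrees at once. -/
def totalDown (V : Type*) [AddCommGroup V] [Module ℝ V] : Module.End ℝ (Total V) where
  toFun X k ℓ := match ℓ with
    | 0 => 0
    | ℓ + 1 => SdagSucc k ℓ V (X (k + 1) ℓ)
  map_add' X Y := by
    funext k ℓ
    cases ℓ <;> simp
  map_smul' c X := by
    funext k ℓ
    cases ℓ <;> simp

/-- `SsymSucc` on all bidegrees at once. -/
def totalUp (V : Type*) [AddCommGroup V] [Module ℝ V] : Module.End ℝ (Total V) where
  toFun X k ℓ := match k with
    | 0 => 0
    | k + 1 => SsymSucc k ℓ V (X k (ℓ + 1))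
  map_add' X Y := by
    funext k ℓ
    cases k <;> simp
  map_smul' c X := by
    funext k ℓ
    cases k <;> simp

/-- The difference of the two degrees. -/
def totalWeight (V : Type*) [AddCommGroup V] [Module ℝ V] : Module.End ℝ (Total V) where
  toFun X k ℓ := ((k : ℝ) - ℓ) • X k ℓ
  map_add' X Y := by funext k ℓ; simp
  map_smul' c X := by funext k ℓ; simp [smul_comm c]

theorem totalUp_totalDown (X : Total V) (k ℓ : ℕ) (v : Fin k → V) (u : Fin ℓ → V) :
    totalUp V (totalDown V X) k ℓ v u = (k : ℝ) * X k ℓ v u - exchangeSum (X k ℓ) v u := by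
  cases k with
  | zero => simp [totalUp, exchangeSum]
  | succ k => exact SsymSucc_SdagSucc (X (k + 1) ℓ) v u

theorem totalDown_totalUp (X : Total V) (k ℓ : ℕ) (v : Fin k → V) (u : Fin ℓ → V) :
    totalDown V (totalUp V X) k ℓ v u = (ℓ : ℝ) * X k ℓ v u - exchangeSum (X k ℓ) v u := by
  cases ℓ with
  | zero => simp [totalDown, exchangeSum]
  | succ k => exact SdagSucc_SsymSucc (X _ (k + 1)) v u

/-- The exchange sums of the two composites are equal and cancel, leaving `k - ℓ`. This is the
relation `[e, f] = h`. -/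
theorem totalUp_mul_totalDown :
    totalUp V * totalDown V = totalDown V * totalUp V + totalWeight V := by
  ext X k ℓ v u
  simp only [Module.End.mul_apply, LinearMap.add_apply, Pi.add_apply, AlternatingMap.add_apply,
    totalUp_totalDown, totalDown_totalUp, totalWeight, LinearMap.coe_mk, AddHom.coe_mk,
    AlternatingMap.smul_apply, smul_eq_mul]
  ring

theorem totalWeight_mul_totalDown :
    totalWeight V * totalDown V + (2 : ℝ) • totalDown V = totalDown V * totalWeight V := by
  ext X k ℓ v u
  cases ℓ with
  | zero => simp [totalWeight, totalDown]
  | succ ℓ =>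
    simp [totalWeight, totalDown]
    ring

theorem totalWeight_mul_totalUp :
    totalWeight V * totalUp V = totalUp V * totalWeight V + (2 : ℝ) • totalUp V := by
  ext X k ℓ v u
  cases k with
  | zero => simp [totalWeight, totalUp]
  | succ ℓ =>
    simp [totalWeight, totalUp]
    ring

/-- The pullback on all bidegrees at once. -/
def totalPull (f : V →ₗ[ℝ] W) : Total W →ₗ[ℝ] Total V where
  toFun X k ℓ := pullback k ℓ f (X k ℓ)
  map_add' X Y := by funext k ℓ; simp
  map_smul' c X := by funext k ℓ; simp

/-- Together with its two companions, this makes kernels of pullbacks `sl₂`-invariant, so that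
Lefschetz preimages keep vanishing conditions on faces. -/
theorem totalPull_totalDown (f : V →ₗ[ℝ] W) (X : Total W) :
    totalPull f (totalDown W X) = totalDown V (totalPull f X) := by
  ext k ℓ v u
  cases ℓ with
  | zero => simp [totalPull, totalDown]
  | succ ℓ =>
    simp [totalPull, totalDown, SdagSucc_apply, pullback_apply, comp_removeNth', comp_vecCons']

theorem totalPull_totalUp (f : V →ₗ[ℝ] W) (X : Total W) :
    totalPull f (totalUp W X) = totalUp V (totalPull f X) := by
  ext k ℓ v u
  cases k with
  | zero => simp [totalPull, totalUp]
  | succ ℓ =>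
    simp [totalPull, totalUp, SsymSucc_apply, pullback_apply, comp_removeNth', comp_vecCons']

theorem totalPull_totalWeight (f : V →ₗ[ℝ] W) (X : Total W) :
    totalPull f (totalWeight W X) = totalWeight V (totalPull f X) := by
  ext k ℓ v u
  simp [totalPull, totalWeight]

end Sl2

end FormValued
end
noncomputable section
namespace FormValued

/-! ### Hard Lefschetz without finite-dimensionality. -/

section Lefschetz

/-- Differences are written `a + (-1) • b` here and below, so that only an additive monoid with real
scalars is needed. -/
theorem add_neg_one_smul_self {X : Type*} [AddCommMonoid X] [Module ℝ X] (a : X) :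
    a + (-1 : ℝ) • a = 0 := by
  nth_rw 1 [← one_smul ℝ a]
  rw [← add_smul, add_neg_cancel, zero_smul]

theorem eq_of_add_neg_one_smul {X : Type*} [AddCommMonoid X] [Module ℝ X] {a b : X}
    (h : a + (-1 : ℝ) • b = 0) : a = b := by
  rw [← add_zero a, ← add_neg_one_smul_self b, add_comm b, ← add_assoc, h, zero_add]

theorem sub_mem_of_module {X : Type*} [AddCommMonoid X] [Module ℝ X] {p : Submodule ℝ X}
    {a b : X} (ha : a ∈ p) (hb : b ∈ p) : a + (-1 : ℝ) • b ∈ p :=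
  p.add_mem ha (p.smul_mem _ hb)

open Polynomial

variable {X : Type*} [AddCommGroup X] [Module ℝ X]

theorem aeval_mem_of_invariant {Ω : Module.End ℝ X} {N : Submodule ℝ X}
    (hN : ∀ x ∈ N, Ω x ∈ N) (u : ℝ[X]) {x : X} (hx : x ∈ N) : aeval Ω u x ∈ N := by
  induction u using Polynomial.induction_on' generalizing x with
  | add p q hp hq => simpa using N.add_mem (hp hx) (hq hx)
  | monomial m a =>
    have h : ∀ m : ℕ, (Ω ^ m) x ∈ N := fun m => by
      induction m with
      | zero => simpa using hx
      | succ m ih => rw [pow_succ', Module.End.mul_apply]; exact hN _ ih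
    simpa [aeval_monomial] using N.smul_mem a (h m)

/-- Hard Lefschetz property of a representation of `sl₂`: a vector of weight `μ ≤ -p` killed by a
power of the lowering operator is a `p`-fold image of that operator, within any invariant subspace,
and it is not killed by the `p`-th power of the raising operator unless it is zero. -/
theorem hardLefschetz {e f h : Module.End ℝ X}
    (hef : ∀ x, e (f x) = f (e x) + h x) (hhf' : ∀ x, h (f x) + (2 : ℝ) • f x = f (h x))
    (hhe : ∀ x, h (e x) = e (h x) + (2 : ℝ) • e x) {N : Submodule ℝ X}
    (he : ∀ x ∈ N, e x ∈ N) (hf : ∀ x ∈ N, f x ∈ N) (hh : ∀ x ∈ N, h x ∈ N)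
    {μ : ℝ} {p j : ℕ} (hμ : μ + p ≤ 0) {x : X} (hxN : x ∈ N) (hx : h x = μ • x)
    (hj : (f ^ j) x = 0) :
    (∃ y ∈ N, (f ^ p) y = x) ∧ ((e ^ p) x = 0 → x = 0) := by
  have hhf : ∀ x, h (f x) = f (h x) - (2 : ℝ) • f x := fun x => eq_sub_of_add_eq (hhf' x)
  -- The Casimir element, which commutes with `e`, `f` and `h`. On weight `λ` it gives `4fe = Ω -
  -- λ(λ + 2)` and `4ef = Ω - λ(λ - 2)`.
  set Ω : Module.End ℝ X := (4 : ℝ) • (f * e) + h * h + (2 : ℝ) • h with hΩ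
  have hΩa : ∀ x, Ω x = (4 : ℝ) • f (e x) + h (h x) + (2 : ℝ) • h x := fun x => by simp [hΩ]
  have hΩf : ∀ x, Ω (f x) = f (Ω x) := fun x => by
    simp only [hΩa, hef, hhf, map_add, map_sub, map_smul]; module
  have hΩe : ∀ x, Ω (e x) = e (Ω x) := fun x => by
    simp only [hΩa, hef, hhe, map_add, map_smul]; module
  have hΩh : ∀ x, h (Ω x) = Ω (h x) := fun x => by
    simp only [hΩa, hhf, hhe, map_add, map_smul]; module
  have hΩfp : ∀ (m : ℕ) x, Ω ((f ^ m) x) = (f ^ m) (Ω x) := fun m => by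
    induction m with
    | zero => simp
    | succ m ih => intro x; simp only [pow_succ, Module.End.mul_apply, ih, hΩf]
  have hΩep : ∀ (m : ℕ) x, Ω ((e ^ m) x) = (e ^ m) (Ω x) := fun m => by
    induction m with
    | zero => simp
    | succ m ih => intro x; simp only [pow_succ, Module.End.mul_apply, ih, hΩe]
  have hwe : ∀ (m : ℕ) x, h x = μ • x → h ((e ^ m) x) = (μ + 2 * m) • (e ^ m) x := fun m => by
    induction m with
    | zero => simp
    | succ m ih =>
      intro x hx
      rw [pow_succ', Module.End.mul_apply, hhe, ih x hx, map_smul]; push_cast; module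
  have hwf : ∀ (m : ℕ) x, h x = μ • x → h ((f ^ m) x) = (μ - 2 * m) • (f ^ m) x := fun m => by
    induction m with
    | zero => simp
    | succ m ih =>
      intro x hx
      rw [pow_succ', Module.End.mul_apply, hhf, ih x hx, map_smul]; push_cast; module
  -- On weight `μ`, telescoping the Casimir identities turns `4^p f^p e^p` into `g(Ω)` and `4^j e^j
  -- f^j` into `q(Ω)`.
  let g : ℝ[X] := ∏ i ∈ Finset.range p, (Polynomial.X - C ((μ + 2 * i) * (μ + 2 * i + 2)))
  let q : ℝ[X] := ∏ r ∈ Finset.range j, (Polynomial.X - C ((μ - 2 * r) * (μ - 2 * r - 2)))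
  have hg : ∀ x, h x = μ • x → aeval Ω g x = (4 : ℝ) ^ p • (f ^ p) ((e ^ p) x) := by
    intro x hx
    simp only [g]
    induction p with
    | zero => simp
    | succ p ih =>
      have := ih (le_trans (by push_cast; linarith) hμ)
      rw [Finset.prod_range_succ_comm, map_mul, Module.End.mul_apply, this, map_smul]
      simp only [map_sub, aeval_X, aeval_C, LinearMap.sub_apply, Module.algebraMap_end_apply]
      rw [hΩfp, hΩa, hwe p x hx, map_smul, hwe p x hx, pow_succ f, pow_succ' e,
        Module.End.mul_apply, Module.End.mul_apply]
      simp only [map_add, map_smul, pow_succ]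
      module
  have hq : aeval Ω q x = 0 := by
    have : ∀ m : ℕ, aeval Ω (∏ r ∈ Finset.range m,
        (Polynomial.X - C ((μ - 2 * r) * (μ - 2 * r - 2)))) x =
          (4 : ℝ) ^ m • (e ^ m) ((f ^ m) x) := fun m => by
      induction m with
      | zero => simp
      | succ m ih =>
        rw [Finset.prod_range_succ_comm, map_mul, Module.End.mul_apply, ih, map_smul]
        simp only [map_sub, aeval_X, aeval_C, LinearMap.sub_apply, Module.algebraMap_end_apply]
        have h4 : (4 : ℝ) • f (e ((f ^ m) x)) = (4 : ℝ) • e (f ((f ^ m) x)) -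
            (4 : ℝ) • h ((f ^ m) x) := by rw [hef]; module
        rw [hΩep, hΩa, h4, hwf m x hx, map_smul, hwf m x hx, pow_succ e, pow_succ' f,
          Module.End.mul_apply, Module.End.mul_apply]
        simp only [map_add, map_sub, map_smul, pow_succ]
        module
    rw [this, hj, map_zero, smul_zero]
  -- A root of `g` minus a root of `q` is `(2i+2r+2)(2μ+2i-2r)`, whose second factor is negative
  -- since `i < p` and `μ ≤ -p`. As `q(Ω)` kills `x`, the Bézout identity inverts `g(Ω)` on `x`.
  have hcop : IsCoprime g q := by
    refine IsCoprime.prod_left fun i hi => IsCoprime.prod_right fun r _ => ?_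
    refine isCoprime_X_sub_C_of_isUnit_sub (IsUnit.mk0 _ ?_)
    have hi' : (i : ℝ) + 1 ≤ p := by exact_mod_cast Finset.mem_range.1 hi
    have hi0 : (0 : ℝ) ≤ i := i.cast_nonneg
    have hr : (0 : ℝ) ≤ r := r.cast_nonneg
    have : (μ + 2 * i) * (μ + 2 * i + 2) - (μ - 2 * r) * (μ - 2 * r - 2) =
        (2 * i + 2 * r + 2) * (2 * μ + 2 * i - 2 * r) := by ring
    rw [this]
    refine mul_ne_zero (by positivity) (ne_of_lt ?_)
    linarith
  obtain ⟨a, b, hab⟩ := hcop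
  have hΩN : ∀ x ∈ N, Ω x ∈ N := fun x hx => by
    rw [hΩa]
    exact N.add_mem (N.add_mem (N.smul_mem _ (hf _ (he _ hx))) (hh _ (hh _ hx)))
      (N.smul_mem _ (hh _ hx))
  have hz : h (aeval Ω a x) = μ • aeval Ω a x := by
    have := aeval_mem_of_invariant (Ω := Ω) (N := LinearMap.ker (h - algebraMap ℝ _ μ))
      (fun x hx => by
        simp only [LinearMap.mem_ker, LinearMap.sub_apply, Module.algebraMap_end_apply,
          sub_eq_zero] at hx ⊢
        rw [hΩh, hx, map_smul]) a (x := x) (by simp [hx])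
    simpa [sub_eq_zero] using this
  have hep : ∀ (m : ℕ) y, y ∈ N → (e ^ m) y ∈ N := fun m => by
    induction m with
    | zero => simp
    | succ m ih => intro y hy; rw [pow_succ', Module.End.mul_apply]; exact he _ (ih y hy)
  have hx' : aeval Ω (a * g) x = x := by
    have := congrArg (fun P => aeval Ω P x) hab
    simpa [hq] using this
  refine ⟨⟨(4 : ℝ) ^ p • (e ^ p) (aeval Ω a x),
    N.smul_mem _ (hep _ _ (aeval_mem_of_invariant hΩN a hxN)), ?_⟩, fun h0 => ?_⟩
  · rw [map_smul, ← hg _ hz, ← Module.End.mul_apply, ← map_mul, mul_comm g, hx']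
  · rw [← hx', map_mul, Module.End.mul_apply, hg x hx, h0, map_zero, smul_zero, map_zero]

end Lefschetz

/-! ### Lefschetz for form-valued forms. -/

section BubbleForms

variable {V : Type*} [AddCommGroup V] [Module ℝ V] {k ℓ : ℕ}

/-- Each application uses up one argument of the first slot. This supplies the nilpotency that
replaces finite-dimensionality. -/
theorem totalDown_pow_eq_zero (X : Total V) {m : ℕ} (hX : ∀ k ℓ, m ≤ k → X k ℓ = 0) :
    (totalDown V ^ m) X = 0 := by
  induction m generalizing X with
  | zero => funext k ℓ; simpa using hX k ℓ (Nat.zero_le k)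
  | succ m ih =>
    rw [pow_succ, Module.End.mul_apply]
    refine ih _ fun k ℓ hk => ?_
    cases ℓ with
    | zero => rfl
    | succ ℓ => simp [totalDown, hX (k + 1) ℓ (by omega)]

theorem totalUp_pow_eq_zero (X : Total V) {m : ℕ} (hX : ∀ k ℓ, m ≤ ℓ → X k ℓ = 0) :
    (totalUp V ^ m) X = 0 := by
  induction m generalizing X with
  | zero => funext k ℓ; simpa using hX k ℓ (Nat.zero_le ℓ)
  | succ m ih =>
    rw [pow_succ, Module.End.mul_apply]
    refine ih _ fun k ℓ hk => ?_
    cases k with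
    | zero => rfl
    | succ k => simp [totalUp, hX k (ℓ + 1) (by omega)]

/-- The family whose only nonzero member is the given form. -/
def pureForm (ω : AltForm k ℓ V) : Total V := Pi.single k (Pi.single ℓ ω)

theorem pureForm_self (ω : AltForm k ℓ V) : pureForm ω k ℓ = ω := by simp [pureForm]

theorem pureForm_of_ne (ω : AltForm k ℓ V) {k' ℓ' : ℕ} (h : (k', ℓ') ≠ (k, ℓ)) :
    pureForm ω k' ℓ' = 0 := by
  by_cases hk : k' = k
  · subst hk
    simp only [pureForm, Pi.single_eq_same]
    exact Pi.single_eq_of_ne (fun h' => h (by rw [h'])) _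
  · simp [pureForm, Pi.single_eq_of_ne hk]

theorem totalWeight_pureForm (ω : AltForm k ℓ V) :
    totalWeight V (pureForm ω) = ((k : ℝ) - ℓ) • pureForm ω := by
  funext k' ℓ'
  change ((k' : ℝ) - ℓ') • pureForm ω k' ℓ' = ((k : ℝ) - ℓ) • pureForm ω k' ℓ'
  by_cases h : (k', ℓ') = (k, ℓ)
  · obtain ⟨rfl, rfl⟩ := Prod.mk.inj h
    rfl
  · rw [pureForm_of_ne ω h, smul_zero, smul_zero]

theorem totalDown_pow_of_ne {X : Total V} {k ℓ p : ℕ}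
    (hX : ∀ k' ℓ', (k', ℓ') ≠ (k + p, ℓ) → X k' ℓ' = 0) {k' ℓ' : ℕ}
    (h : (k', ℓ') ≠ (k, ℓ + p)) : (totalDown V ^ p) X k' ℓ' = 0 := by
  induction p generalizing k k' ℓ' with
  | zero => exact hX _ _ h
  | succ p ih =>
    rw [pow_succ', Module.End.mul_apply]
    cases ℓ' with
    | zero => rfl
    | succ ℓ' =>
      change SdagSucc k' ℓ' V ((totalDown V ^ p) X (k' + 1) ℓ') = 0
      rw [ih (k := k + 1) (fun a b hab => hX a b (by rwa [add_comm p 1, ← add_assoc])), map_zero]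
      intro hh
      obtain ⟨h1, h2⟩ := Prod.mk.inj hh
      exact h (by rw [Nat.succ.inj h1, h2, add_assoc])

/-- `𝒮_{†,[p]}` is onto within the forms killed by a family of pullbacks. -/
theorem exists_totalDown_pow_eq {ι : Type*} (P : ι → V →ₗ[ℝ] V) {p : ℕ} (hp : k + p ≤ ℓ)
    (ω : AltForm k ℓ V) (hω : ∀ i, pullback k ℓ (P i) ω = 0) :
    ∃ Z : Total V, (∀ i k ℓ, pullback k ℓ (P i) (Z k ℓ) = 0) ∧
      (totalDown V ^ p) Z k ℓ = ω := by
  -- The invariant subspace in which the preimage is sought: the families killed by every `P i`.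
  let N : Submodule ℝ (Total V) := ⨅ i, LinearMap.ker (totalPull (P i))
  have hN : ∀ X, X ∈ N ↔ ∀ i, totalPull (P i) X = 0 := fun X => by simp [N]
  obtain ⟨⟨Z, hZ, hZX⟩, -⟩ := hardLefschetz (e := totalUp V) (f := totalDown V)
    (h := totalWeight V) (N := N) (μ := (k : ℝ) - ℓ) (p := p) (j := k + 1) (x := pureForm ω)
    (fun x => LinearMap.congr_fun totalUp_mul_totalDown x)
    (fun x => LinearMap.congr_fun totalWeight_mul_totalDown x)
    (fun x => LinearMap.congr_fun totalWeight_mul_totalUp x)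
    (fun x hx => by
      rw [hN] at hx ⊢; intro i; rw [totalPull_totalUp, hx, map_zero])
    (fun x hx => by
      rw [hN] at hx ⊢; intro i; rw [totalPull_totalDown, hx, map_zero])
    (fun x hx => by
      rw [hN] at hx ⊢; intro i; rw [totalPull_totalWeight, hx, map_zero])
    (by
      have : (k : ℝ) + p ≤ ℓ := by exact_mod_cast hp
      linarith)
    (by
      rw [hN]; intro i; funext k' ℓ'
      change pullback k' ℓ' (P i) (pureForm ω k' ℓ') = 0
      by_cases h : (k', ℓ') = (k, ℓ)
      · obtain ⟨rfl, rfl⟩ := Prod.mk.inj h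
        rw [pureForm_self, hω]
      · rw [pureForm_of_ne ω h, map_zero])
    (totalWeight_pureForm ω)
    (totalDown_pow_eq_zero _ fun k' ℓ' hk => pureForm_of_ne ω fun h => by
      have := (Prod.mk.inj h).1; omega)
  refine ⟨Z, fun i k ℓ => ?_, by rw [hZX, pureForm_self]⟩
  exact congrFun (congrFun ((hN Z).1 hZ i) k) ℓ

/-- `𝒮_{†,[p]}` is injective on forms whose first degree exceeds the second by at least `p`. -/
theorem eq_zero_of_totalDown_pow_pureForm {p : ℕ} (hp : ℓ + p ≤ k) (ω : AltForm k ℓ V)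
    (h : (totalDown V ^ p) (pureForm ω) = 0) : ω = 0 := by
  -- The roles of raising and lowering are exchanged and the weight is negated, so that the second
  -- conclusion concerns `totalDown`.
  have key := (hardLefschetz (e := totalDown V) (f := totalUp V)
    (h := (-1 : ℝ) • totalWeight V) (N := ⊤) (μ := (ℓ : ℝ) - k) (p := p) (j := ℓ + 1)
    (x := pureForm ω)
    (fun x => by
      rw [← Module.End.mul_apply (totalUp V), totalUp_mul_totalDown, LinearMap.add_apply,
        LinearMap.smul_apply, add_assoc, add_neg_one_smul_self, add_zero]
      rfl)
    (fun x => by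
      have := LinearMap.congr_fun totalWeight_mul_totalUp x
      simp only [Module.End.mul_apply, LinearMap.add_apply, LinearMap.smul_apply] at this
      rw [LinearMap.smul_apply, LinearMap.smul_apply, this, map_smul, smul_add, add_assoc,
        smul_smul, ← add_smul]
      norm_num)
    (fun x => by
      have := LinearMap.congr_fun totalWeight_mul_totalDown x
      simp only [Module.End.mul_apply, LinearMap.add_apply, LinearMap.smul_apply] at this
      rw [LinearMap.smul_apply, LinearMap.smul_apply, map_smul, ← this, smul_add, add_assoc,
        smul_smul, ← add_smul]
      norm_num)
    (fun _ _ => trivial) (fun _ _ => trivial) (fun _ _ => trivial)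
    (by
      have : (ℓ : ℝ) + p ≤ k := by exact_mod_cast hp
      linarith)
    trivial
    (by
      rw [LinearMap.smul_apply, totalWeight_pureForm, smul_smul]
      congr 1
      ring)
    (totalUp_pow_eq_zero _ fun k' ℓ' hk => pureForm_of_ne ω fun h => by
      have := (Prod.mk.inj h).2; omega)).2 h
  rw [← pureForm_self ω, key]
  rfl

theorem Sdag_eq_totalDown (X : Total V) (ℓ : ℕ) : ∀ k : ℕ, k ≠ 0 →
    Sdag V k ℓ (X k ℓ) = totalDown V X (k - 1) (ℓ + 1)
  | 0, h => absurd rfl h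
  | _ + 1, _ => rfl

/-- The condition `p ≤ k` keeps the truncated degree `k - p` honest; beyond it the iterate is zero.
-/
theorem SdagIter_eq_totalDown (X : Total V) (k ℓ : ℕ) {p : ℕ} (hp : p ≤ k) :
    SdagIter V k ℓ p (X k ℓ) = (totalDown V ^ p) X (k - p) (ℓ + p) := by
  induction p with
  | zero => rfl
  | succ p ih =>
    rw [pow_succ', Module.End.mul_apply]
    change Sdag V (k - p) (ℓ + p) (SdagIter V k ℓ p (X k ℓ)) = _
    rw [ih (by omega), Sdag_eq_totalDown ((totalDown V ^ p) X) (ℓ + p) (k - p) (by omega)]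
    rfl

theorem SdagIter_eq_zero_of_lt {p : ℕ} (hp : k < p) : SdagIter V k ℓ p = 0 := by
  induction p with
  | zero => omega
  | succ p ih =>
    change Sdag V (k - p) (ℓ + p) ∘ₗ SdagIter V k ℓ p = 0
    rcases Nat.lt_succ_iff_lt_or_eq.1 hp with h | h
    · rw [ih h, LinearMap.comp_zero]
    · have : ∀ m, m = 0 → Sdag V m (ℓ + p) = 0 := by rintro _ rfl; rfl
      rw [this _ (by omega), LinearMap.zero_comp]

theorem pullback_Sdag {W : Type*} [AddCommGroup W] [Module ℝ W] (g : V →ₗ[ℝ] W) :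
    ∀ (k ℓ : ℕ) (ω : AltForm k ℓ W),
      pullback (k - 1) (ℓ + 1) g (Sdag W k ℓ ω) = Sdag V k ℓ (pullback k ℓ g ω)
  | 0, ℓ, ω => by simp [Sdag]
  | k + 1, ℓ, ω => by
    ext v u
    simp [Sdag, SdagSucc_apply, pullback_apply, comp_removeNth', comp_vecCons']

theorem pullback_SdagIter {W : Type*} [AddCommGroup W] [Module ℝ W] (g : V →ₗ[ℝ] W)
    (k ℓ p : ℕ) (ω : AltForm k ℓ W) :
    pullback (k - p) (ℓ + p) g (SdagIter W k ℓ p ω) = SdagIter V k ℓ p (pullback k ℓ g ω) := by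
  induction p with
  | zero => rfl
  | succ p ih =>
    change pullback (k - p - 1) (ℓ + p + 1) g (Sdag W (k - p) (ℓ + p) _) =
      Sdag V (k - p) (ℓ + p) _
    rw [pullback_Sdag, ih]

end BubbleForms

end FormValued
end
noncomputable section
namespace FormValued

/-! ### Homogeneous barycentric coordinates and Whitney forms. -/

section Barycentric

variable {n k ℓ : ℕ}

/-- The map sending weights `w` on the vertices to the pair `(∑ wᵢ, ∑ wᵢ xᵢ)`. -/
def weightedSum (s : Finset (E n)) : (s → ℝ) →ₗ[ℝ] ℝ × E n :=
  (Fintype.linearCombination ℝ fun i : s => ((1 : ℝ), (i : E n)))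

theorem weightedSum_apply (s : Finset (E n)) (w : s → ℝ) :
    weightedSum s w = (∑ i, w i, ∑ i, w i • (i : E n)) := by
  simp [weightedSum, Fintype.linearCombination_apply, Prod.ext_iff, Prod.fst_sum, Prod.snd_sum]

theorem weightedSum_single (s : Finset (E n)) (i : s) :
    weightedSum s (Pi.single i 1) = (1, (i : E n)) := by
  classical
  simp [weightedSum]

theorem weightedSum_injective {s : Finset (E n)} (hs : IsSimplex s) :
    Function.Injective (weightedSum s) := by
  rw [← LinearMap.ker_eq_bot, LinearMap.ker_eq_bot']
  intro w hw
  rw [weightedSum_apply, Prod.mk_eq_zero] at hw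
  funext i
  exact (affineIndependent_iff.1 hs.2) Finset.univ w hw.1 hw.2 i (Finset.mem_univ i)

/-- Homogeneous barycentric coordinates of a simplex. -/
def bary (s : Finset (E n)) : ℝ × E n →ₗ[ℝ] (s → ℝ) :=
  open Classical in
  if h : ∃ g : ℝ × E n →ₗ[ℝ] (s → ℝ), g ∘ₗ weightedSum s = LinearMap.id then h.choose else 0

theorem bary_weightedSum {s : Finset (E n)} (hs : IsSimplex s) (w : s → ℝ) :
    bary s (weightedSum s w) = w := by
  have h : ∃ g : ℝ × E n →ₗ[ℝ] (s → ℝ), g ∘ₗ weightedSum s = LinearMap.id :=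
    LinearMap.exists_leftInverse_of_injective _
      (LinearMap.ker_eq_bot.2 (weightedSum_injective hs))
  rw [bary, dif_pos h]
  exact LinearMap.congr_fun h.choose_spec w

theorem weightedSum_bary {s : Finset (E n)} (hs : IsSimplex s) {z : ℝ × E n}
    (hz : z ∈ LinearMap.range (weightedSum s)) : weightedSum s (bary s z) = z := by
  obtain ⟨w, rfl⟩ := hz
  rw [bary_weightedSum hs]

/-- Points have weights of sum one, tangent vectors weights of sum zero; the first component of
`weightedSum` records which. -/
theorem tangent_mem_range {s : Finset (E n)} {v : E n} (hv : v ∈ Tan s) :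
    ((0 : ℝ), v) ∈ LinearMap.range (weightedSum s) := by
  have : Tan s ≤ (LinearMap.range (weightedSum s)).comap (LinearMap.inr ℝ ℝ (E n)) := by
    refine Submodule.span_le.2 ?_
    rintro _ ⟨a, ha, b, hb, rfl⟩
    refine ⟨Pi.single ⟨a, ha⟩ 1 - Pi.single ⟨b, hb⟩ 1, ?_⟩
    rw [map_sub, weightedSum_single, weightedSum_single]
    simp
  exact this hv

theorem point_mem_range {s : Finset (E n)} (hs : s.Nonempty) {x : E n}
    (hx : x ∈ affineSpan ℝ (s : Set (E n))) :
    ((1 : ℝ), x) ∈ LinearMap.range (weightedSum s) := by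
  obtain ⟨o, ho⟩ := hs
  have h1 : ((1 : ℝ), o) ∈ LinearMap.range (weightedSum s) :=
    ⟨Pi.single ⟨o, ho⟩ 1, weightedSum_single s ⟨o, ho⟩⟩
  have h2 : x - o ∈ Tan s := by
    have := AffineSubspace.vsub_mem_direction hx (subset_affineSpan ℝ _ ho)
    rwa [direction_affineSpan] at this
  have := Submodule.add_mem _ h1 (tangent_mem_range h2)
  simpa using this

/-- The barycentric weights of a tangent vector. -/
def tangentWeights (s : Finset (E n)) : Tan s →ₗ[ℝ] (s → ℝ) :=
  bary s ∘ₗ LinearMap.inr ℝ ℝ (E n) ∘ₗ (Tan s).subtype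

/-- The barycentric weights of a point. -/
def pointWeights (s : Finset (E n)) (x : E n) : s → ℝ := bary s (1, x)

theorem weightedSum_tangentWeights {s : Finset (E n)} (hs : IsSimplex s) (v : Tan s) :
    weightedSum s (tangentWeights s v) = (0, (v : E n)) :=
  weightedSum_bary hs (tangent_mem_range v.2)

theorem weightedSum_pointWeights {s : Finset (E n)} (hs : IsSimplex s) {x : E n}
    (hx : x ∈ affineSpan ℝ (s : Set (E n))) : weightedSum s (pointWeights s x) = (1, x) :=
  weightedSum_bary hs (point_mem_range hs.1 hx)

theorem pointWeights_vertex {s : Finset (E n)} (hs : IsSimplex s) (i : s) :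
    pointWeights s (i : E n) = Pi.single i 1 := by
  rw [pointWeights, ← weightedSum_single, bary_weightedSum hs]

theorem Cell.mem_affineSpan {s : Finset (E n)} (x : Cell s) :
    (x : E n) ∈ affineSpan ℝ (s : Set (E n)) := convexHull_subset_affineSpan _ x.2

/-- A vertex as a point of the closed simplex. -/
def Cell.vertex {s : Finset (E n)} (i : s) : Cell s := ⟨i, subset_convexHull ℝ _ i.2⟩

/-- A difference of vertices as a tangent vector. -/
def edgeVector {s : Finset (E n)} (i o : s) : Tan s :=
  ⟨(i : E n) - o, vsub_mem_vectorSpan ℝ i.2 o.2⟩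

theorem tangentWeights_edgeVector {s : Finset (E n)} (hs : IsSimplex s) (i o : s) :
    tangentWeights s (edgeVector i o) = Pi.single i 1 - Pi.single o 1 := by
  apply weightedSum_injective hs
  rw [weightedSum_tangentWeights hs, map_sub, weightedSum_single, weightedSum_single]
  simp [edgeVector]

/-- The combination of vertex differences `∑ wᵢ (xᵢ - o)`. -/
def tangentOf {s : Finset (E n)} (o : s) : (s → ℝ) →ₗ[ℝ] Tan s :=
  Fintype.linearCombination ℝ fun i : s => edgeVector i o

theorem tangentOf_apply {s : Finset (E n)} (o : s) (w : s → ℝ) :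
    tangentOf o w = ∑ i, w i • edgeVector i o := by
  simp [tangentOf, Fintype.linearCombination_apply]

theorem coe_tangentOf {s : Finset (E n)} (o : s) (w : s → ℝ) :
    (tangentOf o w : E n) = (weightedSum s w).2 - (weightedSum s w).1 • (o : E n) := by
  simp [tangentOf_apply, weightedSum_apply, edgeVector, smul_sub, Finset.sum_smul]

theorem tangentOf_tangentWeights {s : Finset (E n)} (hs : IsSimplex s) (o : s) (v : Tan s) :
    tangentOf o (tangentWeights s v) = v := by
  ext1
  rw [coe_tangentOf, weightedSum_tangentWeights hs]
  simp

/-- The form on a simplex given in homogeneous barycentric coordinates, `x ↦ ω(x, ·)`. -/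
def whitney (k ℓ : ℕ) (s : Finset (E n)) : AltForm (k + 1) ℓ (s → ℝ) →ₗ[ℝ] Field k ℓ s where
  toFun ω x := pullback k ℓ (tangentWeights s) (ω.curryLeft (pointWeights s x))
  map_add' ω η := by funext x; simp
  map_smul' c ω := by funext x; simp

theorem whitney_apply {s : Finset (E n)} (ω : AltForm (k + 1) ℓ (s → ℝ)) (x : Cell s)
    (v : Fin k → Tan s) (u : Fin ℓ → Tan s) :
    whitney k ℓ s ω x v u = ω (Matrix.vecCons (pointWeights s x) fun i => tangentWeights s (v i))
      fun j => tangentWeights s (u j) := rfl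

/-- The weights of `x` are those of `o` plus those of the tangent vector `x - o`; contraction with
them gives the constant and the linear part. -/
theorem whitney_mem_PmAlt {s : Finset (E n)} (ω : AltForm (k + 1) ℓ (s → ℝ)) :
    whitney k ℓ s ω ∈ PmAlt k ℓ s := by
  intro o
  refine ⟨pullback k ℓ (tangentWeights s) (ω.curryLeft (pointWeights s o)),
    pullback (k + 1) ℓ (tangentWeights s) ω, fun x => ?_⟩
  have h : pointWeights s x = pointWeights s o + tangentWeights s (euler s o x) := by
    simp [pointWeights, tangentWeights, euler, ← map_add]
  change pullback k ℓ _ _ = _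
  rw [h, map_add, map_add]
  congr 1
  ext v u
  simp [pullback_apply, comp_vecCons']

/-- The fixed vector `a` and the transferred vector `u j` occupy the first two places in opposite
orders on the two sides, whence the sign. -/
theorem SdagSucc_curryLeft {V : Type*} [AddCommGroup V] [Module ℝ V]
    (ω : AltForm (k + 2) ℓ V) (a : V) :
    SdagSucc k ℓ V (ω.curryLeft a) = -(SdagSucc (k + 1) ℓ V ω).curryLeft a := by
  ext v u
  simp only [SdagSucc_apply, AlternatingMap.neg_apply, AlternatingMap.curryLeft_apply_apply,
    ← Finset.sum_neg_distrib]
  refine Finset.sum_congr rfl fun j _ => ?_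
  have h : (1 : Fin (k + 2)).removeNth (Matrix.vecCons a (Matrix.vecCons (u j) v)) =
      Matrix.vecCons a v := by
    have := removeNth_succ_vecCons a (Matrix.vecCons (u j) v) 0
    rwa [removeNth_zero_vecCons] at this
  have h2 := alternating_cons_removeNth ω 0 a (Matrix.vecCons a (Matrix.vecCons (u j) v))
  have h3 := alternating_cons_removeNth ω 1 (u j) (Matrix.vecCons (u j) (Matrix.vecCons a v))
  have h4 : (1 : Fin (k + 2)).removeNth (Matrix.vecCons (u j) (Matrix.vecCons a v)) =
      Matrix.vecCons (u j) v := by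
    have := removeNth_succ_vecCons (u j) (Matrix.vecCons a v) 0
    rwa [removeNth_zero_vecCons] at this
  have hsw := ω.map_swap (Matrix.vecCons a (Matrix.vecCons (u j) v))
    (i := 0) (j := 1) (by simp)
  have hsw' : Matrix.vecCons a (Matrix.vecCons (u j) v) ∘ Equiv.swap (0 : Fin (k + 2)) 1 =
      Matrix.vecCons (u j) (Matrix.vecCons a v) := by
    funext i
    refine Fin.cases ?_ (fun i => Fin.cases ?_ (fun i => ?_) i) i
    · simp
    · simp
    · rw [Function.comp_apply, Equiv.swap_apply_of_ne_of_ne (Fin.succ_ne_zero _)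
        (by rw [← Fin.succ_zero_eq_one]; exact fun h => Fin.succ_ne_zero i (Fin.succ_inj.1 h))]
      simp
  rw [hsw'] at hsw
  rw [hsw]
  simp

/-- Contraction of the first slot, on all bidegrees at once. -/
def totalCurry {V : Type*} [AddCommGroup V] [Module ℝ V] (a : V) : Total V →ₗ[ℝ] Total V where
  toFun X k ℓ := (X (k + 1) ℓ).curryLeft a
  map_add' X Y := by funext k ℓ; simp
  map_smul' c X := by funext k ℓ; simp

theorem totalDown_totalCurry {V : Type*} [AddCommGroup V] [Module ℝ V] (a : V) (X : Total V) :
    totalDown V (totalCurry a X) = (-1 : ℝ) • totalCurry a (totalDown V X) := by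
  funext k ℓ
  cases ℓ with
  | zero =>
    ext v u
    simp [totalCurry, totalDown]
  | succ ℓ =>
    refine (SdagSucc_curryLeft _ _).trans ?_
    ext v u
    simp [totalDown, totalCurry]

theorem totalDown_pow_totalCurry {V : Type*} [AddCommGroup V] [Module ℝ V] (a : V) (p : ℕ)
    (X : Total V) : (totalDown V ^ p) (totalCurry a X) =
      (-1 : ℝ) ^ p • totalCurry a ((totalDown V ^ p) X) := by
  induction p with
  | zero => simp
  | succ p ih =>
    rw [pow_succ' (totalDown V), Module.End.mul_apply, ih, map_smul, totalDown_totalCurry,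
      smul_smul, ← pow_succ, Module.End.mul_apply]

theorem totalPull_totalDown_pow {V W : Type*} [AddCommGroup V] [Module ℝ V] [AddCommGroup W]
    [Module ℝ W] (f : V →ₗ[ℝ] W) (p : ℕ) (X : Total W) :
    totalPull f ((totalDown W ^ p) X) = (totalDown V ^ p) (totalPull f X) := by
  induction p with
  | zero => simp
  | succ p ih =>
    rw [pow_succ', pow_succ', Module.End.mul_apply, Module.End.mul_apply, totalPull_totalDown, ih]

/-- Bidegree-wise `whitney` at a point. -/
def totalWhitney (s : Finset (E n)) (x : Cell s) : Total (s → ℝ) →ₗ[ℝ] Total (Tan s) :=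
  totalPull (tangentWeights s) ∘ₗ totalCurry (pointWeights s x)

theorem totalDown_pow_totalWhitney (s : Finset (E n)) (x : Cell s) (p : ℕ)
    (X : Total (s → ℝ)) : (totalDown (Tan s) ^ p) (totalWhitney s x X) =
      (-1 : ℝ) ^ p • totalWhitney s x ((totalDown (s → ℝ) ^ p) X) := by
  rw [totalWhitney, LinearMap.comp_apply, ← totalPull_totalDown_pow, totalDown_pow_totalCurry,
    map_smul, LinearMap.comp_apply]

/-- Transfer of weights from the vertices of `a` to those of `b`: restriction to the common
vertices, extended by zero. -/
def transfer (a b : Finset (E n)) : (a → ℝ) →ₗ[ℝ] (b → ℝ) :=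
  open Classical in
  LinearMap.pi fun j => if h : (j : E n) ∈ a then LinearMap.proj ⟨j, h⟩ else 0

theorem transfer_apply_of_mem {a b : Finset (E n)} (w : a → ℝ) {j : b} (h : (j : E n) ∈ a) :
    transfer a b w j = w ⟨j, h⟩ := by simp [transfer, h]

theorem transfer_apply_of_notMem {a b : Finset (E n)} (w : a → ℝ) {j : b} (h : (j : E n) ∉ a) :
    transfer a b w j = 0 := by simp [transfer, h]

/-- The projection setting the weight of the vertex `i` to zero. -/
def dropVertex {s : Finset (E n)} (i : s) : (s → ℝ) →ₗ[ℝ] (s → ℝ) :=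
  open Classical in
  LinearMap.pi fun j => if j = i then 0 else LinearMap.proj j

theorem dropVertex_apply_self {s : Finset (E n)} (i : s) (w : s → ℝ) : dropVertex i w i = 0 := by
  simp [dropVertex]

theorem dropVertex_apply_of_ne {s : Finset (E n)} {i j : s} (h : j ≠ i) (w : s → ℝ) :
    dropVertex i w j = w j := by simp [dropVertex, h]

theorem IsSimplex.subset {s t : Finset (E n)} (hs : IsSimplex s) (h : t ⊆ s) (ht : t.Nonempty) :
    IsSimplex t := ⟨ht, hs.2.mono (Finset.coe_subset.2 h)⟩

theorem weightedSum_transfer {s t : Finset (E n)} (h : t ⊆ s) (w : t → ℝ) :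
    weightedSum s (transfer t s w) = weightedSum t w := by
  classical
  have key : weightedSum s ∘ₗ transfer t s = weightedSum t := by
    refine (Pi.basisFun ℝ t).ext fun i => ?_
    have : transfer t s (Pi.single i 1) = Pi.single ⟨i, h i.2⟩ 1 := by
      funext j
      by_cases hj : (j : E n) ∈ t
      · rw [transfer_apply_of_mem _ hj, Pi.single_apply, Pi.single_apply]
        simp [Subtype.ext_iff]
      · rw [transfer_apply_of_notMem _ hj, Pi.single_eq_of_ne]
        rintro rfl
        exact hj i.2
    rw [Pi.basisFun_apply, LinearMap.comp_apply, this, weightedSum_single, weightedSum_single]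
  exact LinearMap.congr_fun key w

theorem pointWeights_transfer {s t : Finset (E n)} (hs : IsSimplex s) (h : t ⊆ s)
    (ht : t.Nonempty) {x : E n} (hx : x ∈ affineSpan ℝ (t : Set (E n))) :
    pointWeights s x = transfer t s (pointWeights t x) := by
  apply weightedSum_injective hs
  rw [weightedSum_transfer h, weightedSum_pointWeights (hs.subset h ht) hx,
    weightedSum_pointWeights hs (affineSpan_mono ℝ (Finset.coe_subset.2 h) hx)]

theorem tangentWeights_transfer {s t : Finset (E n)} (hs : IsSimplex s) (h : t ⊆ s)
    (ht : t.Nonempty) (v : Tan t) :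
    tangentWeights s (Submodule.inclusion (vectorSpan_mono ℝ (Finset.coe_subset.2 h)) v) =
      transfer t s (tangentWeights t v) := by
  apply weightedSum_injective hs
  rw [weightedSum_transfer h, weightedSum_tangentWeights (hs.subset h ht),
    weightedSum_tangentWeights hs]
  rfl

/-- The weights in `s` of a point or tangent vector of `t` are its weights in `t`, extended by zero
to the other vertices. -/
theorem trace_whitney {s t : Finset (E n)} (hs : IsSimplex s) (h : t ⊆ s) (ht : t.Nonempty)
    (ω : AltForm (k + 1) ℓ (s → ℝ)) :
    trace k ℓ h (whitney k ℓ s ω) = whitney k ℓ t (pullback (k + 1) ℓ (transfer t s) ω) := by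
  ext x v u
  change whitney k ℓ s ω _ _ _ = _
  rw [whitney_apply, whitney_apply, pullback_apply, comp_vecCons']
  simp only [tangentWeights_transfer hs h ht]
  rw [pointWeights_transfer hs h ht x.mem_affineSpan]

end Barycentric

end FormValued
end
noncomputable section
namespace FormValued

/-! ### Bubbles in barycentric coordinates and their images under `𝒮_{†,[p]}`. -/

section Bubbles

variable {n k ℓ : ℕ}

theorem mem_BmAlt {s : Finset (E n)} {ω : Field k ℓ s} :
    ω ∈ BmAlt k ℓ s ↔ ω ∈ PmAlt k ℓ s ∧
      ∀ (t : Finset (E n)) (h : t ⊂ s), t.Nonempty → trace k ℓ h.subset ω = 0 := by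
  simp only [BmAlt, Submodule.mem_inf, Submodule.mem_iInf, LinearMap.mem_ker, Subtype.forall]
  exact and_congr_right fun _ =>
    ⟨fun h t ht hne => h t ⟨hne, ht⟩, fun h t ht => h t ht.2 ht.1⟩

/-- Multiples of the first argument may be removed from the others; used to replace edge vectors by
vertices in barycentric coordinates. -/
theorem alternating_cons_sub_smul {V N : Type*} [AddCommGroup V] [Module ℝ V] [AddCommGroup N]
    [Module ℝ N] (f : V [⋀^Fin (k + 1)]→ₗ[ℝ] N) (a : V) (c : Fin k → ℝ) (v : Fin k → V) :
    f (Matrix.vecCons a fun j => v j - c j • a) = f (Matrix.vecCons a v) := by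
  classical
  have key : ∀ S : Finset (Fin k),
      f.curryLeft a (fun j => if j ∈ S then v j - c j • a else v j) = f.curryLeft a v := by
    intro S
    induction S using Finset.induction_on with
    | empty => simp
    | insert i S hi ih =>
      set w : Fin k → V := fun j => if j ∈ S then v j - c j • a else v j with hw
      have h1 : (fun j => if j ∈ insert i S then v j - c j • a else v j) =
          Function.update w i (v i - c i • a) := by
        funext j
        by_cases hj : j = i
        · subst hj; simp
        · simp [hj, hw]
      have h2 : Function.update w i (v i) = w := by
        rw [Function.update_eq_self_iff]; simp [hw, hi]
      have h3 : f.curryLeft a (Function.update w i a) = 0 := by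
        rw [AlternatingMap.curryLeft_apply_apply]
        refine f.map_eq_zero_of_eq _ (i := 0) (j := i.succ) ?_ (Fin.succ_ne_zero i).symm
        simp
      rw [h1, AlternatingMap.map_update_sub, h2, AlternatingMap.map_update_smul, h3, ih]
      simp
  simpa using key Finset.univ

/-- Every form in `𝒫⁻Alt` is given by a constant form in homogeneous barycentric coordinates. -/
theorem exists_homogeneous {s : Finset (E n)} (hs : IsSimplex s) {ω : Field k ℓ s}
    (hω : ω ∈ PmAlt k ℓ s) :
    ∃ η : (s → ℝ) [⋀^Fin (k + 1)]→ₗ[ℝ] ((Tan s) [⋀^Fin ℓ]→ₗ[ℝ] ℝ), ∀ (x : Cell s) v,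
      ω x v = η (Matrix.vecCons (pointWeights s x) fun i => tangentWeights s (v i)) := by
  obtain ⟨o, ho⟩ := hs.1
  let o' : s := ⟨o, ho⟩
  obtain ⟨a, b, hab⟩ := hω ⟨o, subset_affineSpan ℝ _ ho⟩
  let σ : (s → ℝ) →ₗ[ℝ] ℝ := LinearMap.fst ℝ ℝ (E n) ∘ₗ weightedSum s
  -- With `σ` the sum of the weights, the form is `b + σ ∧ a`: since `σ` is one on points and zero
  -- on tangent vectors, only `a(v)` survives from the wedge, while `b` sees `x - o`.
  refine ⟨b.compLinearMap (tangentOf o') + AlternatingMap.alternatizeUncurryFin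
    (σ.smulRight (a.compLinearMap (tangentOf o'))), fun x v => ?_⟩
  have hx := weightedSum_pointWeights hs x.mem_affineSpan
  have hσx : σ (pointWeights s x) = 1 := by simp [σ, hx]
  have hσv : ∀ v : Tan s, σ (tangentWeights s v) = 0 := fun v => by
    simp [σ, weightedSum_tangentWeights hs]
  have hq : tangentOf o' (pointWeights s x) =
      euler s ⟨o, subset_affineSpan ℝ _ ho⟩ x := by
    ext1
    rw [coe_tangentOf, hx]
    simp [euler, o']
  rw [hab, AlternatingMap.add_apply, AlternatingMap.add_apply, alternatizeUncurryFin_apply_real,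
    Fin.sum_univ_succ, Finset.sum_eq_zero (s := Finset.univ)
      (f := fun i : Fin k => (-1 : ℝ) ^ ((i.succ : Fin (k + 1)) : ℕ) • _), add_zero, add_comm]
  · congr 1
    · rw [AlternatingMap.compLinearMap_apply, comp_vecCons', hq]
      simp only [tangentOf_tangentWeights hs]
      rfl
    · rw [removeNth_zero_vecCons]
      simp [hσx, tangentOf_tangentWeights hs]
  · intro i _
    simp [hσv]

theorem tangentOf_mem_of_apply_eq_zero {s t : Finset (E n)} {o : s} (ho : (o : E n) ∈ t)
    {w : s → ℝ} (hw : ∀ j : s, (j : E n) ∉ t → w j = 0) : (tangentOf o w : E n) ∈ Tan t := by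
  rw [tangentOf_apply, AddSubmonoidClass.coe_finsetSum]
  refine Submodule.sum_mem _ fun j _ => ?_
  by_cases hj : (j : E n) ∈ t
  · exact Submodule.smul_mem _ _ (vsub_mem_vectorSpan ℝ hj ho)
  · simp [hw j hj]

/-- The homogeneous representation of a form with vanishing trace on the facet opposite to `i`
vanishes on that facet. -/
theorem homogeneous_eq_zero_of_trace {s : Finset (E n)} (hs : IsSimplex s) {ω : Field k ℓ s}
    {η : (s → ℝ) [⋀^Fin (k + 1)]→ₗ[ℝ] ((Tan s) [⋀^Fin ℓ]→ₗ[ℝ] ℝ)}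
    (hη : ∀ (x : Cell s) v,
      ω x v = η (Matrix.vecCons (pointWeights s x) fun i => tangentWeights s (v i)))
    {t : Finset (E n)} (h : t ⊆ s) (htr : t.Nonempty → trace k ℓ h ω = 0) {i : s}
    (hi : ∀ j ∈ s, j ≠ (i : E n) → j ∈ t) (w : Fin (k + 1) → s → ℝ) (u : Fin ℓ → Tan s)
    (hu : ∀ j, (u j : E n) ∈ Tan t) : η (fun j => dropVertex i (w j)) u = 0 := by
  classical
  have hle : Tan t ≤ Tan s := vectorSpan_mono ℝ (Finset.coe_subset.2 h)
  -- It suffices to test on coordinate vectors of vertices. If none is `i`, they span a face of `t`,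
  -- where the value is that of `ω` at the vertex `I 0` on the edges leaving it.
  have key : (pullAlt ℓ (Submodule.inclusion hle)).compAlternatingMap
      (η.compLinearMap (dropVertex i)) = 0 := by
    refine (Pi.basisFun ℝ s).ext_alternating fun I _ => ?_
    ext u'
    change η (fun j => dropVertex i (Pi.basisFun ℝ s (I j))) (fun j => Submodule.inclusion hle (u' j))
      = 0
    simp only [Pi.basisFun_apply]
    by_cases hI : ∃ j, I j = i
    · obtain ⟨j, hj⟩ := hI
      rw [η.map_coord_zero j, AlternatingMap.zero_apply]
      funext r
      by_cases hr : r = i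
      · rw [hr, dropVertex_apply_self]; rfl
      · rw [dropVertex_apply_of_ne hr, hj, Pi.single_eq_of_ne hr]; rfl
    · push Not at hI
      have hd : ∀ j, dropVertex i (Pi.single (I j) (1 : ℝ)) = Pi.single (I j) 1 := fun j => by
        funext r
        by_cases hr : r = i
        · rw [hr, dropVertex_apply_self, Pi.single_eq_of_ne (hI j).symm]
        · rw [dropVertex_apply_of_ne hr]
      simp only [hd]
      have hIt : ∀ j, (I j : E n) ∈ t := fun j =>
        hi _ (I j).2 fun hh => hI j (Subtype.ext hh)
      have h0 := htr ⟨_, hIt 0⟩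
      let x0 : Cell t := Cell.vertex ⟨I 0, hIt 0⟩
      have h1 := congrFun h0 x0
      have h2 := DFunLike.congr_fun (DFunLike.congr_fun h1
        fun j : Fin k => edgeVector (s := t) ⟨I j.succ, hIt _⟩ ⟨I 0, hIt 0⟩) u'
      change ω ⟨(I 0 : E n), _⟩ (fun j => edgeVector (I j.succ) (I 0)) _ = 0 at h2
      rw [hη] at h2
      simp only [tangentWeights_edgeVector hs, pointWeights_vertex hs] at h2
      have h3 := alternating_cons_sub_smul η (Pi.single (I 0) 1) (fun _ => 1)
        fun j : Fin k => Pi.single (I j.succ) (1 : ℝ)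
      simp only [one_smul] at h3
      rw [h3] at h2
      convert h2 using 2
      congr 1
      funext j
      refine Fin.cases rfl (fun j => rfl) j
  have h2 := DFunLike.congr_fun (DFunLike.congr_fun key w) fun j => (⟨u j, hu j⟩ : Tan t)
  exact h2

/-- Bubbles come from forms in barycentric coordinates that vanish on every facet in both slots. -/
theorem exists_whitney_eq_of_mem_BmAlt {s : Finset (E n)} (hs : IsSimplex s) {ω : Field k ℓ s}
    (hω : ω ∈ BmAlt k ℓ s) : ∃ ζ : AltForm (k + 1) ℓ (s → ℝ), whitney k ℓ s ζ = ω ∧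
      ∀ i : s, pullback (k + 1) ℓ (dropVertex i) ζ = 0 := by
  classical
  rw [mem_BmAlt] at hω
  obtain ⟨η, hη⟩ := exists_homogeneous hs hω.1
  -- The second slot must be extended from tangent vectors to all weights. A single origin would
  -- break the vanishing on the facet opposite to it, so the origin used in the second slot is the
  -- vertex `r` fed to the first slot; alternating and dividing by `k + 1` restores the symmetry.
  let G : (s → ℝ) →ₗ[ℝ] AltForm k ℓ (s → ℝ) :=
    Fintype.linearCombination ℝ fun r : s =>
      (pullAlt ℓ (tangentOf r)).compAlternatingMap (η.curryLeft (Pi.single r 1))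
  have hG : ∀ w v u, G w v u = ∑ r : s, w r *
      η (Matrix.vecCons (Pi.single r 1) v) (fun j => tangentOf r (u j)) := by
    intro w v u
    simp only [G, Fintype.linearCombination_apply, alternatingMap_sum_apply,
      AlternatingMap.smul_apply, smul_eq_mul]
    rfl
  refine ⟨((k : ℝ) + 1)⁻¹ • AlternatingMap.alternatizeUncurryFin G, ?_, fun i => ?_⟩
  · funext x
    ext v u
    rw [whitney_apply, hη]
    set w : Fin (k + 1) → s → ℝ :=
      Matrix.vecCons (pointWeights s x) fun i => tangentWeights s (v i) with hw
    -- On tangent weights the origin is irrelevant, so each of the `k + 1` terms of the alternation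
    -- reproduces `η`.
    have h1 : ∀ i : Fin (k + 1), G (w i) (i.removeNth w) (fun j => tangentWeights s (u j)) =
        (-1 : ℝ) ^ (i : ℕ) * η w u := by
      intro i
      have h3 : (w i) = ∑ r, w i r • (Pi.single r 1 : s → ℝ) := by
        funext r
        simp [Finset.sum_apply, Pi.single_apply]
      have h2 : η (Matrix.vecCons (w i) (i.removeNth w)) = (-1 : ℝ) ^ (i : ℕ) • η w := by
        rw [alternating_cons_removeNth, Function.update_eq_self]
      rw [← smul_eq_mul, ← AlternatingMap.smul_apply, ← h2, hG]
      simp only [tangentOf_tangentWeights hs]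
      conv_rhs => rw [h3]
      have h4 := map_sum (η.curryLeft) (fun r => w i r • (Pi.single r 1 : s → ℝ)) Finset.univ
      have h5 := DFunLike.congr_fun (DFunLike.congr_fun h4 (i.removeNth w)) u
      rw [alternatingMap_sum_apply, alternatingMap_sum_apply] at h5
      refine Eq.trans ?_ h5.symm
      refine Finset.sum_congr rfl fun r _ => ?_
      rw [map_smul]
      rfl
    rw [AlternatingMap.smul_apply, AlternatingMap.smul_apply, alternatizeUncurryFin_apply_real,
      alternatingMap_sum_apply]
    simp only [AlternatingMap.smul_apply, smul_eq_mul, h1, neg_one_pow_mul_self_mul]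
    rw [Finset.sum_const, Finset.card_univ, Fintype.card_fin, nsmul_eq_mul]
    push_cast
    rw [inv_mul_cancel_left₀ (by positivity)]
  · ext w u
    rw [pullback_apply, AlternatingMap.smul_apply, AlternatingMap.smul_apply,
      alternatizeUncurryFin_apply_real, alternatingMap_sum_apply, Finset.sum_eq_zero, smul_zero]
    · rfl
    intro j _
    rw [AlternatingMap.smul_apply, hG, Finset.sum_eq_zero, smul_zero]
    intro r _
    -- The term `r = i` has coefficient zero. For `r ≠ i` the origin lies on the facet opposite to
    -- `i`, so the second arguments are tangent to it and `η` vanishes.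
    by_cases hr : r = i
    · rw [hr, dropVertex_apply_self, zero_mul]
    · have hmem : (r : E n) ∈ s.erase i :=
        Finset.mem_erase.2 ⟨fun h => hr (Subtype.ext h), r.2⟩
      have h1 : (Pi.single r 1 : s → ℝ) = dropVertex i (Pi.single r 1) := by
        funext q
        by_cases hq : q = i
        · rw [hq, dropVertex_apply_self, Pi.single_eq_of_ne (Ne.symm hr)]
        · rw [dropVertex_apply_of_ne hq]
      have h2 : (Matrix.vecCons (Pi.single r 1)
          (j.removeNth fun q => dropVertex i (w q)) : Fin (k + 1) → s → ℝ) =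
          fun q => dropVertex i (Matrix.vecCons (Pi.single r 1) (j.removeNth w) q) := by
        rw [comp_vecCons', ← h1]
        rfl
      rw [h2, homogeneous_eq_zero_of_trace hs hη (Finset.erase_subset (i : E n) s)
        (fun hne => hω.2 _ (Finset.erase_ssubset i.2) hne) (i := i)
        (fun j hj hji => Finset.mem_erase.2 ⟨hji, hj⟩), mul_zero]
      refine fun q => tangentOf_mem_of_apply_eq_zero hmem fun m hm => ?_
      have : m = i := by
        by_contra hmi
        exact hm (Finset.mem_erase.2 ⟨fun h => hmi (Subtype.ext h), m.2⟩)
      rw [this, dropVertex_apply_self]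

/-- A map whose `i`-th coordinate is zero factors through `dropVertex i`. Vanishing on facets thus
passes to all proper faces. -/
theorem pullback_eq_zero_of_dropVertex {W : Type*} [AddCommGroup W] [Module ℝ W]
    {s : Finset (E n)} {ζ : AltForm k ℓ (s → ℝ)}
    {i : s} (h : pullback k ℓ (dropVertex i) ζ = 0) (g : W →ₗ[ℝ] (s → ℝ)) (hg : ∀ w, g w i = 0) :
    pullback k ℓ g ζ = 0 := by
  have : g = dropVertex i ∘ₗ g := by
    ext w j
    by_cases hj : j = i
    · rw [LinearMap.comp_apply, hj, dropVertex_apply_self, hg]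
    · rw [LinearMap.comp_apply, dropVertex_apply_of_ne hj]
  rw [this]
  change pullback k ℓ g (pullback k ℓ (dropVertex i) ζ) = 0
  rw [h, map_zero]

theorem whitney_mem_BmAlt {s : Finset (E n)} (hs : IsSimplex s)
    {ζ : AltForm (k + 1) ℓ (s → ℝ)} (h : ∀ i : s, pullback (k + 1) ℓ (dropVertex i) ζ = 0) :
    whitney k ℓ s ζ ∈ BmAlt k ℓ s := by
  rw [mem_BmAlt]
  refine ⟨whitney_mem_PmAlt ζ, fun t ht hne => ?_⟩
  obtain ⟨i, hi, hit⟩ := Finset.exists_of_ssubset ht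
  rw [trace_whitney hs ht.subset hne, pullback_eq_zero_of_dropVertex (h ⟨i, hi⟩) _ fun w =>
    transfer_apply_of_notMem w hit, map_zero]

/-- Pointwise application of `𝒮_{†,[p]}`. -/
abbrev fieldS (p k ℓ : ℕ) (s : Finset (E n)) : Field k ℓ s →ₗ[ℝ] Field (k - p) (ℓ + p) s :=
  (SdagIter (Tan s) k ℓ p).compLeft (Cell s)

theorem SdagIter_whitney {s : Finset (E n)} {p : ℕ} (hp : p ≤ k) (Z : Total (s → ℝ)) :
    fieldS p k ℓ s (whitney k ℓ s (Z (k + 1) ℓ)) =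
      (-1 : ℝ) ^ p • whitney (k - p) (ℓ + p) s
        ((totalDown (s → ℝ) ^ p) Z (k - p + 1) (ℓ + p)) := by
  funext x
  have h := SdagIter_eq_totalDown (totalWhitney s x Z) k ℓ hp
  rw [totalDown_pow_totalWhitney] at h
  exact h

theorem trace_fieldS {s t : Finset (E n)} (h : t ⊆ s) (p : ℕ) (ω : Field k ℓ s) :
    trace (k - p) (ℓ + p) h (fieldS p k ℓ s ω) = fieldS p k ℓ t (trace k ℓ h ω) := by
  funext x
  exact pullback_SdagIter _ k ℓ p _

theorem trace_mem_PmAlt {s t : Finset (E n)} (h : t ⊆ s) {ω : Field k ℓ s}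
    (hω : ω ∈ PmAlt k ℓ s) : trace k ℓ h ω ∈ PmAlt k ℓ t := by
  intro o
  obtain ⟨a, b, hab⟩ := hω ⟨o, affineSpan_mono ℝ (Finset.coe_subset.2 h) o.2⟩
  have hle : Tan t ≤ Tan s := vectorSpan_mono ℝ (Finset.coe_subset.2 h)
  refine ⟨pullback k ℓ (Submodule.inclusion hle) a,
    pullback (k + 1) ℓ (Submodule.inclusion hle) b, fun x => ?_⟩
  change pullback k ℓ (Submodule.inclusion hle) (ω _) = _
  rw [hab, map_add]
  congr 1
  ext v u
  simp only [pullback_apply, AlternatingMap.curryLeft_apply_apply, comp_vecCons']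
  rfl

theorem trace_trace {s t r : Finset (E n)} (h : t ⊆ s) (h' : r ⊆ t) (ω : Field k ℓ s) :
    trace k ℓ h' (trace k ℓ h ω) = trace k ℓ (h'.trans h) ω := rfl

theorem trace_self {s : Finset (E n)} (h : s ⊆ s) (ω : Field k ℓ s) : trace k ℓ h ω = ω := rfl

theorem exists_whitney_eq {s : Finset (E n)} (hs : IsSimplex s) {ω : Field k ℓ s}
    (hω : ω ∈ PmAlt k ℓ s) : ∃ ζ : AltForm (k + 1) ℓ (s → ℝ), whitney k ℓ s ζ = ω := by
  obtain ⟨η, hη⟩ := exists_homogeneous hs hω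
  obtain ⟨o, ho⟩ := hs.1
  refine ⟨(pullAlt ℓ (tangentOf ⟨o, ho⟩)).compAlternatingMap η, ?_⟩
  funext x
  ext v u
  rw [hη]
  change η _ (fun j => tangentOf _ (tangentWeights s (u j))) = _
  simp only [tangentOf_tangentWeights hs]
  rfl

theorem fieldS_mem_PmAlt {s : Finset (E n)} (hs : IsSimplex s) (p : ℕ) {ω : Field k ℓ s}
    (hω : ω ∈ PmAlt k ℓ s) : fieldS p k ℓ s ω ∈ PmAlt (k - p) (ℓ + p) s := by
  rcases lt_or_ge k p with h | h
  · have : fieldS p k ℓ s ω = 0 := by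
      funext x
      exact LinearMap.congr_fun (SdagIter_eq_zero_of_lt h) (ω x)
    rw [this]
    exact Submodule.zero_mem _
  · obtain ⟨ζ, rfl⟩ := exists_whitney_eq hs hω
    have := SdagIter_whitney (ℓ := ℓ) h (pureForm ζ)
    rw [pureForm_self] at this
    rw [this]
    exact Submodule.smul_mem _ _ (whitney_mem_PmAlt _)

/-- This is where `k + 1 ≤ ℓ + p` enters: it is the Lefschetz condition for the barycentric form of
`y`, of bidegree `(k - p + 1, ℓ + p)`. The preimage is killed by every `dropVertex`, hence is a
bubble. -/
theorem exists_bubble_fieldS_eq {s : Finset (E n)} (hs : IsSimplex s) {p : ℕ} (hp : p ≤ k)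
    (hkl : k + 1 ≤ ℓ + p) {y : Field (k - p) (ℓ + p) s} (hy : y ∈ BmAlt (k - p) (ℓ + p) s) :
    ∃ x ∈ BmAlt k ℓ s, fieldS p k ℓ s x = y := by
  obtain ⟨ζ, hζ, hζ0⟩ := exists_whitney_eq_of_mem_BmAlt hs hy
  obtain ⟨Z, hZ0, hZ⟩ := exists_totalDown_pow_eq (fun i : s => dropVertex i) (p := p)
    (by omega) ζ hζ0
  refine ⟨(-1 : ℝ) ^ p • whitney k ℓ s (Z (k + 1) ℓ),
    Submodule.smul_mem _ _ (whitney_mem_BmAlt hs fun i => hZ0 i _ _), ?_⟩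
  rw [map_smul, SdagIter_whitney hp, hZ, hζ, smul_smul, ← mul_pow]
  simp

/-- Composing with the restriction of weights to `σ` extends the form. On a face missing a vertex of
`σ`, the restricted weight of that vertex is zero, and the bubble vanishes there. -/
theorem exists_extension {K σ : Finset (E n)} (hK : IsSimplex K) (h : σ ⊆ K) (hσ : σ.Nonempty)
    {b : Field k ℓ σ} (hb : b ∈ BmAlt k ℓ σ) :
    ∃ x ∈ PmAlt k ℓ K, trace k ℓ h x = b ∧
      ∀ (τ : Finset (E n)) (hτ : τ ⊆ K), τ.Nonempty → ¬ σ ⊆ τ → trace k ℓ hτ x = 0 := by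
  obtain ⟨ζ, rfl, hζ0⟩ := exists_whitney_eq_of_mem_BmAlt (hK.subset h hσ) hb
  refine ⟨whitney k ℓ K (pullback (k + 1) ℓ (transfer K σ) ζ), whitney_mem_PmAlt _, ?_, ?_⟩
  · rw [trace_whitney hK h hσ]
    change whitney k ℓ σ (pullback (k + 1) ℓ (transfer K σ ∘ₗ transfer σ K) ζ) = _
    have : transfer K σ ∘ₗ transfer σ K = LinearMap.id := by
      refine LinearMap.ext fun w => funext fun j => ?_
      rw [LinearMap.comp_apply, transfer_apply_of_mem _ (h j.2)]
      exact transfer_apply_of_mem w j.2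
    rw [this]
    rfl
  · intro τ hτ hne hστ
    obtain ⟨i, hi, hit⟩ := Finset.not_subset.1 hστ
    rw [trace_whitney hK hτ hne]
    change whitney k ℓ τ (pullback (k + 1) ℓ (transfer K σ ∘ₗ transfer τ K) ζ) = 0
    rw [pullback_eq_zero_of_dropVertex (hζ0 ⟨i, hi⟩), map_zero]
    intro w
    rw [LinearMap.comp_apply, transfer_apply_of_mem _ (h hi), transfer_apply_of_notMem _ hit]

end Bubbles

end FormValued
end
noncomputable section
namespace FormValued

/-! ### Extension of bubbles within the kernel of `𝒮_{†,[p]}`. -/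

section Extension

variable {n k ℓ : ℕ}

/-- Triangularity: extensions attached to the faces with `m` vertices do not interfere with each
other on such faces, nor with smaller ones. -/
theorem trace_sum_powersetCard {K : Finset (E n)} {m : ℕ} {e : Finset (E n) → Field k ℓ K}
    (he : ∀ σ ∈ K.powersetCard m, ∀ (τ : Finset (E n)) (hτ : τ ⊆ K), τ.Nonempty → τ.card ≤ m →
      τ ≠ σ → trace k ℓ hτ (e σ) = 0)
    {τ : Finset (E n)} (hτ : τ ⊆ K) (hne : τ.Nonempty) (hm : τ.card ≤ m) :
    trace k ℓ hτ (∑ σ ∈ K.powersetCard m, e σ) =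
      if τ.card = m then trace k ℓ hτ (e τ) else 0 := by
  classical
  rw [map_sum]
  split_ifs with h
  · have hmem : τ ∈ K.powersetCard m := Finset.mem_powersetCard.2 ⟨hτ, h⟩
    exact Finset.sum_eq_single_of_mem _ hmem fun σ hσ hne' => he σ hσ τ hτ hne hm hne'.symm
  · refine Finset.sum_eq_zero fun σ hσ => he σ hσ τ hτ hne hm ?_
    rintro rfl
    exact h (Finset.mem_powersetCard.1 hσ).2

theorem trace_mem_BmAlt {K σ : Finset (E n)} (h : σ ⊆ K) {ω : Field k ℓ K}
    (hω : ω ∈ PmAlt k ℓ K)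
    (h0 : ∀ (τ : Finset (E n)) (hτ : τ ⊆ K), τ.Nonempty → τ.card < σ.card →
      trace k ℓ hτ ω = 0) : trace k ℓ h ω ∈ BmAlt k ℓ σ := by
  rw [mem_BmAlt]
  refine ⟨trace_mem_PmAlt h hω, fun τ hτ hne => ?_⟩
  rw [trace_trace]
  exact h0 τ _ hne (Finset.card_lt_card hτ)

theorem ne_of_card_le {σ τ : Finset (E n)} (hc : τ.card ≤ σ.card) (hne : τ ≠ σ) : ¬ σ ⊆ τ :=
  fun h => hne (Finset.eq_of_subset_of_card_le h hc).symm

/-- `𝒮_{†,[p]} : 𝒫⁻Alt → 𝒫⁻Alt` is onto, with control of the vanishing of low-dimensional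
traces. -/
theorem exists_fieldS_eq {K : Finset (E n)} (hK : IsSimplex K) {p : ℕ} (hp : p ≤ k)
    (hkl : k + 1 ≤ ℓ + p) (d m : ℕ) (hd : K.card ≤ m + d) {y : Field (k - p) (ℓ + p) K}
    (hy : y ∈ PmAlt (k - p) (ℓ + p) K)
    (hy0 : ∀ (τ : Finset (E n)) (hτ : τ ⊆ K), τ.Nonempty → τ.card ≤ m →
      trace (k - p) (ℓ + p) hτ y = 0) :
    ∃ x ∈ PmAlt k ℓ K, fieldS p k ℓ K x = y ∧
      ∀ (τ : Finset (E n)) (hτ : τ ⊆ K), τ.Nonempty → τ.card ≤ m → trace k ℓ hτ x = 0 := by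
  induction d generalizing m y with
  | zero =>
    have h := hy0 K (Finset.Subset.refl K) hK.1 hd
    rw [trace_self] at h
    refine ⟨0, Submodule.zero_mem _, ?_, fun _ _ _ _ => map_zero _⟩
    rw [h, map_zero]
  | succ d ih =>
    -- On a face with `m + 1` vertices the trace of `y` is a bubble; it has a bubble preimage, which
    -- is extended to `K`. Subtracting all these images clears one more level of traces.
    have hex : ∀ σ ∈ K.powersetCard (m + 1), ∃ e : Field k ℓ K, e ∈ PmAlt k ℓ K ∧
        (∀ h : σ ⊆ K, fieldS p k ℓ σ (trace k ℓ h e) = trace (k - p) (ℓ + p) h y) ∧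
        ∀ (τ : Finset (E n)) (hτ : τ ⊆ K), τ.Nonempty → τ.card ≤ m + 1 → τ ≠ σ →
          trace k ℓ hτ e = 0 := by
      intro σ hσ
      obtain ⟨hσK, hcard⟩ := Finset.mem_powersetCard.1 hσ
      have hne : σ.Nonempty := Finset.card_pos.1 (by omega)
      obtain ⟨c, hc, hcy⟩ := exists_bubble_fieldS_eq (hK.subset hσK hne) hp hkl
        (trace_mem_BmAlt hσK hy fun τ hτ hτn hlt => hy0 τ hτ hτn (by omega))
      obtain ⟨e, he, hec, he0⟩ := exists_extension hK hσK hne hc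
      exact ⟨e, he, fun h => by rw [hec, hcy], fun τ hτ hτn hcd hne' =>
        he0 τ hτ hτn (ne_of_card_le (by omega) hne')⟩
    choose! e he hey he0 using hex
    obtain ⟨x, hx, hxy, hx0⟩ := ih (m + 1) (by omega)
      (y := y + (-1 : ℝ) • fieldS p k ℓ K (∑ σ ∈ K.powersetCard (m + 1), e σ))
      (sub_mem_of_module hy (fieldS_mem_PmAlt hK p (Submodule.sum_mem _ he)))
      (fun τ hτ hne hcard => by
        rw [map_add, map_smul, trace_fieldS, trace_sum_powersetCard he0 hτ hne hcard]
        split_ifs with h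
        · rw [hey τ (Finset.mem_powersetCard.2 ⟨hτ, h⟩) hτ, add_neg_one_smul_self]
        · rw [map_zero, smul_zero, add_zero]
          exact hy0 τ hτ hne (by omega))
    refine ⟨x + ∑ σ ∈ K.powersetCard (m + 1), e σ,
      Submodule.add_mem _ hx (Submodule.sum_mem _ he), ?_, fun τ hτ hne hcard => ?_⟩
    · rw [map_add, hxy, add_assoc, add_comm (_ • _), add_neg_one_smul_self, add_zero]
    · rw [map_add, hx0 τ hτ hne (by omega), trace_sum_powersetCard he0 hτ hne (by omega),
        if_neg (by omega), add_zero]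

theorem mem_PmW {p : ℕ} {s : Finset (E n)} {ω : Field k ℓ s} :
    ω ∈ PmW p k ℓ s ↔ ω ∈ PmAlt k ℓ s ∧ fieldS p k ℓ s ω = 0 := Iff.rfl

theorem mem_BmW {p : ℕ} {s : Finset (E n)} {ω : Field k ℓ s} :
    ω ∈ BmW p k ℓ s ↔ ω ∈ BmAlt k ℓ s ∧ fieldS p k ℓ s ω = 0 := Iff.rfl

theorem mem_BmW_iff {p : ℕ} {s : Finset (E n)} {ω : Field k ℓ s} :
    ω ∈ BmW p k ℓ s ↔ ω ∈ PmW p k ℓ s ∧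
      ∀ (t : Finset (E n)) (h : t ⊂ s), t.Nonempty → trace k ℓ h.subset ω = 0 := by
  rw [mem_BmW, mem_PmW, mem_BmAlt]
  tauto

theorem BmW_le_PmW {p : ℕ} {s : Finset (E n)} : BmW p k ℓ s ≤ PmW p k ℓ s :=
  fun _ h => (mem_BmW_iff.1 h).1

theorem trace_mem_PmW {p : ℕ} {s t : Finset (E n)} (h : t ⊆ s) {ω : Field k ℓ s}
    (hω : ω ∈ PmW p k ℓ s) : trace k ℓ h ω ∈ PmW p k ℓ t :=
  mem_PmW.2 ⟨trace_mem_PmAlt h hω.1, by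
    rw [← trace_fieldS h, (mem_PmW.1 hω).2, map_zero]⟩

/-- Extension of the bubbles in `ℬ⁻𝕎` of a face to `𝒫⁻𝕎` of the simplex. -/
theorem exists_extension_PmW {K σ : Finset (E n)} (hK : IsSimplex K) {p : ℕ}
    (hkl : k + 1 ≤ ℓ + p) (h : σ ⊆ K) (hσ : σ.Nonempty) {b : Field k ℓ σ}
    (hb : b ∈ BmW p k ℓ σ) :
    ∃ x ∈ PmW p k ℓ K, trace k ℓ h x = b ∧
      ∀ (τ : Finset (E n)) (hτ : τ ⊆ K), τ.Nonempty → τ.card ≤ σ.card → τ ≠ σ →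
        trace k ℓ hτ x = 0 := by
  rw [mem_BmW] at hb
  obtain ⟨e, he, heb, he0⟩ := exists_extension hK h hσ hb.1
  rcases lt_or_ge k p with hp | hp
  · refine ⟨e, mem_PmW.2 ⟨he, ?_⟩, heb, fun τ hτ hne hc hne' =>
      he0 τ hτ hne (ne_of_card_le hc hne')⟩
    funext x
    exact LinearMap.congr_fun (SdagIter_eq_zero_of_lt hp) (e x)
  -- The image of the extension vanishes on all faces of at most `σ.card` vertices, on `σ` because
  -- `b` lies in the kernel. The correction `x` has zero traces there, so the trace on `σ` stays
  -- `b`.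
  · obtain ⟨x, hx, hxe, hx0⟩ := exists_fieldS_eq hK hp hkl K.card σ.card (by omega)
      (fieldS_mem_PmAlt hK p he) (fun τ hτ hne hc => by
        rw [trace_fieldS]
        by_cases hτσ : τ = σ
        · subst hτσ
          rw [heb, hb.2]
        · rw [he0 τ hτ hne (ne_of_card_le hc hτσ), map_zero])
    refine ⟨e + (-1 : ℝ) • x, mem_PmW.2 ⟨sub_mem_of_module he hx, ?_⟩, ?_, fun τ hτ hne hc hne' => ?_⟩
    · rw [map_add, map_smul, hxe]
      exact add_neg_one_smul_self _
    · rw [map_add, map_smul, heb, hx0 σ h hσ le_rfl]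
      simp
    · rw [map_add, map_smul, he0 τ hτ hne (ne_of_card_le hc hne'), hx0 τ hτ hne hc]
      simp

end Extension

end FormValued
end
noncomputable section
namespace FormValued

/-! ### The `L²` inner product is definite on `𝒫⁻Alt`. -/

section L2

variable {n k ℓ : ℕ}

/-- The surface measure on a closed simplex. -/
abbrev cellMeasure (s : Finset (E n)) : Measure (Cell s) :=
  (Measure.euclideanHausdorffMeasure (s.card - 1) : Measure (E n)).comap Subtype.val

theorem finrank_Tan {s : Finset (E n)} (hs : IsSimplex s) : finrank ℝ (Tan s) = s.card - 1 := by
  have hc : Fintype.card s = s.card - 1 + 1 := by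
    rw [Fintype.card_coe]
    have := hs.1.card_pos
    omega
  have h := hs.2.finrank_vectorSpan hc
  rwa [Subtype.range_coe_subtype, Finset.setOfPred_mem] at h

theorem isCompact_cell (s : Finset (E n)) : IsCompact (convexHull ℝ (s : Set (E n))) :=
  s.finite_toSet.isCompact_convexHull ℝ

instance (s : Finset (E n)) : CompactSpace (Cell s) :=
  isCompact_iff_compactSpace.1 (isCompact_cell s)

/-- The affine parametrization of the affine hull of a simplex by its tangent space. -/
def tangentChart (s : Finset (E n)) (o : E n) : Tan s →ᵃ[ℝ] E n :=
  (Tan s).subtype.toAffineMap + AffineMap.const ℝ (Tan s) o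

theorem tangentChart_apply (s : Finset (E n)) (o : E n) (v : Tan s) :
    tangentChart s o v = (v : E n) + o := rfl

theorem isometry_tangentChart (s : Finset (E n)) (o : E n) : Isometry (tangentChart s o) :=
  Isometry.of_dist_eq fun v w => by
    simp [tangentChart_apply, Subtype.dist_eq]

theorem image_tangentChart {s : Finset (E n)} (o : s) :
    tangentChart s o '' convexHull ℝ (Set.range fun i : s => edgeVector i o) =
      convexHull ℝ (s : Set (E n)) := by
  rw [AffineMap.image_convexHull, ← Set.range_comp]
  congr 1
  ext x
  simp [tangentChart_apply, edgeVector]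

theorem affineSpan_edgeVector {s : Finset (E n)} (hs : IsSimplex s) (o : s) :
    affineSpan ℝ (Set.range fun i : s => edgeVector i o) = ⊤ := by
  have h : AffineIndependent ℝ fun i : s => edgeVector i o := by
    refine AffineIndependent.of_comp (tangentChart s o) ?_
    convert hs.2 using 1
    funext i
    simp [tangentChart_apply, edgeVector]
  rw [h.affineSpan_eq_top_iff_card_eq_finrank_add_one, finrank_Tan hs, Fintype.card_coe]
  have := hs.1.card_pos
  omega

/-- The chart is an isometry, so surface measure becomes the full-dimensional measure on the tangent
space. -/
theorem cellMeasure_apply (s : Finset (E n)) {A : Set (Cell s)} (o : s) (hs : IsSimplex s) :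
    cellMeasure s A = (Measure.euclideanHausdorffMeasure (finrank ℝ (Tan s)) : Measure (Tan s))
      (tangentChart s o ⁻¹' (Subtype.val '' A)) := by
  rw [cellMeasure, (MeasurableEmbedding.subtype_coe
    (isCompact_cell s).measurableSet).comap_apply, finrank_Tan hs,
    ← (isometry_tangentChart s o).euclideanHausdorffMeasure_image, Set.image_preimage_eq_of_subset]
  rintro _ ⟨x, _, rfl⟩
  obtain ⟨v, _, hv⟩ := (image_tangentChart o).ge x.2
  exact ⟨v, hv⟩

theorem preimage_tangentChart {s : Finset (E n)} (o : s) :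
    tangentChart s o ⁻¹' convexHull ℝ (s : Set (E n)) =
      convexHull ℝ (Set.range fun i : s => edgeVector i o) := by
  rw [← image_tangentChart o, Set.preimage_image_eq _ (isometry_tangentChart s o).injective]

theorem isFiniteMeasure_cellMeasure {s : Finset (E n)} (hs : IsSimplex s) :
    IsFiniteMeasure (cellMeasure s) := by
  obtain ⟨o, ho⟩ := hs.1
  refine ⟨?_⟩
  rw [cellMeasure_apply s ⟨o, ho⟩ hs, Set.image_univ, Subtype.range_coe, preimage_tangentChart]
  exact ((Set.finite_range _).isCompact_convexHull ℝ).measure_lt_top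

/-- In its tangent space the simplex is convex with nonempty interior, so every point of it, even on
the boundary, is a limit of interior points; a nonempty relatively open set contains an open ball.
-/
theorem isOpenPosMeasure_cellMeasure {s : Finset (E n)} (hs : IsSimplex s) :
    (cellMeasure s).IsOpenPosMeasure := by
  obtain ⟨o, ho⟩ := hs.1
  let o' : s := ⟨o, ho⟩
  refine ⟨fun U hU hne h0 => ?_⟩
  obtain ⟨O, hO, rfl⟩ := isOpen_induced_iff.1 hU
  rw [cellMeasure_apply s o' hs, Subtype.image_preimage_coe, Set.preimage_inter,
    preimage_tangentChart o'] at h0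
  set S := convexHull ℝ (Set.range fun i : s => edgeVector i o') with hS
  have hint : (interior S).Nonempty :=
    interior_convexHull_nonempty_iff_affineSpan_eq_top.2 (affineSpan_edgeVector hs o')
  have hcl := (Convex.closure_interior_eq_closure_of_nonempty_interior (convex_convexHull ℝ
    (Set.range fun i : s => edgeVector i o')) hint).ge
  have hO' : IsOpen (tangentChart s o' ⁻¹' O) :=
    hO.preimage (isometry_tangentChart s o').continuous
  obtain ⟨x, hx⟩ := hne
  obtain ⟨v, hv, hvx⟩ := (image_tangentChart o').ge x.2
  have hvO : v ∈ tangentChart s o' ⁻¹' O := by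
    rw [Set.mem_preimage, hvx]; exact hx
  obtain ⟨w, hwO, hwS⟩ := mem_closure_iff.1 (hcl (subset_closure hv)) _ hO' hvO
  have hpos := (hO'.inter isOpen_interior).measure_pos
    (Measure.euclideanHausdorffMeasure (finrank ℝ (Tan s)) : Measure (Tan s)) ⟨w, hwO, hwS⟩
  refine hpos.ne' (measure_mono_null ?_ h0)
  rintro z ⟨hz1, hz2⟩
  exact ⟨interior_subset hz2, hz1⟩

theorem frobInner_add_left {V : Type*} [NormedAddCommGroup V] [InnerProductSpace ℝ V]
    [FiniteDimensional ℝ V] (ω ω' η : AltForm k ℓ V) :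
    frobInner (ω + ω') η = frobInner ω η + frobInner ω' η := by
  simp only [frobInner, AlternatingMap.add_apply, add_mul, Finset.sum_add_distrib, mul_add]

theorem frobInner_smul_left {V : Type*} [NormedAddCommGroup V] [InnerProductSpace ℝ V]
    [FiniteDimensional ℝ V] (c : ℝ) (ω η : AltForm k ℓ V) :
    frobInner (c • ω) η = c * frobInner ω η := by
  simp only [frobInner, AlternatingMap.smul_apply, smul_eq_mul, Finset.mul_sum]
  refine Finset.sum_congr rfl fun I _ => Finset.sum_congr rfl fun J _ => by ring

theorem frobInner_comm {V : Type*} [NormedAddCommGroup V] [InnerProductSpace ℝ V]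
    [FiniteDimensional ℝ V] (ω η : AltForm k ℓ V) : frobInner ω η = frobInner η ω := by
  simp only [frobInner, mul_comm]

theorem frobInner_self_nonneg {V : Type*} [NormedAddCommGroup V] [InnerProductSpace ℝ V]
    [FiniteDimensional ℝ V] (ω : AltForm k ℓ V) : 0 ≤ frobInner ω ω :=
  mul_nonneg (by positivity) (Finset.sum_nonneg fun I _ => Finset.sum_nonneg fun J _ =>
    mul_self_nonneg _)

theorem altForm_ext_basis {V ι : Type*} [AddCommGroup V] [Module ℝ V] (b : Basis ι ℝ V)
    {ω η : AltForm k ℓ V} (h : ∀ (I : Fin k → ι) (J : Fin ℓ → ι), ω (fun i => b (I i)) (fun j => b (J j)) =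
      η (fun i => b (I i)) (fun j => b (J j))) : ω = η :=
  b.ext_alternating fun I _ => b.ext_alternating fun J _ => h I J

theorem eq_zero_of_frobInner_self {V : Type*} [NormedAddCommGroup V] [InnerProductSpace ℝ V]
    [FiniteDimensional ℝ V] {ω : AltForm k ℓ V} (h : frobInner ω ω = 0) : ω = 0 := by
  have h1 := (mul_eq_zero.1 h).resolve_left (by positivity)
  refine altForm_ext_basis (stdOrthonormalBasis ℝ V).toBasis fun I J => ?_
  rw [Finset.sum_eq_zero_iff_of_nonneg fun I _ => Finset.sum_nonneg fun J _ =>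
    mul_self_nonneg _] at h1
  have h2 := h1 I (Finset.mem_univ _)
  rw [Finset.sum_eq_zero_iff_of_nonneg fun J _ => mul_self_nonneg _] at h2
  simpa using h2 J (Finset.mem_univ _)

theorem continuous_of_mem_PmAlt {s : Finset (E n)} (hs : IsSimplex s) {ω : Field k ℓ s}
    (hω : ω ∈ PmAlt k ℓ s) (v : Fin k → Tan s) (u : Fin ℓ → Tan s) :
    Continuous fun x => ω x v u := by
  obtain ⟨o, ho⟩ := hs.1
  obtain ⟨a, b, hab⟩ := hω ⟨o, subset_affineSpan ℝ _ ho⟩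
  let f : Tan s →ₗ[ℝ] ℝ :=
    { toFun := fun y => b.curryLeft y v u
      map_add' := fun y z => by rw [map_add]; rfl
      map_smul' := fun c y => by rw [map_smul]; rfl }
  have he : Continuous fun x : Cell s => euler s ⟨o, subset_affineSpan ℝ _ ho⟩ x := by
    refine Continuous.subtype_mk ?_ _
    fun_prop
  have hf : Continuous f := f.continuous_of_finiteDimensional
  have : (fun x => ω x v u) = fun x => a v u + f (euler s ⟨o, subset_affineSpan ℝ _ ho⟩ x) := by
    funext x
    rw [hab]
    rfl
  rw [this]
  exact continuous_const.add (hf.comp he)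

theorem continuous_frobInner {s : Finset (E n)} (hs : IsSimplex s) {ω η : Field k ℓ s}
    (hω : ω ∈ PmAlt k ℓ s) (hη : η ∈ PmAlt k ℓ s) :
    Continuous fun x => frobInner (ω x) (η x) := by
  unfold frobInner
  refine continuous_const.mul (continuous_finsetSum _ fun I _ => continuous_finsetSum _
    fun J _ => (continuous_of_mem_PmAlt hs hω _ _).mul (continuous_of_mem_PmAlt hs hη _ _))

theorem integrable_frobInner {s : Finset (E n)} (hs : IsSimplex s) {ω η : Field k ℓ s}
    (hω : ω ∈ PmAlt k ℓ s) (hη : η ∈ PmAlt k ℓ s) :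
    Integrable (fun x => frobInner (ω x) (η x)) (cellMeasure s) := by
  have := isFiniteMeasure_cellMeasure hs
  exact (continuous_frobInner hs hω hη).integrable_of_hasCompactSupport
    (HasCompactSupport.of_compactSpace _)

theorem l2Inner_add_left {s : Finset (E n)} (hs : IsSimplex s) {ω ω' η : Field k ℓ s}
    (hω : ω ∈ PmAlt k ℓ s) (hω' : ω' ∈ PmAlt k ℓ s) (hη : η ∈ PmAlt k ℓ s) :
    l2Inner (ω + ω') η = l2Inner ω η + l2Inner ω' η := by
  unfold l2Inner
  rw [← integral_add (integrable_frobInner hs hω hη) (integrable_frobInner hs hω' hη)]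
  simp only [Pi.add_apply, frobInner_add_left]

theorem l2Inner_smul_left {s : Finset (E n)} (c : ℝ) (ω η : Field k ℓ s) :
    l2Inner (c • ω) η = c * l2Inner ω η := by
  unfold l2Inner
  rw [← integral_const_mul]
  simp only [Pi.smul_apply, frobInner_smul_left]

theorem l2Inner_comm {s : Finset (E n)} (ω η : Field k ℓ s) : l2Inner ω η = l2Inner η ω := by
  unfold l2Inner
  simp only [frobInner_comm]

theorem eq_zero_of_l2Inner_self {s : Finset (E n)} (hs : IsSimplex s) {ω : Field k ℓ s}
    (hω : ω ∈ PmAlt k ℓ s) (h : l2Inner ω ω = 0) : ω = 0 := by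
  have := isFiniteMeasure_cellMeasure hs
  have := isOpenPosMeasure_cellMeasure hs
  have h1 := (integral_eq_zero_iff_of_nonneg (fun x => frobInner_self_nonneg (ω x))
    (integrable_frobInner hs hω hω)).1 h
  have h2 := (continuous_frobInner hs hω hω).ae_eq_iff_eq _ continuous_zero |>.1 h1
  funext x
  exact eq_zero_of_frobInner_self (congrFun h2 x)

end L2

end FormValued
end
noncomputable section
namespace FormValued

/-! ### Unisolvency, conformity and the dimension formula. -/

section Unisolvency

variable {n p k ℓ : ℕ}

theorem IsSimplex.face {K : Finset (E n)} (hK : IsSimplex K) (σ : Face K) : IsSimplex σ.1 :=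
  hK.subset σ.2.2 σ.2.1

instance finite_altForm {ι : Type*} [Finite ι] : Module.Finite ℝ (AltForm k ℓ (ι → ℝ)) := by
  let f : AltForm k ℓ (ι → ℝ) →ₗ[ℝ] ((Fin k → ι) → (Fin ℓ → ι) → ℝ) :=
    { toFun := fun ω I J => ω (fun i => Pi.basisFun ℝ ι (I i)) fun j => Pi.basisFun ℝ ι (J j)
      map_add' := fun ω η => rfl
      map_smul' := fun c ω => rfl }
  exact Module.Finite.of_injective f fun ω η h =>
    altForm_ext_basis (Pi.basisFun ℝ ι) fun I J => congrFun (congrFun h I) J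

theorem PmAlt_eq_range {s : Finset (E n)} (hs : IsSimplex s) :
    PmAlt k ℓ s = LinearMap.range (whitney k ℓ s) := by
  apply le_antisymm
  · intro ω hω
    exact exists_whitney_eq hs hω
  · rintro _ ⟨ζ, rfl⟩
    exact whitney_mem_PmAlt ζ

theorem finite_of_injective_real {X Y : Type*} [AddCommMonoid X] [Module ℝ X] [AddCommMonoid Y]
    [Module ℝ Y] [Module.Finite ℝ Y] (f : X →ₗ[ℝ] Y) (hf : Function.Injective f) :
    Module.Finite ℝ X := by
  let _ : AddCommGroup Y := Module.addCommMonoidToAddCommGroup ℝ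
  exact Module.Finite.of_injective f hf

theorem finite_of_le_PmAlt {s : Finset (E n)} (hs : IsSimplex s)
    {P : Submodule ℝ (Field k ℓ s)} (hP : P ≤ PmAlt k ℓ s) : Module.Finite ℝ P := by
  have h1 : Module.Finite ℝ (PmAlt k ℓ s) := by
    rw [PmAlt_eq_range hs]
    infer_instance
  exact finite_of_injective_real (Submodule.inclusion hP) (Submodule.inclusion_injective hP)

theorem PmW_le_PmAlt {s : Finset (E n)} : PmW p k ℓ s ≤ PmAlt k ℓ s := fun _ h => h.1

theorem exists_dual_eq {X : Type*} [AddCommMonoid X] [Module ℝ X] [Module.Finite ℝ X]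
    (T : X →ₗ[ℝ] Module.Dual ℝ X) (hT : ∀ x, T x x = 0 → x = 0) (L : Module.Dual ℝ X) :
    ∃ x, T x = L := by
  let _ : AddCommGroup X := Module.addCommMonoidToAddCommGroup ℝ
  have hinj : Function.Injective T := by
    rw [← LinearMap.ker_eq_bot, LinearMap.ker_eq_bot']
    intro x hx
    exact hT x (by rw [hx]; rfl)
  exact (LinearMap.injective_iff_surjective_of_finrank_eq_finrank
    (Subspace.dual_finrank_eq (K := ℝ) (V := X)).symm).1 hinj L

/-- The `L²` pairing of two subspaces of `𝒫⁻Alt`. -/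
def l2Pairing {s : Finset (E n)} (hs : IsSimplex s) {P Q : Submodule ℝ (Field k ℓ s)}
    (hP : P ≤ PmAlt k ℓ s) (hQ : Q ≤ PmAlt k ℓ s) : P →ₗ[ℝ] Module.Dual ℝ Q :=
  LinearMap.mk₂ ℝ (fun ω b => l2Inner (ω : Field k ℓ s) b)
    (fun ω ω' b => l2Inner_add_left hs (hP ω.2) (hP ω'.2) (hQ b.2))
    (fun c ω b => l2Inner_smul_left c _ _)
    (fun ω b b' => by
      simp only [l2Inner_comm (ω : Field k ℓ s)]
      exact l2Inner_add_left hs (hQ b.2) (hQ b'.2) (hP ω.2))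
    (fun c ω b => by
      simp only [l2Inner_comm (ω : Field k ℓ s)]
      exact l2Inner_smul_left c _ _)

/-- The trace as a map from `𝒫⁻𝕎` of a simplex to `𝒫⁻𝕎` of a face. -/
def tracePmW (p k ℓ : ℕ) {s t : Finset (E n)} (h : t ⊆ s) : PmW p k ℓ s →ₗ[ℝ] PmW p k ℓ t :=
  (trace k ℓ h).restrict fun _ => trace_mem_PmW h

/-- All degrees of freedom at once. -/
def allDofs (p k ℓ : ℕ) {K : Finset (E n)} (hK : IsSimplex K) :
    PmW p k ℓ K →ₗ[ℝ] ((σ : Face K) → Module.Dual ℝ (BmW p k ℓ σ.1)) :=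
  LinearMap.pi fun σ =>
    l2Pairing (hK.face σ) PmW_le_PmAlt (BmW_le_PmW.trans PmW_le_PmAlt) ∘ₗ tracePmW p k ℓ σ.2.2

theorem allDofs_apply {K : Finset (E n)} (hK : IsSimplex K) (ω : PmW p k ℓ K) (σ : Face K)
    (b : BmW p k ℓ σ.1) : allDofs p k ℓ hK ω σ b = dof σ.2.2 (ω : Field k ℓ K) b := rfl

/-- By induction on the number of vertices: once all smaller traces vanish, the trace on `σ` is
itself an admissible test bubble, orthogonal to itself. No relation between `k`, `ℓ` and `p` is
needed. -/
theorem eq_zero_of_dof_eq_zero {K : Finset (E n)} (hK : IsSimplex K) {ω : Field k ℓ K}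
    (hω : ω ∈ PmW p k ℓ K)
    (h : ∀ (σ : Finset (E n)) (hσ : σ ⊆ K), σ.Nonempty → ∀ b ∈ BmW p k ℓ σ, dof hσ ω b = 0) :
    ω = 0 := by
  have key : ∀ (m : ℕ) (σ : Finset (E n)) (hσ : σ ⊆ K), σ.Nonempty → σ.card ≤ m →
      trace k ℓ hσ ω = 0 := by
    intro m
    induction m with
    | zero =>
      intro σ _ hne hc
      have := hne.card_pos
      omega
    | succ m ih =>
      intro σ hσ hne hc
      have hmem : trace k ℓ hσ ω ∈ BmW p k ℓ σ := by
        rw [mem_BmW_iff]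
        refine ⟨trace_mem_PmW hσ hω, fun τ hτ hτn => ?_⟩
        rw [trace_trace]
        exact ih τ _ hτn (by have := Finset.card_lt_card hτ; omega)
      exact eq_zero_of_l2Inner_self (hK.subset hσ hne) (PmW_le_PmAlt (BmW_le_PmW hmem))
        (h σ hσ hne _ hmem)
  exact key K.card K (Finset.Subset.refl K) hK.1 le_rfl

theorem allDofs_injective {K : Finset (E n)} (hK : IsSimplex K) :
    Function.Injective (allDofs p k ℓ hK) := by
  intro ω ω' h
  apply eq_of_add_neg_one_smul
  ext1
  refine eq_zero_of_dof_eq_zero hK (ω + (-1 : ℝ) • ω').2 fun σ hσ hne b hb => ?_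
  have h1 := congrFun (show allDofs p k ℓ hK (ω + (-1 : ℝ) • ω') = 0 by
    rw [map_add, map_smul, h, add_neg_one_smul_self]) ⟨σ, hne, hσ⟩
  exact LinearMap.congr_fun h1 ⟨b, hb⟩

theorem exists_representing_bubble {s : Finset (E n)} (hs : IsSimplex s)
    (L : Module.Dual ℝ (BmW p k ℓ s)) :
    ∃ c ∈ BmW p k ℓ s, ∀ b : BmW p k ℓ s, l2Inner c (b : Field k ℓ s) = L b := by
  have hle : BmW p k ℓ s ≤ PmAlt k ℓ s := BmW_le_PmW.trans PmW_le_PmAlt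
  have := finite_of_le_PmAlt hs hle
  obtain ⟨c, hc⟩ := exists_dual_eq (l2Pairing hs hle hle)
    (fun x hx => Subtype.ext (eq_zero_of_l2Inner_self hs (hle x.2) hx)) L
  exact ⟨c, c.2, fun b => LinearMap.congr_fun hc b⟩

theorem allDofs_surjective {K : Finset (E n)} (hK : IsSimplex K) (hkl : k + 1 ≤ ℓ + p) :
    Function.Surjective (allDofs p k ℓ hK) := by
  intro L
  have key : ∀ m : ℕ, ∃ ω : PmW p k ℓ K, ∀ σ : Face K, σ.1.card ≤ m →
      allDofs p k ℓ hK ω σ = L σ := by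
    intro m
    induction m with
    | zero =>
      refine ⟨0, fun σ hσ => ?_⟩
      have := σ.2.1.card_pos
      omega
    | succ m ih =>
      obtain ⟨ω, hω⟩ := ih
      -- On each face of the next level, the bubble representing the remaining error is extended
      -- within `𝒫⁻𝕎`; the values already matched on smaller faces are untouched.
      have hex : ∀ σ ∈ K.powersetCard (m + 1), ∃ e : Field k ℓ K, e ∈ PmW p k ℓ K ∧
          (∀ (hσ : σ.Nonempty ∧ σ ⊆ K) (b : BmW p k ℓ σ),
            dof hσ.2 e (b : Field k ℓ σ) =
              (L ⟨σ, hσ⟩ - allDofs p k ℓ hK ω ⟨σ, hσ⟩) b) ∧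
          ∀ (τ : Finset (E n)) (hτ : τ ⊆ K), τ.Nonempty → τ.card ≤ m + 1 → τ ≠ σ →
            trace k ℓ hτ e = 0 := by
        intro σ hσ
        obtain ⟨hσK, hcard⟩ := Finset.mem_powersetCard.1 hσ
        have hne : σ.Nonempty := Finset.card_pos.1 (by omega)
        obtain ⟨c, hc, hcL⟩ := exists_representing_bubble (hK.subset hσK hne)
          (L ⟨σ, hne, hσK⟩ - allDofs p k ℓ hK ω ⟨σ, hne, hσK⟩)
        obtain ⟨e, he, hec, he0⟩ := exists_extension_PmW hK hkl hσK hne hc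
        refine ⟨e, he, fun hσ b => ?_, fun τ hτ hτn hcd => he0 τ hτ hτn (by omega)⟩
        rw [← hcL, ← hec]
        rfl
      choose! e he heL he0 using hex
      refine ⟨ω + ⟨∑ σ ∈ K.powersetCard (m + 1), e σ, Submodule.sum_mem _ he⟩,
        fun σ hσ => ?_⟩
      have htr := trace_sum_powersetCard he0 σ.2.2 σ.2.1 hσ
      ext b
      rw [map_add, Pi.add_apply, LinearMap.add_apply, allDofs_apply hK ⟨∑ _ ∈ _, _, _⟩, dof, htr]
      split_ifs with h
      · have := heL σ.1 (Finset.mem_powersetCard.2 ⟨σ.2.2, h⟩) σ.2 b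
        rw [dof] at this
        rw [this, LinearMap.sub_apply]
        exact add_sub_cancel _ _
      · have h0 : l2Inner (0 : Field k ℓ σ.1) b = 0 := by
          have := l2Inner_smul_left 0 (0 : Field k ℓ σ.1) (b : Field k ℓ σ.1)
          rwa [zero_smul, zero_mul] at this
        rw [h0, add_zero, hω σ (by omega)]
  obtain ⟨ω, hω⟩ := key K.card
  exact ⟨ω, funext fun σ => hω σ (Finset.card_le_card σ.2.2)⟩

theorem existsUnique_of_dofs {K : Finset (E n)} (hK : IsSimplex K) (hkl : k + 1 ≤ ℓ + p)
    (L : (σ : Face K) → Module.Dual ℝ (BmW p k ℓ σ.1)) :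
    ∃! ω : PmW p k ℓ K, ∀ (σ : Face K) (b : BmW p k ℓ σ.1),
      dof σ.2.2 (ω : Field k ℓ K) (b : Field k ℓ σ.1) = L σ b := by
  obtain ⟨ω, hω⟩ := allDofs_surjective hK hkl L
  refine ⟨ω, fun σ b => by rw [← hω]; rfl, fun ω' hω' => allDofs_injective hK ?_⟩
  rw [hω]
  funext σ
  ext b
  exact hω' σ b

theorem TopCell.isSimplex {T : Geometry.SimplicialComplex ℝ (E n)} (K : TopCell T) :
    IsSimplex K.1 :=
  ⟨Finset.card_pos.1 (by rw [K.2.2]; omega), T.indep K.2.1⟩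

/-- The difference of two traces on `σ` lies in `𝒫⁻𝕎(σ)`, and its degrees of freedom on the faces of
`σ` vanish because those faces are common to both cells. -/
theorem feSpace_eq (T : Geometry.SimplicialComplex ℝ (E n)) :
    feSpace p k ℓ T =
      {ω | ∀ K, ω K ∈ PmW p k ℓ K.1} ∩ (IICconforming k ℓ T : Set (PiecewiseField k ℓ T)) := by
  ext ω
  refine and_congr_right fun hω => ⟨fun h K K' σ hσ hσ' hne => ?_, fun h => ?_⟩
  · have hs := K.isSimplex.subset hσ hne
    have h1 := trace_mem_PmW hσ (hω K)
    have h2 := trace_mem_PmW hσ' (hω K')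
    apply eq_of_add_neg_one_smul
    refine eq_zero_of_dof_eq_zero hs (sub_mem_of_module h1 h2) fun τ hτ hτn b hb => ?_
    have hb' := PmW_le_PmAlt (BmW_le_PmW hb)
    rw [dof, map_add, map_smul, l2Inner_add_left (hs.subset hτ hτn)
      (PmW_le_PmAlt (trace_mem_PmW hτ h1))
      (Submodule.smul_mem _ _ (PmW_le_PmAlt (trace_mem_PmW hτ h2))) hb', l2Inner_smul_left]
    have := h K K' τ (hτ.trans hσ) (hτ.trans hσ') hτn b hb
    rw [dof, dof] at this
    rw [trace_trace, trace_trace, this]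
    ring
  · intro K K' σ hσ hσ' hne b _
    rw [dof, dof, h K K' σ hσ hσ' hne]

theorem finrank_PmW {K : Finset (E n)} (hK : IsSimplex K) (hkl : k + 1 ≤ ℓ + p) :
    finrank ℝ (PmW p k ℓ K) =
      ∑ m ∈ Finset.Icc 1 K.card, ∑ σ ∈ K.powersetCard m, finrank ℝ (BmW p k ℓ σ) := by
  classical
  let F : Finset (Finset (E n)) := K.powerset.filter Finset.Nonempty
  have hF : ∀ σ, σ ∈ F ↔ σ.Nonempty ∧ σ ⊆ K := fun σ => by simp [F, and_comm]
  let _ : Fintype (Face K) := Fintype.subtype F hF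
  have hfin : ∀ σ : Face K, Module.Finite ℝ (BmW p k ℓ σ.1) := fun σ =>
    finite_of_le_PmAlt (hK.face σ) (BmW_le_PmW.trans PmW_le_PmAlt)
  have hdual : ∀ σ : Face K, finrank ℝ (Module.Dual ℝ (BmW p k ℓ σ.1)) =
      finrank ℝ (BmW p k ℓ σ.1) := fun σ => by
    let _ : AddCommGroup (BmW p k ℓ σ.1) := Module.addCommMonoidToAddCommGroup ℝ
    exact Subspace.dual_finrank_eq
  have hdfin : ∀ σ : Face K, Module.Finite ℝ (Module.Dual ℝ (BmW p k ℓ σ.1)) := fun σ => by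
    let _ : AddCommGroup (BmW p k ℓ σ.1) := Module.addCommMonoidToAddCommGroup ℝ
    infer_instance
  rw [(LinearEquiv.ofBijective (allDofs p k ℓ hK)
    ⟨allDofs_injective hK, allDofs_surjective hK hkl⟩).finrank_eq, Module.finrank_pi_fintype]
  simp only [hdual]
  rw [← Finset.sum_subtype F hF fun σ => finrank ℝ (BmW p k ℓ σ)]
  have hmaps : ∀ σ ∈ F, σ.card ∈ Finset.Icc 1 K.card := fun σ hσ => by
    rw [hF] at hσ
    exact Finset.mem_Icc.2 ⟨hσ.1.card_pos, Finset.card_le_card hσ.2⟩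
  rw [← Finset.sum_fiberwise_of_maps_to hmaps]
  refine Finset.sum_congr rfl fun m hm => Finset.sum_congr ?_ fun _ _ => rfl
  ext σ
  rw [Finset.mem_filter, hF, Finset.mem_powersetCard, ← Finset.card_pos]
  have := (Finset.mem_Icc.1 hm).1
  constructor
  · rintro ⟨⟨_, h⟩, h'⟩
    exact ⟨h, h'⟩
  · rintro ⟨h, h'⟩
    exact ⟨⟨by omega, h⟩, h'⟩

end Unisolvency

end FormValued
end
noncomputable section
namespace FormValued

/-! ### Constant shape functions and matrix coordinates when `ℓ + p = k + 1`. -/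

section ConstantShapeFunctions

variable {n p k ℓ : ℕ}

/-- For `ℓ + p = k + 1` the shape functions are constant. -/
theorem mem_PmW_iff_const {s : Finset (E n)} (hs : IsSimplex s) (hp : p ≤ k)
    (hkl : ℓ + p = k + 1) {ω : Field k ℓ s} :
    ω ∈ PmW p k ℓ s ↔ ∃ a, SdagIter (Tan s) k ℓ p a = 0 ∧ ω = fun _ => a := by
  constructor
  · intro hω
    obtain ⟨o, ho⟩ := hs.1
    let o' : s := ⟨o, ho⟩
    obtain ⟨a, b, hab⟩ := hω.1 ⟨o, subset_affineSpan ℝ _ ho⟩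
    have hS : ∀ x, SdagIter (Tan s) k ℓ p (ω x) = 0 := fun x => congrFun (mem_PmW.1 hω).2 x
    have he : ∀ i : s, euler s ⟨o, subset_affineSpan ℝ _ ho⟩ (Cell.vertex i) = edgeVector i o' :=
      fun i => rfl
    have ha : SdagIter (Tan s) k ℓ p a = 0 := by
      have h := hS (Cell.vertex o')
      have h0 : edgeVector o' o' = 0 := Subtype.ext (sub_self _)
      rwa [hab, he, h0, map_zero, add_zero] at h
    have hb1 : ∀ i : s, SdagIter (Tan s) k ℓ p (b.curryLeft (edgeVector i o')) = 0 := fun i => by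
      have h := hS (Cell.vertex i)
      rwa [hab, he, map_add, ha, zero_add] at h
    have hb2 : ∀ y : Tan s, SdagIter (Tan s) k ℓ p (b.curryLeft y) = 0 := fun y => by
      rw [← tangentOf_tangentWeights hs o' y, tangentOf_apply, map_sum, map_sum]
      refine Finset.sum_eq_zero fun i _ => ?_
      rw [map_smul, map_smul, hb1, smul_zero]
    -- Every contraction of `𝒮_{†,[p]} b` is, up to sign, `𝒮_{†,[p]}` of a contraction of `b`, hence
    -- zero. As `b` has bidegree `(k + 1, ℓ)` and weight `p`, Lefschetz injectivity gives `b = 0`.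
    have hb3 : (totalDown (Tan s) ^ p) (pureForm b) (k - p + 1) (ℓ + p) = 0 := by
      ext v u
      have h := hb2 (v 0)
      have h1 := SdagIter_eq_totalDown (totalCurry (v 0) (pureForm b)) k ℓ hp
      rw [totalDown_pow_totalCurry] at h1
      have h2 : totalCurry (v 0) (pureForm b) k ℓ = b.curryLeft (v 0) := by
        change (pureForm b (k + 1) ℓ).curryLeft _ = _
        rw [pureForm_self]
      rw [h2, h] at h1
      have h3 := DFunLike.congr_fun (DFunLike.congr_fun h1 (fun i => v i.succ)) u
      change 0 = (-1 : ℝ) ^ p • (totalDown (Tan s) ^ p) (pureForm b) (k - p + 1) (ℓ + p)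
        (Matrix.vecCons (v 0) fun i => v i.succ) u at h3
      have h4 : (Matrix.vecCons (v 0) fun i => v i.succ) = v := Fin.cons_self_tail v
      rw [h4, eq_comm, smul_eq_zero] at h3
      exact h3.resolve_left (pow_ne_zero _ (by norm_num))
    have hb : b = 0 := by
      refine eq_zero_of_totalDown_pow_pureForm (p := p) hkl.le b ?_
      funext k' ℓ'
      by_cases h : (k', ℓ') = (k - p + 1, ℓ + p)
      · obtain ⟨rfl, rfl⟩ := Prod.mk.inj h
        exact hb3
      · refine totalDown_pow_of_ne (fun a c hac => pureForm_of_ne b ?_) h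
        rwa [show k - p + 1 + p = k + 1 by omega] at hac
    refine ⟨a, ha, ?_⟩
    funext x
    rw [hab, hb]
    ext v u
    simp
  · rintro ⟨a, ha, rfl⟩
    refine mem_PmW.2 ⟨fun o => ⟨a, 0, fun x => ?_⟩, ?_⟩
    · ext v u
      simp
    · funext x
      exact ha

theorem alternating_eq_zero_of_finrank_lt {V N : Type*} [AddCommGroup V] [Module ℝ V]
    [FiniteDimensional ℝ V] [AddCommGroup N] [Module ℝ N] (h : finrank ℝ V < k)
    (f : V [⋀^Fin k]→ₗ[ℝ] N) : f = 0 := by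
  ext v
  refine f.map_linearDependent v fun hv => ?_
  have := hv.fintype_card_le_finrank
  rw [Fintype.card_fin] at this
  omega

theorem altForm_eq_zero_of_finrank_lt_snd {V : Type*} [AddCommGroup V] [Module ℝ V]
    [FiniteDimensional ℝ V] (h : finrank ℝ V < ℓ) (f : AltForm k ℓ V) : f = 0 := by
  ext v : 1
  exact alternating_eq_zero_of_finrank_lt h _

theorem field_eq_zero_of_card_le {s : Finset (E n)} (hs : IsSimplex s) (h : s.card ≤ k)
    (ω : Field k ℓ s) : ω = 0 := by
  funext x
  refine alternating_eq_zero_of_finrank_lt ?_ (ω x)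
  rw [finrank_Tan hs]
  have := hs.1.card_pos
  omega

theorem BmW_eq_bot_of_card_le {s : Finset (E n)} (hs : IsSimplex s) (h : s.card ≤ k) :
    BmW p k ℓ s = ⊥ :=
  (Submodule.eq_bot_iff _).2 fun ω _ => field_eq_zero_of_card_le hs h ω

/-- The proper faces have dimension less than `k`, so the trace conditions are empty. -/
theorem BmW_eq_PmW_of_card_eq {s : Finset (E n)} (hs : IsSimplex s) (h : s.card = k + 1) :
    BmW p k ℓ s = PmW p k ℓ s := by
  refine le_antisymm BmW_le_PmW fun ω hω => mem_BmW_iff.2 ⟨hω, fun t ht hne => ?_⟩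
  exact field_eq_zero_of_card_le (hs.subset ht.subset hne)
    (by have := Finset.card_lt_card ht; omega) _

/-- The kernel condition is empty too: `𝒮_{†,[p]}` takes values in forms of second degree `k + 1` on
a `k`-dimensional space. -/
theorem finrank_BmW_of_card_eq {s : Finset (E n)} (hs : IsSimplex s) (hp : p ≤ k)
    (hkl : ℓ + p = k + 1) (h : s.card = k + 1) :
    finrank ℝ (BmW p k ℓ s) = finrank ℝ (AltForm k ℓ (Tan s)) := by
  rw [BmW_eq_PmW_of_card_eq hs h]
  have hmem : ∀ a : AltForm k ℓ (Tan s), (fun _ => a : Field k ℓ s) ∈ PmW p k ℓ s := fun a =>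
    (mem_PmW_iff_const hs hp hkl).2 ⟨a, altForm_eq_zero_of_finrank_lt_snd
      (by rw [finrank_Tan hs]; omega) _, rfl⟩
  let f : AltForm k ℓ (Tan s) →ₗ[ℝ] PmW p k ℓ s :=
    { toFun := fun a => ⟨fun _ => a, hmem a⟩
      map_add' := fun _ _ => rfl
      map_smul' := fun _ _ => rfl }
  refine (LinearEquiv.ofBijective f ⟨fun a b hab => ?_, fun ω => ?_⟩).finrank_eq.symm
  · obtain ⟨o, ho⟩ := hs.1
    exact congrFun (congrArg Subtype.val hab) (Cell.vertex ⟨o, ho⟩)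
  · obtain ⟨a, -, ha⟩ := (mem_PmW_iff_const hs hp hkl).1 ω.2
    exact ⟨a, Subtype.ext ha.symm⟩

theorem dof_eq_zero_iff_trace_eq_zero {K σ : Finset (E n)} (hK : IsSimplex K) (h : σ ⊆ K)
    (hne : σ.Nonempty) (hcard : σ.card = k + 1) {ω : Field k ℓ K} (hω : ω ∈ PmW p k ℓ K) :
    (∀ β ∈ BmW p k ℓ σ, dof h ω β = 0) ↔ trace k ℓ h ω = 0 := by
  have hσ := hK.subset h hne
  constructor
  · intro h0
    have hmem := trace_mem_PmW h hω
    exact eq_zero_of_l2Inner_self hσ (PmW_le_PmAlt hmem)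
      (h0 _ (by rwa [BmW_eq_PmW_of_card_eq hσ hcard]))
  · intro h0 β _
    rw [dof, h0]
    have := l2Inner_smul_left 0 (0 : Field k ℓ σ) β
    rwa [zero_smul, zero_mul] at this

theorem Tan_eq_top {K : Finset (E n)} (hK : IsSimplex K) (h : K.card = n + 1) : Tan K = ⊤ := by
  apply Submodule.eq_top_of_finrank_eq
  rw [finrank_Tan hK, h]
  simp

/-- A linear parametrization of the alternating `k`-forms on `V` by `m` coordinates. -/
structure Coframe (V : Type) [AddCommGroup V] [Module ℝ V] (k m : ℕ) where
  /-- The vector of coordinate forms. -/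
  form : V [⋀^Fin k]→ₗ[ℝ] (Fin m → ℝ)
  /-- Dual `k`-vectors. -/
  vec : Fin m → Fin k → V
  form_vec : ∀ i, form (vec i) = Pi.single i 1
  eq_zero : ∀ (N : Type) [AddCommGroup N] [Module ℝ N] (f : V [⋀^Fin k]→ₗ[ℝ] N),
    (∀ i, f (vec i) = 0) → f = 0

variable {V : Type} [AddCommGroup V] [Module ℝ V] {m m' : ℕ}

/-- The form-valued form `(v, u) ↦ α(v)ᵀ A β(u)`. -/
def proxyForm (α : Coframe V k m) (β : Coframe V ℓ m') :
    Matrix (Fin m) (Fin m') ℝ →ₗ[ℝ] AltForm k ℓ V where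
  toFun A :=
    ({ toFun := fun x => (Matrix.toBilin' (1 : Matrix (Fin m') (Fin m') ℝ)
          (x ᵥ* A)).compAlternatingMap β.form
       map_add' := fun x y => by ext u; simp [Matrix.add_vecMul]
       map_smul' := fun c x => by ext u; simp [Matrix.smul_vecMul] } :
      (Fin m → ℝ) →ₗ[ℝ] (V [⋀^Fin ℓ]→ₗ[ℝ] ℝ)).compAlternatingMap α.form
  map_add' A B := by ext v u; simp [Matrix.vecMul_add]
  map_smul' c A := by ext v u; simp [Matrix.vecMul_smul]

theorem proxyForm_apply (α : Coframe V k m) (β : Coframe V ℓ m') (A : Matrix (Fin m) (Fin m') ℝ)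
    (v : Fin k → V) (u : Fin ℓ → V) :
    proxyForm α β A v u = α.form v ⬝ᵥ A *ᵥ β.form u := by
  rw [Matrix.dotProduct_mulVec]
  change Matrix.toBilin' 1 (α.form v ᵥ* A) (β.form u) = _
  rw [Matrix.toBilin'_apply', Matrix.one_mulVec]

theorem proxyForm_vec (α : Coframe V k m) (β : Coframe V ℓ m') (A : Matrix (Fin m) (Fin m') ℝ)
    (i : Fin m) (j : Fin m') : proxyForm α β A (α.vec i) (β.vec j) = A i j := by
  rw [proxyForm_apply, α.form_vec, β.form_vec]
  simp

/-- Form-valued forms correspond to matrices. -/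
def proxyEquiv (α : Coframe V k m) (β : Coframe V ℓ m') :
    Matrix (Fin m) (Fin m') ℝ ≃ₗ[ℝ] AltForm k ℓ V :=
  LinearEquiv.ofBijective (proxyForm α β) ⟨fun A B h => by
    ext i j
    rw [← proxyForm_vec α β A, h, proxyForm_vec], fun ω => by
    refine ⟨Matrix.of fun i j => ω (α.vec i) (β.vec j), ?_⟩
    apply eq_of_add_neg_one_smul
    refine α.eq_zero _ _ fun i => β.eq_zero _ _ fun j => ?_
    have h := proxyForm_vec α β (Matrix.of fun i j => ω (α.vec i) (β.vec j)) i j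
    rw [AlternatingMap.add_apply, AlternatingMap.add_apply, AlternatingMap.smul_apply,
      AlternatingMap.smul_apply, h]
    simp⟩

theorem finrank_altForm (α : Coframe V k m) (β : Coframe V ℓ m') :
    finrank ℝ (AltForm k ℓ V) = m * m' := by
  rw [← (proxyEquiv α β).finrank_eq, Module.finrank_matrix]
  simp

/-- Coordinates of vectors. -/
def Coframe.ofBasis (b : Basis (Fin m) ℝ V) : Coframe V 1 m where
  form := AlternatingMap.ofSubsingleton ℝ V (Fin m → ℝ) (0 : Fin 1) b.equivFun.toLinearMap
  vec i := fun _ => b i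
  form_vec i := by
    simp [AlternatingMap.ofSubsingleton]
    ext j
    simp [Finsupp.single_apply, Pi.single_apply, eq_comm]
  eq_zero N _ _ f h := by
    refine b.ext_alternating fun I _ => ?_
    have : (fun i => b (I i)) = fun _ => b (I 0) := by
      funext i
      rw [Subsingleton.elim i 0]
    rw [this, h]
    rfl

/-- The area form of a plane. -/
def Coframe.area (b : Basis (Fin 2) ℝ V) : Coframe V 2 1 where
  form := (LinearMap.pi fun _ => LinearMap.id : ℝ →ₗ[ℝ] (Fin 1 → ℝ)).compAlternatingMap b.det
  vec _ := b
  form_vec i := by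
    ext j
    simp [b.det_self, Subsingleton.elim j i]
  eq_zero N _ _ f h := by
    refine b.ext_alternating fun I hI => ?_
    obtain ⟨e, he⟩ : ∃ e : Equiv.Perm (Fin 2), ⇑e = I :=
      ⟨Equiv.ofBijective I ((Fintype.bijective_iff_injective_and_card I).2 ⟨hI, rfl⟩), rfl⟩
    have := f.map_perm b e
    rw [h 0, smul_zero] at this
    rw [← he]
    exact this

theorem cross_smul_smul (x y : Fin 3 → ℝ) (a b c d : ℝ) :
    crossProduct (a • x + b • y) (c • x + d • y) = (a * d - b * c) • crossProduct x y := by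
  simp only [cross_apply]
  ext i
  fin_cases i <;> simp <;> ring

/-- The cross product as an alternating map. -/
def crossForm : E 3 [⋀^Fin 2]→ₗ[ℝ] (Fin 3 → ℝ) where
  toFun v := crossProduct (v 0).ofLp (v 1).ofLp
  map_update_add' v i x y := by
    fin_cases i <;> simp
  map_update_smul' v i c x := by
    fin_cases i <;> simp
  map_eq_zero_of_eq' v i j h hij := by
    have : v 0 = v 1 := by
      fin_cases i <;> fin_cases j <;> simp_all
    rw [this, cross_self]

/-- Standard basis vectors of `ℝⁿ`. -/
abbrev stdVec (i : Fin n) : E n := EuclideanSpace.single i 1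

/-- Coordinates of `2`-vectors in space by the cross product. -/
def Coframe.cross : Coframe (E 3) 2 3 where
  form := crossForm
  -- Indices are cyclic modulo 3, so the cross product of these two vectors is the `i`-th standard
  -- vector.
  vec i := ![stdVec (i + 1), stdVec (i + 2)]
  form_vec i := by
    ext j
    fin_cases i <;> fin_cases j <;> simp [crossForm, cross_apply, stdVec]
  eq_zero N _ _ f h := by
    refine (EuclideanSpace.basisFun (Fin 3) ℝ).toBasis.ext_alternating fun I hI => ?_
    have hsw : ∀ a b : E 3, f ![a, b] = 0 → f ![b, a] = 0 := fun a b hab => by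
      have := f.map_swap ![a, b] (i := 0) (j := 1) (by simp)
      rw [hab, neg_zero] at this
      rw [← this]
      congr 1
      funext i
      fin_cases i <;> simp
    have hI' : (fun i => (EuclideanSpace.basisFun (Fin 3) ℝ).toBasis (I i)) =
        ![stdVec (I 0), stdVec (I 1)] := by
      funext i
      fin_cases i <;> simp [stdVec]
    have hne : I 0 ≠ I 1 := fun h => by simpa using hI h
    rw [hI', AlternatingMap.zero_apply]
    have h0 := h 0
    have h1 := h 1
    have h2 := h 2
    generalize I 0 = a at hne ⊢
    generalize I 1 = b at hne ⊢
    fin_cases a <;> fin_cases b <;> first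
      | exact absurd rfl hne
      | exact h0
      | exact h1
      | exact h2
      | exact hsw _ _ h0
      | exact hsw _ _ h1
      | exact hsw _ _ h2

end ConstantShapeFunctions

end FormValued
end
noncomputable section
namespace FormValued

/-! ### Matrix proxies and the kernel of `𝒮_{†,[p]}` in each case. -/

section Proxies

variable {n p k ℓ m m' : ℕ}

/-- The constant field with a given matrix proxy. -/
def proxyField (α : Coframe (E n) k m) (β : Coframe (E n) ℓ m') (s : Finset (E n)) :
    Matrix (Fin m) (Fin m') ℝ →ₗ[ℝ] Field k ℓ s where
  toFun A := fun _ => pullback k ℓ (Tan s).subtype (proxyForm α β A)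
  map_add' A B := by funext x; simp
  map_smul' c A := by funext x; simp

theorem proxyField_apply (α : Coframe (E n) k m) (β : Coframe (E n) ℓ m') {s : Finset (E n)}
    (A : Matrix (Fin m) (Fin m') ℝ) (x : Cell s) (v : Fin k → Tan s) (u : Fin ℓ → Tan s) :
    proxyField α β s A x v u =
      α.form (fun i => (v i : E n)) ⬝ᵥ A *ᵥ β.form (fun j => (u j : E n)) :=
  proxyForm_apply α β A _ _

theorem trace_proxyField (α : Coframe (E n) k m) (β : Coframe (E n) ℓ m') {s t : Finset (E n)}
    (h : t ⊆ s) (A : Matrix (Fin m) (Fin m') ℝ) :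
    trace k ℓ h (proxyField α β s A) = proxyField α β t A := rfl

section TopDimensional

variable (α : Coframe (E n) k m) (β : Coframe (E n) ℓ m') {K : Finset (E n)}

theorem pullback_subtype_injective (h : Tan K = ⊤) :
    Function.Injective (pullback k ℓ (Tan K).subtype) := by
  intro a b hab
  ext v u
  have := DFunLike.congr_fun (DFunLike.congr_fun hab fun i => ⟨v i, h ▸ Submodule.mem_top⟩)
    fun j => ⟨u j, h ▸ Submodule.mem_top⟩
  exact this

theorem pullback_subtype_surjective (h : Tan K = ⊤) :
    Function.Surjective (pullback k ℓ (Tan K).subtype) := fun a =>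
  ⟨pullback k ℓ (LinearMap.codRestrict (Tan K) LinearMap.id fun _ => h ▸ Submodule.mem_top) a, rfl⟩

theorem proxyField_injective (hK : IsSimplex K) (hc : K.card = n + 1) :
    Function.Injective (proxyField α β K) := by
  intro A B h
  obtain ⟨o, ho⟩ := hK.1
  exact (proxyEquiv α β).injective
    (pullback_subtype_injective (Tan_eq_top hK hc) (congrFun h (Cell.vertex ⟨o, ho⟩)))

theorem mem_PmW_iff_proxy (hK : IsSimplex K) (hc : K.card = n + 1) (hp : p ≤ k)
    (hkl : ℓ + p = k + 1) {ω : Field k ℓ K} :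
    ω ∈ PmW p k ℓ K ↔
      ∃ A, SdagIter (E n) k ℓ p (proxyForm α β A) = 0 ∧ ω = proxyField α β K A := by
  have ht := Tan_eq_top hK hc
  rw [mem_PmW_iff_const hK hp hkl]
  constructor
  · rintro ⟨a, ha, rfl⟩
    obtain ⟨b, rfl⟩ := pullback_subtype_surjective ht a
    obtain ⟨A, rfl⟩ := (proxyEquiv α β).surjective b
    refine ⟨A, pullback_subtype_injective ht ?_, rfl⟩
    rw [pullback_SdagIter, map_zero]
    exact ha
  · rintro ⟨A, hA, rfl⟩
    exact ⟨pullback k ℓ (Tan K).subtype (proxyForm α β A),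
      by rw [← pullback_SdagIter, hA, map_zero], rfl⟩

theorem exists_proxy_equiv (hK : IsSimplex K) (hc : K.card = n + 1) (hp : p ≤ k)
    (hkl : ℓ + p = k + 1) (S : Submodule ℝ (Matrix (Fin m) (Fin m') ℝ))
    (hS : ∀ A, SdagIter (E n) k ℓ p (proxyForm α β A) = 0 ↔ A ∈ S) :
    ∃ Φ : S ≃ₗ[ℝ] PmW p k ℓ K, ∀ A : S,
      (Φ A : Field k ℓ K) = proxyField α β K (A : Matrix (Fin m) (Fin m') ℝ) := by
  let f : S →ₗ[ℝ] PmW p k ℓ K := LinearMap.codRestrict _ (proxyField α β K ∘ₗ S.subtype)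
    fun A => (mem_PmW_iff_proxy α β hK hc hp hkl).2 ⟨A, (hS A).2 A.2, rfl⟩
  refine ⟨LinearEquiv.ofBijective f ⟨fun A B h => ?_, fun ω => ?_⟩, fun A => rfl⟩
  · exact Subtype.ext (proxyField_injective α β hK hc (congrArg Subtype.val h))
  · obtain ⟨A, hA, hω⟩ := (mem_PmW_iff_proxy α β hK hc hp hkl).1 ω.2
    exact ⟨⟨A, (hS A).1 hA⟩, Subtype.ext hω.symm⟩

/-- The finite element space in terms of matrix proxies. -/
theorem feSpace_eq_proxy (hp : p ≤ k) (hkl : ℓ + p = k + 1)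
    (S : Submodule ℝ (Matrix (Fin m) (Fin m') ℝ))
    (hS : ∀ A, SdagIter (E n) k ℓ p (proxyForm α β A) = 0 ↔ A ∈ S)
    (C : Finset (E n) → Matrix (Fin m) (Fin m') ℝ → Matrix (Fin m) (Fin m') ℝ → Prop)
    (hC : ∀ σ, IsSimplex σ → σ.card = k + 1 → ∀ A B,
      proxyField α β σ A = proxyField α β σ B ↔ C σ A B)
    (hB : ∀ σ : Finset (E n), IsSimplex σ → k + 1 < σ.card → σ.card < n + 1 →
      BmW p k ℓ σ = ⊥)
    (T : Geometry.SimplicialComplex ℝ (E n)) :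
    feSpace p k ℓ T = {ω | ∃ A : TopCell T → S,
      (∀ K, ω K = proxyField α β K.1 (A K : Matrix (Fin m) (Fin m') ℝ)) ∧
      ∀ (K K' : TopCell T) (σ : Finset (E n)), σ ⊆ K.1 → σ ⊆ K'.1 → σ.card = k + 1 →
        C σ (A K) (A K')} := by
  ext ω
  constructor
  · intro hω
    have hω' := hω
    rw [feSpace_eq] at hω'
    have hex : ∀ K, ∃ A : S, ω K = proxyField α β K.1 (A : Matrix (Fin m) (Fin m') ℝ) := by
      intro K
      obtain ⟨A, hA, h⟩ := (mem_PmW_iff_proxy α β K.isSimplex K.2.2 hp hkl).1 (hω.1 K)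
      exact ⟨⟨A, (hS A).1 hA⟩, h⟩
    choose A hA using hex
    refine ⟨A, hA, fun K K' σ hσ hσ' hc => ?_⟩
    have hne : σ.Nonempty := Finset.card_pos.1 (by omega)
    have h := hω'.2 K K' σ hσ hσ' hne
    rw [hA, hA, trace_proxyField, trace_proxyField] at h
    exact (hC σ (K.isSimplex.subset hσ hne) hc _ _).1 h
  · rintro ⟨A, hA, h⟩
    refine ⟨fun K => (mem_PmW_iff_proxy α β K.isSimplex K.2.2 hp hkl).2
      ⟨A K, (hS _).2 (A K).2, hA K⟩, fun K K' σ hσ hσ' hne b hb => ?_⟩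
    have hs := K.isSimplex.subset hσ hne
    -- Smaller faces carry no forms, faces with `k + 1` vertices are governed by `C`, intermediate
    -- ones have no bubbles by `hB`, and a common face with `n + 1` vertices forces `K = K'`.
    rcases lt_trichotomy σ.card (k + 1) with hc | hc | hc
    · rw [dof, dof, field_eq_zero_of_card_le hs (by omega) (trace k ℓ hσ (ω K)),
        field_eq_zero_of_card_le hs (by omega) (trace k ℓ hσ' (ω K'))]
    · rw [dof, dof, hA, hA, trace_proxyField, trace_proxyField,
        (hC σ hs hc _ _).2 (h K K' σ hσ hσ' hc)]
    · rcases lt_or_ge σ.card (n + 1) with hc' | hc'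
      · rw [hB σ hs hc hc', Submodule.mem_bot] at hb
        rw [hb, dof, dof, l2Inner_comm, l2Inner_comm _ 0]
        have h0 : ∀ η : Field k ℓ σ, l2Inner 0 η = 0 := fun η => by
          have := l2Inner_smul_left 0 (0 : Field k ℓ σ) η
          rwa [zero_smul, zero_mul] at this
        rw [h0, h0]
      · have h1 : σ = K.1 := Finset.eq_of_subset_of_card_le hσ (by rw [K.2.2]; exact hc')
        have h2 : σ = K'.1 := Finset.eq_of_subset_of_card_le hσ' (by rw [K'.2.2]; exact hc')
        obtain rfl : K = K' := Subtype.ext (h1.symm.trans h2)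
        rfl

theorem dof_eq_zero_iff_proxy (hK : IsSimplex K) {σ : Finset (E n)} (h : σ ⊆ K)
    (hne : σ.Nonempty) (hcard : σ.card = k + 1) {A : Matrix (Fin m) (Fin m') ℝ}
    {ω : Field k ℓ K} (hω : ω ∈ PmW p k ℓ K) (hA : ω = proxyField α β K A) :
    (∀ b ∈ BmW p k ℓ σ, dof h ω b = 0) ↔ proxyField α β σ A = proxyField α β σ 0 := by
  rw [dof_eq_zero_iff_trace_eq_zero hK h hne hcard hω, hA, trace_proxyField, map_zero]

end TopDimensional

/-- Coordinates of vectors in `ℝⁿ`. -/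
def Coframe.std (n : ℕ) : Coframe (E n) 1 n :=
  Coframe.ofBasis (EuclideanSpace.basisFun (Fin n) ℝ).toBasis

theorem Coframe.std_form (v : Fin 1 → E n) : (Coframe.std n).form v = (v 0).ofLp := by
  ext i
  simp [Coframe.std, Coframe.ofBasis, AlternatingMap.ofSubsingleton]

theorem Coframe.cross_form (v : Fin 2 → E 3) :
    Coframe.cross.form v = crossProduct (v 0).ofLp (v 1).ofLp := rfl

theorem hasProxy11_iff {s : Finset (E n)} {ω : Field 1 1 s} {A : Matrix (Fin n) (Fin n) ℝ} :
    HasProxy11 ω A ↔ ω = proxyField (Coframe.std n) (Coframe.std n) s A := by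
  constructor
  · intro h
    funext x
    ext v u
    rw [h, proxyField_apply, Coframe.std_form, Coframe.std_form]
  · rintro rfl x v u
    rw [proxyField_apply, Coframe.std_form, Coframe.std_form]

theorem hasProxy22_iff {s : Finset (E 3)} {ω : Field 2 2 s} {A : Matrix (Fin 3) (Fin 3) ℝ} :
    HasProxy22 ω A ↔ ω = proxyField Coframe.cross Coframe.cross s A := by
  constructor
  · intro h
    funext x
    ext v u
    rw [h, proxyField_apply, Coframe.cross_form, Coframe.cross_form]
  · rintro rfl x v u
    rw [proxyField_apply, Coframe.cross_form, Coframe.cross_form]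

theorem hasProxy21_iff {s : Finset (E 3)} {ω : Field 2 1 s} {A : Matrix (Fin 3) (Fin 3) ℝ} :
    HasProxy21 ω A ↔ ω = proxyField Coframe.cross (Coframe.std 3) s A := by
  constructor
  · intro h
    funext x
    ext v u
    rw [h, proxyField_apply, Coframe.cross_form, Coframe.std_form]
  · rintro rfl x v u
    rw [proxyField_apply, Coframe.cross_form, Coframe.std_form]

theorem SdagSucc_zero_one_apply {V : Type*} [AddCommGroup V] [Module ℝ V] (ω : AltForm 1 1 V)
    (v : Fin 0 → V) (u : Fin 2 → V) :
    SdagSucc 0 1 V ω v u = ω ![u 0] ![u 1] - ω ![u 1] ![u 0] := by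
  rw [SdagSucc_apply, Fin.sum_univ_two]
  have h0 : (0 : Fin 2).removeNth u = ![u 1] := by ext i; fin_cases i; rfl
  have h1 : (1 : Fin 2).removeNth u = ![u 0] := by ext i; fin_cases i; rfl
  have hv : ∀ a, Matrix.vecCons a v = ![a] := fun a => by ext i; fin_cases i; rfl
  rw [h0, h1, hv, hv]
  simp [sub_eq_add_neg]

theorem SdagSucc_one_one_apply {V : Type*} [AddCommGroup V] [Module ℝ V] (ω : AltForm 2 1 V)
    (v : Fin 1 → V) (u : Fin 2 → V) :
    SdagSucc 1 1 V ω v u = ω ![u 0, v 0] ![u 1] - ω ![u 1, v 0] ![u 0] := by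
  rw [SdagSucc_apply, Fin.sum_univ_two]
  have h0 : (0 : Fin 2).removeNth u = ![u 1] := by ext i; fin_cases i; rfl
  have h1 : (1 : Fin 2).removeNth u = ![u 0] := by ext i; fin_cases i; rfl
  have hv : ∀ a, Matrix.vecCons a v = ![a, v 0] := fun a => by ext i; fin_cases i <;> rfl
  rw [h0, h1, hv, hv]
  simp [sub_eq_add_neg]

theorem SdagSucc_zero_two_apply {V : Type*} [AddCommGroup V] [Module ℝ V] (ω : AltForm 1 2 V)
    (v : Fin 0 → V) (u : Fin 3 → V) :
    SdagSucc 0 2 V ω v u =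
      ω ![u 0] ![u 1, u 2] - ω ![u 1] ![u 0, u 2] + ω ![u 2] ![u 0, u 1] := by
  rw [SdagSucc_apply, Fin.sum_univ_three]
  have h0 : (0 : Fin 3).removeNth u = ![u 1, u 2] := by ext i; fin_cases i <;> rfl
  have h1 : (1 : Fin 3).removeNth u = ![u 0, u 2] := by ext i; fin_cases i <;> rfl
  have h2 : (2 : Fin 3).removeNth u = ![u 0, u 1] := by ext i; fin_cases i <;> rfl
  have hv : ∀ a, Matrix.vecCons a v = ![a] := fun a => by ext i; fin_cases i; rfl
  rw [h0, h1, h2, hv, hv, hv]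
  simp [sub_eq_add_neg]

theorem SdagSucc_one_two_apply {V : Type*} [AddCommGroup V] [Module ℝ V] (ω : AltForm 2 2 V)
    (v : Fin 1 → V) (u : Fin 3 → V) :
    SdagSucc 1 2 V ω v u =
      ω ![u 0, v 0] ![u 1, u 2] - ω ![u 1, v 0] ![u 0, u 2] + ω ![u 2, v 0] ![u 0, u 1] := by
  rw [SdagSucc_apply, Fin.sum_univ_three]
  have h0 : (0 : Fin 3).removeNth u = ![u 1, u 2] := by ext i; fin_cases i <;> rfl
  have h1 : (1 : Fin 3).removeNth u = ![u 0, u 2] := by ext i; fin_cases i <;> rfl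
  have h2 : (2 : Fin 3).removeNth u = ![u 0, u 1] := by ext i; fin_cases i <;> rfl
  have hv : ∀ a, Matrix.vecCons a v = ![a, v 0] := fun a => by ext i; fin_cases i <;> rfl
  rw [h0, h1, h2, hv, hv, hv]
  simp [sub_eq_add_neg]

theorem Sdag_proxy11_eq_zero_iff (A : Matrix (Fin n) (Fin n) ℝ) :
    SdagIter (E n) 1 1 1 (proxyForm (Coframe.std n) (Coframe.std n) A) = 0 ↔ A ∈ symMat n := by
  change SdagSucc 0 1 (E n) _ = 0 ↔ A.IsSymm
  constructor
  · intro h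
    ext i j
    have := DFunLike.congr_fun (DFunLike.congr_fun h ![]) ![stdVec j, stdVec i]
    rw [SdagSucc_zero_one_apply, proxyForm_apply, proxyForm_apply] at this
    simpa [Coframe.std_form, sub_eq_zero] using this
  · intro h
    ext v u
    rw [SdagSucc_zero_one_apply, proxyForm_apply, proxyForm_apply, Matrix.dotProduct_mulVec,
      ← Matrix.mulVec_transpose, h, dotProduct_comm]
    exact sub_self _

theorem Sdag_proxy22_eq_zero_iff (A : Matrix (Fin 3) (Fin 3) ℝ) :
    SdagIter (E 3) 2 2 1 (proxyForm Coframe.cross Coframe.cross A) = 0 ↔ A ∈ symMat 3 := by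
  change SdagSucc 1 2 (E 3) _ = 0 ↔ A.IsSymm
  constructor
  · intro h
    -- Evaluated on the standard frame, the three equations say that the off-diagonal antisymmetric
    -- part of `A` vanishes.
    have key : ∀ i : Fin 3, _ := fun i => DFunLike.congr_fun
      (DFunLike.congr_fun h ![stdVec i]) ![stdVec 0, stdVec 1, stdVec 2]
    have h0 := key 0
    have h1 := key 1
    have h2 := key 2
    rw [SdagSucc_one_two_apply, proxyForm_apply, proxyForm_apply, proxyForm_apply] at h0 h1 h2
    simp [Coframe.cross_form, cross_apply, dotProduct, mulVec, Fin.sum_univ_three] at h0 h1 h2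
    ext i j
    fin_cases i <;> fin_cases j <;> simp <;> linarith
  · intro h
    ext v u
    have h01 : A 1 0 = A 0 1 := h.apply 0 1
    have h02 : A 2 0 = A 0 2 := h.apply 0 2
    have h12 : A 2 1 = A 1 2 := h.apply 1 2
    rw [SdagSucc_one_two_apply, proxyForm_apply, proxyForm_apply, proxyForm_apply]
    simp [Coframe.cross_form, cross_apply, dotProduct, mulVec, Fin.sum_univ_three, h01, h02, h12]
    ring

theorem Sdag_proxy21_eq_zero_iff (A : Matrix (Fin 3) (Fin 3) ℝ) :
    SdagIter (E 3) 2 1 2 (proxyForm Coframe.cross (Coframe.std 3) A) = 0 ↔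
      A ∈ traceFreeMat 3 := by
  change SdagSucc 0 2 (E 3) (SdagSucc 1 1 (E 3) _) = 0 ↔ A.trace = 0
  -- The image is a scalar-valued 3-form on space, hence a multiple of the determinant; the multiple
  -- is `-2 tr A`.
  have key : ∀ (v : Fin 0 → E 3) (u : Fin 3 → E 3),
      SdagSucc 0 2 (E 3) (SdagSucc 1 1 (E 3) (proxyForm Coframe.cross (Coframe.std 3) A)) v u =
        -2 * A.trace * (crossProduct (u 0).ofLp (u 1).ofLp ⬝ᵥ (u 2).ofLp) := by
    intro v u
    rw [SdagSucc_zero_two_apply, SdagSucc_one_one_apply, SdagSucc_one_one_apply,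
      SdagSucc_one_one_apply]
    simp only [proxyForm_apply]
    simp [Coframe.cross_form, Coframe.std_form, cross_apply, dotProduct, mulVec,
      Fin.sum_univ_three, Matrix.trace]
    ring
  constructor
  · intro h
    have h1 := key ![] ![stdVec 0, stdVec 1, stdVec 2]
    rw [h] at h1
    simpa [cross_apply, dotProduct, Fin.sum_univ_three] using h1
  · intro h
    ext v u
    rw [key, h]
    simp

end Proxies

end FormValued
end
noncomputable section
namespace FormValued

/-! ### The Regge, Hellan–Herrmann–Johnson and MCS elements. -/

section ClassicalElements

variable {n k ℓ p : ℕ}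

theorem exists_smul_of_mem_Tan {σ : Finset (E n)} {a b : E n} (h : (σ : Set (E n)) = {a, b})
    (v : Tan σ) : ∃ c : ℝ, (v : E n).ofLp = c • edgeTangent a b := by
  have hv : (v : E n) ∈ vectorSpan ℝ ({a, b} : Set (E n)) := h ▸ v.2
  obtain ⟨c, hc⟩ := mem_vectorSpan_pair_rev.1 hv
  exact ⟨c, by rw [← hc]; rfl⟩

theorem exists_smul_add_smul_of_mem_Tan {σ : Finset (E n)} {a b c : E n}
    (h : (σ : Set (E n)) = {a, b, c}) (v : Tan σ) :
    ∃ r s : ℝ, (v : E n).ofLp = r • edgeTangent a b + s • edgeTangent a c := by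
  have hv : (v : E n) ∈ vectorSpan ℝ ({a, b, c} : Set (E n)) := h ▸ v.2
  rw [vectorSpan_eq_span_vsub_set_right ℝ (Set.mem_insert a _), Set.image_insert_eq,
    Set.image_pair, vsub_self, Submodule.span_insert_zero] at hv
  obtain ⟨r, s, hrs⟩ := Submodule.mem_span_pair.1 hv
  exact ⟨r, s, by rw [← hrs]; rfl⟩

theorem exists_cross_eq_smul_faceNormal {σ : Finset (E 3)} {a b c : E 3}
    (h : (σ : Set (E 3)) = {a, b, c}) (v w : Tan σ) :
    ∃ r : ℝ, crossProduct (v : E 3).ofLp (w : E 3).ofLp = r • faceNormal a b c := by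
  obtain ⟨r, s, hv⟩ := exists_smul_add_smul_of_mem_Tan h v
  obtain ⟨r', s', hw⟩ := exists_smul_add_smul_of_mem_Tan h w
  exact ⟨r * s' - s * r', by rw [hv, hw, cross_smul_smul]; rfl⟩

theorem sub_mem_Tan {σ : Finset (E n)} {a b : E n} (ha : a ∈ σ) (hb : b ∈ σ) : b - a ∈ Tan σ :=
  vsub_mem_vectorSpan ℝ (Finset.mem_coe.2 hb) (Finset.mem_coe.2 ha)

theorem proxyField_eq_iff {k ℓ m m' : ℕ} (α : Coframe (E n) k m) (β : Coframe (E n) ℓ m')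
    {σ : Finset (E n)} (hσ : σ.Nonempty) {A B : Matrix (Fin m) (Fin m') ℝ} :
    proxyField α β σ A = proxyField α β σ B ↔ ∀ (v : Fin k → Tan σ) (u : Fin ℓ → Tan σ),
      α.form (fun i => (v i : E n)) ⬝ᵥ A *ᵥ β.form (fun j => (u j : E n)) =
        α.form (fun i => (v i : E n)) ⬝ᵥ B *ᵥ β.form (fun j => (u j : E n)) := by
  obtain ⟨o, ho⟩ := hσ
  constructor
  · intro h v u
    rw [← proxyField_apply α β A (Cell.vertex ⟨o, ho⟩), h, proxyField_apply]
  · intro h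
    funext x
    ext v u
    rw [proxyField_apply, proxyField_apply, h]

theorem proxyField11_eq_iff {σ : Finset (E n)} {a b : E n} (h : (σ : Set (E n)) = {a, b})
    {A B : Matrix (Fin n) (Fin n) ℝ} :
    proxyField (Coframe.std n) (Coframe.std n) σ A = proxyField (Coframe.std n) (Coframe.std n) σ B ↔
      edgeTangent a b ⬝ᵥ A *ᵥ edgeTangent a b = edgeTangent a b ⬝ᵥ B *ᵥ edgeTangent a b := by
  have ha : a ∈ σ := Finset.mem_coe.1 (h ▸ Set.mem_insert a _)
  have hb : b ∈ σ := Finset.mem_coe.1 (h ▸ by simp)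
  rw [proxyField_eq_iff _ _ ⟨a, ha⟩]
  simp only [Coframe.std_form]
  constructor
  · intro h'
    exact h' ![⟨b - a, sub_mem_Tan ha hb⟩] ![⟨b - a, sub_mem_Tan ha hb⟩]
  · intro h' v u
    obtain ⟨r, hr⟩ := exists_smul_of_mem_Tan h (v 0)
    obtain ⟨s, hs⟩ := exists_smul_of_mem_Tan h (u 0)
    rw [hr, hs]
    simp only [smul_dotProduct, mulVec_smul, dotProduct_smul, h']

theorem proxyField22_eq_iff {σ : Finset (E 3)} {a b c : E 3} (h : (σ : Set (E 3)) = {a, b, c})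
    {A B : Matrix (Fin 3) (Fin 3) ℝ} :
    proxyField Coframe.cross Coframe.cross σ A = proxyField Coframe.cross Coframe.cross σ B ↔
      faceNormal a b c ⬝ᵥ A *ᵥ faceNormal a b c = faceNormal a b c ⬝ᵥ B *ᵥ faceNormal a b c := by
  have ha : a ∈ σ := Finset.mem_coe.1 (h ▸ Set.mem_insert a _)
  have hb : b ∈ σ := Finset.mem_coe.1 (h ▸ by simp)
  have hc : c ∈ σ := Finset.mem_coe.1 (h ▸ by simp)
  rw [proxyField_eq_iff _ _ ⟨a, ha⟩]
  simp only [Coframe.cross_form]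
  constructor
  · intro h'
    exact h' ![⟨b - a, sub_mem_Tan ha hb⟩, ⟨c - a, sub_mem_Tan ha hc⟩]
      ![⟨b - a, sub_mem_Tan ha hb⟩, ⟨c - a, sub_mem_Tan ha hc⟩]
  · intro h' v u
    obtain ⟨r, hr⟩ := exists_cross_eq_smul_faceNormal h (v 0) (v 1)
    obtain ⟨s, hs⟩ := exists_cross_eq_smul_faceNormal h (u 0) (u 1)
    rw [hr, hs]
    simp only [smul_dotProduct, mulVec_smul, dotProduct_smul, h']

theorem proxyField21_eq_iff {σ : Finset (E 3)} {a b c : E 3} (h : (σ : Set (E 3)) = {a, b, c})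
    {A B : Matrix (Fin 3) (Fin 3) ℝ} :
    proxyField Coframe.cross (Coframe.std 3) σ A = proxyField Coframe.cross (Coframe.std 3) σ B ↔
      ∀ t ∈ Tan σ, faceNormal a b c ⬝ᵥ A *ᵥ t.ofLp = faceNormal a b c ⬝ᵥ B *ᵥ t.ofLp := by
  have ha : a ∈ σ := Finset.mem_coe.1 (h ▸ Set.mem_insert a _)
  have hb : b ∈ σ := Finset.mem_coe.1 (h ▸ by simp)
  have hc : c ∈ σ := Finset.mem_coe.1 (h ▸ by simp)
  rw [proxyField_eq_iff _ _ ⟨a, ha⟩]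
  simp only [Coframe.cross_form, Coframe.std_form]
  constructor
  · intro h' t ht
    exact h' ![⟨b - a, sub_mem_Tan ha hb⟩, ⟨c - a, sub_mem_Tan ha hc⟩] ![⟨t, ht⟩]
  · intro h' v u
    obtain ⟨r, hr⟩ := exists_cross_eq_smul_faceNormal h (v 0) (v 1)
    rw [hr]
    simp only [smul_dotProduct, h' _ (u 0).2]

theorem exists_coe_eq_pair {σ : Finset (E n)} (h : σ.card = 2) :
    ∃ a b : E n, (σ : Set (E n)) = {a, b} := by
  classical
  obtain ⟨a, b, -, rfl⟩ := Finset.card_eq_two.1 h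
  exact ⟨a, b, by simp⟩

theorem exists_coe_eq_triple {σ : Finset (E n)} (h : σ.card = 3) :
    ∃ a b c : E n, (σ : Set (E n)) = {a, b, c} := by
  classical
  obtain ⟨a, b, c, -, -, -, rfl⟩ := Finset.card_eq_three.1 h
  exact ⟨a, b, c, by simp⟩

/-- A basis of the tangent space of an `m`-simplex. -/
def tanBasis {σ : Finset (E n)} {m : ℕ} (hσ : IsSimplex σ) (h : σ.card = m + 1) :
    Basis (Fin m) ℝ (Tan σ) :=
  finBasisOfFinrankEq ℝ (Tan σ) (by rw [finrank_Tan hσ, h]; rfl)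

theorem finrank_BmW_edge {σ : Finset (E n)} (hσ : IsSimplex σ) (h : σ.card = 2) :
    finrank ℝ (BmW 1 1 1 σ) = 1 := by
  rw [finrank_BmW_of_card_eq hσ le_rfl rfl h, finrank_altForm (Coframe.ofBasis (tanBasis hσ h))
    (Coframe.ofBasis (tanBasis hσ h))]

theorem finrank_BmW22_triangle {σ : Finset (E n)} (hσ : IsSimplex σ) (h : σ.card = 3) :
    finrank ℝ (BmW 1 2 2 σ) = 1 := by
  rw [finrank_BmW_of_card_eq hσ (by norm_num) rfl h, finrank_altForm (Coframe.area (tanBasis hσ h))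
    (Coframe.area (tanBasis hσ h))]

theorem finrank_BmW21_triangle {σ : Finset (E n)} (hσ : IsSimplex σ) (h : σ.card = 3) :
    finrank ℝ (BmW 2 2 1 σ) = 2 := by
  rw [finrank_BmW_of_card_eq (k := 2) hσ le_rfl rfl h, finrank_altForm (Coframe.area (tanBasis hσ h))
    (Coframe.ofBasis (tanBasis hσ h))]

theorem eq_zero_of_edgeVector {N : Type*} [AddCommGroup N] [Module ℝ N] {s : Finset (E n)}
    (hs : IsSimplex s) (o : s) (f : Tan s →ₗ[ℝ] N) (h : ∀ i, f (edgeVector i o) = 0) (v : Tan s) :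
    f v = 0 := by
  rw [← tangentOf_tangentWeights hs o v, tangentOf_apply, map_sum]
  exact Finset.sum_eq_zero fun i _ => by rw [map_smul, h, smul_zero]

/-- With at least three vertices all edges are proper faces, and a symmetric bilinear form whose
quadratic form vanishes on every edge is zero by polarization. -/
theorem BmW11_eq_bot {s : Finset (E n)} (hs : IsSimplex s) (hc : s.card ≠ 2) :
    BmW 1 1 1 s = ⊥ := by
  classical
  have hpos := hs.1.card_pos
  rcases Nat.lt_or_ge s.card 2 with h | h
  · exact BmW_eq_bot_of_card_le hs (by omega)
  rw [Submodule.eq_bot_iff]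
  intro ω hω
  obtain ⟨hω, htr⟩ := mem_BmW_iff.1 hω
  obtain ⟨a, ha, rfl⟩ := (mem_PmW_iff_const hs le_rfl rfl).1 hω
  obtain ⟨o', ho⟩ := hs.1
  let o : s := ⟨o', ho⟩
  let f : Tan s →ₗ[ℝ] ((Tan s) [⋀^Fin 1]→ₗ[ℝ] ℝ) := (AlternatingMap.ofSubsingleton ℝ _ _ 0).symm a
  let g : ((Tan s) [⋀^Fin 1]→ₗ[ℝ] ℝ) → Tan s →ₗ[ℝ] ℝ :=
    fun η => (AlternatingMap.ofSubsingleton ℝ _ _ 0).symm η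
  have hfg : ∀ (v : Fin 1 → Tan s) (u : Fin 1 → Tan s), a v u = g (f (v 0)) (u 0) := fun v u => by
    change _ = a (fun _ => v 0) (fun _ => u 0)
    rw [show v = fun _ => v 0 from funext fun i => by rw [Subsingleton.elim i 0],
      show u = fun _ => u 0 from funext fun i => by rw [Subsingleton.elim i 0]]
  have hadd : ∀ x y u, g (f (x + y)) u = g (f x) u + g (f y) u := fun x y u => by
    rw [map_add]; rfl
  have hsymm : ∀ x y, g (f x) y = g (f y) x := fun x y => by
    have := DFunLike.congr_fun (DFunLike.congr_fun ha ![]) ![x, y]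
    change SdagSucc 0 1 (Tan s) a ![] ![x, y] = 0 at this
    rw [SdagSucc_zero_one_apply, hfg, hfg] at this
    exact sub_eq_zero.1 this
  have hq : ∀ i j : s, g (f (edgeVector i j)) (edgeVector i j) = 0 := fun i j => by
    have hsub : ({(i : E n), (j : E n)} : Finset (E n)) ⊂ s := by
      refine Finset.ssubset_iff_subset_ne.2 ⟨fun x hx => ?_, fun he => ?_⟩
      · rcases Finset.mem_insert.1 hx with rfl | hx
        · exact i.2
        · rw [Finset.mem_singleton.1 hx]; exact j.2
      · have := Finset.card_le_two (a := (i : E n)) (b := (j : E n))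
        rw [he] at this
        omega
    have h0 := htr _ hsub ⟨i, Finset.mem_insert_self _ _⟩
    let e : Tan ({(i : E n), (j : E n)} : Finset (E n)) :=
      ⟨(i : E n) - j, sub_mem_Tan (by simp) (by simp)⟩
    have := DFunLike.congr_fun (DFunLike.congr_fun (congrFun h0
      (Cell.vertex ⟨i, Finset.mem_insert_self _ _⟩)) fun _ => e) fun _ => e
    change a (fun _ => edgeVector i j) (fun _ => edgeVector i j) = 0 at this
    rwa [hfg] at this
  -- Expanding the quadratic form on `(i - j) + (j - o)` leaves only twice the mixed term.
  have hcross : ∀ i j : s, g (f (edgeVector i o)) (edgeVector j o) = 0 := fun i j => by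
    have he : edgeVector i o = edgeVector i j + edgeVector j o := by
      ext1; simp [edgeVector]
    have h1 := hq i o
    rw [he, hadd, map_add, map_add, hq, hq, hsymm (edgeVector j o)] at h1
    rw [he, hadd, hq]
    linarith
  have hz : a = 0 := by
    ext v u
    rw [hfg]
    have : f (v 0) = 0 := eq_zero_of_edgeVector hs o f (fun i => by
      ext u
      have h1 := eq_zero_of_edgeVector hs o (g (f (edgeVector i o))) (hcross i) (u 0)
      rw [← hfg (fun _ => edgeVector i o)] at h1
      exact h1) _
    rw [this]
    rfl
  rw [hz]
  rfl

theorem finrank_symMat_three : finrank ℝ (symMat 3) = 6 := by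
  let e : symMat 3 ≃ₗ[ℝ] (Fin 6 → ℝ) :=
    { toFun := fun A => ![A.1 0 0, A.1 0 1, A.1 0 2, A.1 1 1, A.1 1 2, A.1 2 2]
      map_add' := fun A B => by ext i; fin_cases i <;> simp
      map_smul' := fun c A => by ext i; fin_cases i <;> simp
      invFun := fun c => ⟨!![c 0, c 1, c 2; c 1, c 3, c 4; c 2, c 4, c 5],
        Matrix.IsSymm.ext fun i j => by fin_cases i <;> fin_cases j <;> rfl⟩
      left_inv := fun A => by
        have h : ∀ i j, A.1 j i = A.1 i j := fun i j => Matrix.IsSymm.apply A.2 i j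
        ext i j
        fin_cases i <;> fin_cases j <;> first | rfl | exact h _ _
      right_inv := fun c => by ext i; fin_cases i <;> rfl }
  rw [e.finrank_eq, finrank_fin_fun]

theorem finrank_traceFreeMat_three : finrank ℝ (traceFreeMat 3) = 8 := by
  have h := LinearMap.finrank_range_add_finrank_ker (Matrix.traceLinearMap (Fin 3) ℝ ℝ)
  have hr : LinearMap.range (Matrix.traceLinearMap (Fin 3) ℝ ℝ) = ⊤ := by
    refine LinearMap.range_eq_top.2 fun c => ⟨Matrix.diagonal ![c, 0, 0], ?_⟩
    simp [Matrix.trace, Fin.sum_univ_three]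
  rw [hr, finrank_top, Module.finrank_matrix] at h
  simp at h
  change finrank ℝ (LinearMap.ker (Matrix.traceLinearMap (Fin 3) ℝ ℝ)) = 8
  omega

/-- On a tetrahedron, forms of degree two in the first index have degrees of freedom on the four
triangles and in the interior only. -/
theorem finrank_PmW_tetrahedron {K : Finset (E n)} (hK : IsSimplex K) (hc : K.card = 4)
    (hkl : 3 ≤ ℓ + p) {d : ℕ}
    (hd : ∀ σ : Finset (E n), IsSimplex σ → σ.card = 3 → finrank ℝ (BmW p 2 ℓ σ) = d) :
    finrank ℝ (PmW p 2 ℓ K) = 4 * d + finrank ℝ (BmW p 2 ℓ K) := by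
  rw [finrank_PmW hK hkl, hc]
  have hface : ∀ m, 1 ≤ m → ∀ σ ∈ K.powersetCard m, IsSimplex σ ∧ σ.card = m := by
    intro m hm σ hσ
    obtain ⟨h1, h2⟩ := Finset.mem_powersetCard.1 hσ
    exact ⟨hK.subset h1 (Finset.card_pos.1 (by omega)), h2⟩
  have hlow : ∀ m, 1 ≤ m → m ≤ 2 →
      ∑ σ ∈ K.powersetCard m, finrank ℝ (BmW p 2 ℓ σ) = 0 := fun m hm hm' =>
    Finset.sum_eq_zero fun σ hσ => by
      obtain ⟨h1, h2⟩ := hface m hm σ hσ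
      rw [BmW_eq_bot_of_card_le h1 (by omega), finrank_bot]
  have h3 : ∑ σ ∈ K.powersetCard 3, finrank ℝ (BmW p 2 ℓ σ) = 4 * d := by
    rw [Finset.sum_congr rfl fun σ hσ => hd σ (hface 3 (by norm_num) σ hσ).1
      (hface 3 (by norm_num) σ hσ).2, Finset.sum_const, Finset.card_powersetCard, hc]
    rfl
  have h4 : ∑ σ ∈ K.powersetCard 4, finrank ℝ (BmW p 2 ℓ σ) = finrank ℝ (BmW p 2 ℓ K) := by
    rw [← hc, Finset.powersetCard_self, Finset.sum_singleton]
  rw [show Finset.Icc 1 4 = {1, 2, 3, 4} by decide]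
  rw [Finset.sum_insert (by decide), Finset.sum_insert (by decide), Finset.sum_insert (by decide),
    Finset.sum_singleton, hlow 1 le_rfl (by norm_num), hlow 2 (by norm_num) le_rfl, h3, h4]
  ring

theorem exists_proxy22_equiv {K : Finset (E 3)} (hK : IsSimplex K) (hc : K.card = 4) :
    ∃ Φ : symMat 3 ≃ₗ[ℝ] PmW 1 2 2 K, ∀ A : symMat 3, (Φ A : Field 2 2 K) =
      proxyField Coframe.cross Coframe.cross K (A : Matrix (Fin 3) (Fin 3) ℝ) :=
  exists_proxy_equiv _ _ hK hc (by norm_num) rfl _ Sdag_proxy22_eq_zero_iff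

theorem exists_proxy21_equiv {K : Finset (E 3)} (hK : IsSimplex K) (hc : K.card = 4) :
    ∃ Φ : traceFreeMat 3 ≃ₗ[ℝ] PmW 2 2 1 K, ∀ A : traceFreeMat 3, (Φ A : Field 2 1 K) =
      proxyField Coframe.cross (Coframe.std 3) K (A : Matrix (Fin 3) (Fin 3) ℝ) :=
  exists_proxy_equiv (p := 2) (k := 2) (ℓ := 1) Coframe.cross (Coframe.std 3) hK hc le_rfl rfl
    (traceFreeMat 3) Sdag_proxy21_eq_zero_iff

/-- Symmetric matrices have dimension 6, the four triangles account for one each, and unisolvency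
leaves 2 for the interior. -/
theorem finrank_BmW22_tetrahedron {K : Finset (E 3)} (hK : IsSimplex K) (hc : K.card = 4) :
    finrank ℝ (BmW 1 2 2 K) = 2 := by
  have h := finrank_PmW_tetrahedron (p := 1) (ℓ := 2) hK hc le_rfl
    fun σ hσ h3 => finrank_BmW22_triangle hσ h3
  obtain ⟨Φ, -⟩ := exists_proxy22_equiv hK hc
  rw [← Φ.finrank_eq, finrank_symMat_three] at h
  omega

/-- Trace-free matrices have dimension 8, which the four triangles exhaust with two each. -/
theorem BmW21_eq_bot_of_tetrahedron {K : Finset (E 3)} (hK : IsSimplex K) (hc : K.card = 4) :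
    BmW 2 2 1 K = ⊥ := by
  have h := finrank_PmW_tetrahedron (p := 2) (ℓ := 1) hK hc le_rfl
    fun σ hσ h3 => finrank_BmW21_triangle hσ h3
  obtain ⟨Φ, -⟩ := exists_proxy21_equiv hK hc
  rw [← Φ.finrank_eq, finrank_traceFreeMat_three] at h
  have := finite_of_le_PmAlt hK ((BmW_le_PmW (p := 2)).trans PmW_le_PmAlt : BmW 2 2 1 K ≤ _)
  have h0 : finrank ℝ (BmW 2 2 1 K) = 0 := by omega
  let _ : AddCommGroup (BmW 2 2 1 K) := Module.addCommMonoidToAddCommGroup ℝ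
  have := finrank_zero_iff.1 h0
  exact (Submodule.eq_bot_iff _).2 fun x hx =>
    congrArg Subtype.val (Subsingleton.elim (⟨x, hx⟩ : BmW 2 2 1 K) 0)

theorem proxyField22_mem_BmW_iff {K : Finset (E 3)} (hK : IsSimplex K) (hc : K.card = 4)
    {A : Matrix (Fin 3) (Fin 3) ℝ}
    (hA : proxyField Coframe.cross Coframe.cross K A ∈ PmW 1 2 2 K) :
    proxyField Coframe.cross Coframe.cross K A ∈ BmW 1 2 2 K ↔
      ∀ σ : Face K, σ.1.card = 3 → ∀ a b c : E 3, (σ.1 : Set (E 3)) = {a, b, c} →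
        faceNormal a b c ⬝ᵥ A *ᵥ faceNormal a b c = 0 := by
  rw [mem_BmW_iff]
  constructor
  · rintro ⟨-, h⟩ σ h3 a b c habc
    have hss : σ.1 ⊂ K := Finset.ssubset_iff_subset_ne.2 ⟨σ.2.2, fun he => by
      rw [he] at h3; omega⟩
    have h0 := h σ.1 hss σ.2.1
    rw [trace_proxyField, ← map_zero (proxyField Coframe.cross Coframe.cross σ.1),
      proxyField22_eq_iff habc] at h0
    simpa using h0
  · refine fun h => ⟨hA, fun t ht hne => ?_⟩
    have hlt := Finset.card_lt_card ht
    rcases Nat.lt_or_ge t.card 3 with h3 | h3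
    · exact field_eq_zero_of_card_le (hK.subset ht.subset hne) (by omega) _
    · have h3 : t.card = 3 := by omega
      obtain ⟨a, b, c, habc⟩ := exists_coe_eq_triple h3
      rw [trace_proxyField, ← map_zero (proxyField Coframe.cross Coframe.cross t),
        proxyField22_eq_iff habc]
      simpa using h ⟨t, hne, ht.subset⟩ h3 a b c habc

end ClassicalElements

end FormValued
end

open FormValued in
theorem mainTheorem4 :
    -- unisolvency and conformity, in every dimension
    (∀ (n p k ℓ : ℕ), 1 ≤ p → k + 1 ≤ ℓ + p →
      (∀ K : Finset (E n), IsSimplex K →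
        ∀ L : (σ : Face K) → Module.Dual ℝ (BmW p k ℓ σ.1),
          ∃! ω : PmW p k ℓ K, ∀ (σ : Face K) (b : BmW p k ℓ σ.1),
            dof σ.2.2 (ω : Field k ℓ K) (b : Field k ℓ σ.1) = L σ b) ∧
      (∀ T : Geometry.SimplicialComplex ℝ (E n),
        feSpace p k ℓ T =
          {ω | ∀ K, ω K ∈ PmW p k ℓ K.1} ∩ (IICconforming k ℓ T : Set (PiecewiseField k ℓ T)))) ∧
    -- the Regge element: `p = 1`, `k = ℓ = 1`, any dimension
    (∀ n : ℕ,
      (∀ K : Finset (E n), IsSimplex K → K.card = n + 1 →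
        (∃ Φ : symMat n ≃ₗ[ℝ] PmW 1 1 1 K, ∀ A : symMat n,
          HasProxy11 (Φ A : Field 1 1 K) (A : Matrix (Fin n) (Fin n) ℝ)) ∧
        (∀ σ : Face K, σ.1.card ≠ 2 → BmW 1 1 1 σ.1 = ⊥) ∧
        (∀ σ : Face K, σ.1.card = 2 → Module.finrank ℝ (BmW 1 1 1 σ.1) = 1 ∧
          ∀ a b : E n, (σ.1 : Set (E n)) = {a, b} →
            ∀ ω ∈ PmW 1 1 1 K, ∀ A : Matrix (Fin n) (Fin n) ℝ, HasProxy11 ω A →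
              ((∀ β ∈ BmW 1 1 1 σ.1, dof σ.2.2 ω β = 0) ↔
                edgeTangent a b ⬝ᵥ A *ᵥ edgeTangent a b = 0))) ∧
      (∀ T : Geometry.SimplicialComplex ℝ (E n),
        feSpace 1 1 1 T = {ω | ∃ A : TopCell T → symMat n,
          (∀ K, HasProxy11 (ω K) (A K : Matrix (Fin n) (Fin n) ℝ)) ∧
          ∀ (K K' : TopCell T) (σ : Finset (E n)), σ ⊆ K.1 → σ ⊆ K'.1 → σ.card = 2 →
            ∀ a b : E n, (σ : Set (E n)) = {a, b} →
              edgeTangent a b ⬝ᵥ (A K : Matrix (Fin n) (Fin n) ℝ) *ᵥ edgeTangent a b =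
                edgeTangent a b ⬝ᵥ (A K' : Matrix (Fin n) (Fin n) ℝ) *ᵥ edgeTangent a b})) ∧
    -- the Hellan-Herrmann-Johnson element: `p = 1`, `k = ℓ = 2`, dimension three
    ((∀ K : Finset (E 3), IsSimplex K → K.card = 4 →
        (∃ Φ : symMat 3 ≃ₗ[ℝ] PmW 1 2 2 K,
          (∀ A : symMat 3, HasProxy22 (Φ A : Field 2 2 K) (A : Matrix (Fin 3) (Fin 3) ℝ)) ∧
          (∀ A : symMat 3, (Φ A : Field 2 2 K) ∈ BmW 1 2 2 K ↔
            ∀ σ : Face K, σ.1.card = 3 → ∀ a b c : E 3, (σ.1 : Set (E 3)) = {a, b, c} →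
              faceNormal a b c ⬝ᵥ (A : Matrix (Fin 3) (Fin 3) ℝ) *ᵥ faceNormal a b c = 0)) ∧
        Module.finrank ℝ (BmW 1 2 2 K) = 2 ∧
        (∀ σ : Face K, σ.1.card ≤ 2 → BmW 1 2 2 σ.1 = ⊥) ∧
        (∀ σ : Face K, σ.1.card = 3 → Module.finrank ℝ (BmW 1 2 2 σ.1) = 1 ∧
          ∀ a b c : E 3, (σ.1 : Set (E 3)) = {a, b, c} →
            ∀ ω ∈ PmW 1 2 2 K, ∀ A : Matrix (Fin 3) (Fin 3) ℝ, HasProxy22 ω A →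
              ((∀ β ∈ BmW 1 2 2 σ.1, dof σ.2.2 ω β = 0) ↔
                faceNormal a b c ⬝ᵥ A *ᵥ faceNormal a b c = 0))) ∧
      (∀ T : Geometry.SimplicialComplex ℝ (E 3),
        feSpace 1 2 2 T = {ω | ∃ A : TopCell T → symMat 3,
          (∀ K, HasProxy22 (ω K) (A K : Matrix (Fin 3) (Fin 3) ℝ)) ∧
          ∀ (K K' : TopCell T) (σ : Finset (E 3)), σ ⊆ K.1 → σ ⊆ K'.1 → σ.card = 3 →
            ∀ a b c : E 3, (σ : Set (E 3)) = {a, b, c} →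
              faceNormal a b c ⬝ᵥ (A K : Matrix (Fin 3) (Fin 3) ℝ) *ᵥ faceNormal a b c =
                faceNormal a b c ⬝ᵥ (A K' : Matrix (Fin 3) (Fin 3) ℝ) *ᵥ faceNormal a b c})) ∧
    -- the MCS element: `p = 2`, `k = 2`, `ℓ = 1`, dimension three
    ((∀ K : Finset (E 3), IsSimplex K → K.card = 4 →
        (∃ Φ : traceFreeMat 3 ≃ₗ[ℝ] PmW 2 2 1 K, ∀ A : traceFreeMat 3,
          HasProxy21 (Φ A : Field 2 1 K) (A : Matrix (Fin 3) (Fin 3) ℝ)) ∧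
        (∀ σ : Face K, σ.1.card ≠ 3 → BmW 2 2 1 σ.1 = ⊥) ∧
        (∀ σ : Face K, σ.1.card = 3 → Module.finrank ℝ (BmW 2 2 1 σ.1) = 2 ∧
          ∀ a b c : E 3, (σ.1 : Set (E 3)) = {a, b, c} →
            ∀ ω ∈ PmW 2 2 1 K, ∀ A : Matrix (Fin 3) (Fin 3) ℝ, HasProxy21 ω A →
              ((∀ β ∈ BmW 2 2 1 σ.1, dof σ.2.2 ω β = 0) ↔
                ∀ t ∈ Tan σ.1, faceNormal a b c ⬝ᵥ A *ᵥ t.ofLp = 0))) ∧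
      (∀ T : Geometry.SimplicialComplex ℝ (E 3),
        feSpace 2 2 1 T = {ω | ∃ A : TopCell T → traceFreeMat 3,
          (∀ K, HasProxy21 (ω K) (A K : Matrix (Fin 3) (Fin 3) ℝ)) ∧
          ∀ (K K' : TopCell T) (σ : Finset (E 3)), σ ⊆ K.1 → σ ⊆ K'.1 → σ.card = 3 →
            ∀ a b c : E 3, (σ : Set (E 3)) = {a, b, c} → ∀ t ∈ Tan σ,
              faceNormal a b c ⬝ᵥ (A K : Matrix (Fin 3) (Fin 3) ℝ) *ᵥ t.ofLp =
                faceNormal a b c ⬝ᵥ (A K' : Matrix (Fin 3) (Fin 3) ℝ) *ᵥ t.ofLp})) := by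
  refine ⟨fun n p k ℓ _ hkl => ⟨fun K hK L => existsUnique_of_dofs hK hkl L, feSpace_eq⟩,
    fun n => ⟨fun K hK hc => ⟨?_, fun σ hσ => BmW11_eq_bot (hK.face σ) hσ, fun σ hσ =>
      ⟨finrank_BmW_edge (hK.face σ) hσ, fun a b hab ω hω A hA => ?_⟩⟩, fun T => ?_⟩,
    ⟨fun K hK hc => ⟨?_, finrank_BmW22_tetrahedron hK hc,
      fun σ hσ => BmW_eq_bot_of_card_le (hK.face σ) hσ, fun σ hσ =>
      ⟨finrank_BmW22_triangle (hK.face σ) hσ, fun a b c habc ω hω A hA => ?_⟩⟩, fun T => ?_⟩,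
    ⟨fun K hK hc => ⟨?_, fun σ hσ => ?_, fun σ hσ =>
      ⟨finrank_BmW21_triangle (hK.face σ) hσ, fun a b c habc ω hω A hA => ?_⟩⟩, fun T => ?_⟩⟩
  · simp only [hasProxy11_iff]
    exact exists_proxy_equiv (p := 1) (Coframe.std n) (Coframe.std n) hK hc le_rfl rfl (symMat n)
      Sdag_proxy11_eq_zero_iff
  · rw [dof_eq_zero_iff_proxy (Coframe.std n) (Coframe.std n) hK σ.2.2 σ.2.1 hσ hω
      (hasProxy11_iff.1 hA), proxyField11_eq_iff hab, Matrix.zero_mulVec, dotProduct_zero]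
  · simp only [hasProxy11_iff]
    refine feSpace_eq_proxy (p := 1) (Coframe.std n) (Coframe.std n) le_rfl rfl (symMat n)
      Sdag_proxy11_eq_zero_iff (fun σ A B => ∀ a b : E n, (σ : Set (E n)) = {a, b} →
        edgeTangent a b ⬝ᵥ A *ᵥ edgeTangent a b = edgeTangent a b ⬝ᵥ B *ᵥ edgeTangent a b)
      (fun σ _ hc A B => ⟨fun h a b hab => (proxyField11_eq_iff hab).1 h, fun h => ?_⟩)
      (fun σ hσ hc _ => BmW11_eq_bot hσ hc.ne') T
    obtain ⟨a, b, hab⟩ := exists_coe_eq_pair hc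
    exact (proxyField11_eq_iff hab).2 (h a b hab)
  · obtain ⟨Φ, hΦ⟩ := exists_proxy22_equiv hK hc
    refine ⟨Φ, fun A => hasProxy22_iff.2 (hΦ A), fun A => ?_⟩
    have hmem := (Φ A).2
    rw [hΦ] at hmem ⊢
    exact proxyField22_mem_BmW_iff hK hc hmem
  · rw [dof_eq_zero_iff_proxy Coframe.cross Coframe.cross hK σ.2.2 σ.2.1 hσ hω
      (hasProxy22_iff.1 hA), proxyField22_eq_iff habc, Matrix.zero_mulVec, dotProduct_zero]
  · simp only [hasProxy22_iff]
    refine feSpace_eq_proxy (p := 1) Coframe.cross Coframe.cross (by norm_num) rfl (symMat 3)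
      Sdag_proxy22_eq_zero_iff (fun σ A B => ∀ a b c : E 3, (σ : Set (E 3)) = {a, b, c} →
        faceNormal a b c ⬝ᵥ A *ᵥ faceNormal a b c = faceNormal a b c ⬝ᵥ B *ᵥ faceNormal a b c)
      (fun σ _ hc A B => ⟨fun h a b c habc => (proxyField22_eq_iff habc).1 h, fun h => ?_⟩)
      -- No face has a number of vertices strictly between 3 and 4.
      (fun σ hσ hc _ => by omega) T
    obtain ⟨a, b, c, habc⟩ := exists_coe_eq_triple hc
    exact (proxyField22_eq_iff habc).2 (h a b c habc)
  · simp only [hasProxy21_iff]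
    exact exists_proxy21_equiv hK hc
  · rcases Nat.lt_or_ge σ.1.card 3 with h3 | h3
    · exact BmW_eq_bot_of_card_le (hK.face σ) (by omega)
    · have hle := Finset.card_le_card σ.2.2
      exact BmW21_eq_bot_of_tetrahedron (hK.face σ) (by omega)
  · rw [dof_eq_zero_iff_proxy Coframe.cross (Coframe.std 3) hK σ.2.2 σ.2.1 hσ hω
      (hasProxy21_iff.1 hA), proxyField21_eq_iff habc]
    simp only [Matrix.zero_mulVec, dotProduct_zero]
  · simp only [hasProxy21_iff]
    refine feSpace_eq_proxy (p := 2) Coframe.cross (Coframe.std 3) le_rfl rfl (traceFreeMat 3)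
      Sdag_proxy21_eq_zero_iff (fun σ A B => ∀ a b c : E 3, (σ : Set (E 3)) = {a, b, c} →
        ∀ t ∈ Tan σ, faceNormal a b c ⬝ᵥ A *ᵥ t.ofLp = faceNormal a b c ⬝ᵥ B *ᵥ t.ofLp)
      (fun σ _ hc A B => ⟨fun h a b c habc => (proxyField21_eq_iff habc).1 h, fun h => ?_⟩)
      (fun σ hσ hc _ => by omega) T
    obtain ⟨a, b, c, habc⟩ := exists_coe_eq_triple hc
    exact (proxyField21_eq_iff habc).2 (h a b c habc)
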